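/- **Setting.** There are $n\ge 1$ agents with functions $f_i,g_i:\mathbb R^p\times\mathbb R^q\to\mathbb R$, and $\Phi(x)=\frac1n\sum_i f_i(x,y^*(x))$ with $y^*(x)=\arg\min_y\frac1n\sum_i g_i(x,y)$. Assume that $f_i,\nabla f_i,\nabla g_i,\nabla^2g_i$ are Lipschitz continuous with constants $L_{f,0},L,L,L_{g,2}$ ($f_i$ differentiable, $g_i$ of class $C^2$), that each $g_i(x,\cdot)$ is $\mu$-strongly convex, $0<\mu\le L$, and that $\Phi$ is bounded below. Let $W=(w_{ij})$ be symmetric and doubly stochastic with eigenvalues $1=\lambda_1\ge\dots\ge\lambda_n$ and $\rho=\max_{k\ge2}|\lambda_k|<1$ ($\rho=0$ if $n=1$). Put $\kappa=L/\mu$ and $$L_\Phi=L+\tfrac{2L^2+L_{g,2}L_{f,0}^2}{\mu}+\tfrac{LL_{f,0}L_{g,2}+L^3+L_{g,2}L_{f,0}L}{\mu^2}+\tfrac{L_{g,2}L^2L_{f,0}}{\mu^3},\qquad L_f=L+\tfrac{L^2}{\mu}+L_{f,0}\Big(\tfrac{L_{g,2}}{\mu}+\tfrac{L_{g,2}L}{\mu^2}\Big).$$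 **DBOGT.** Outer iteration: $x_{i,0}=0$, $u_{i,0}=h_{i,0}$, $x_{i,k+1}=\sum_jw_{ij}x_{j,k}-\eta_xu_{i,k}$, $u_{i,k+1}=\sum_jw_{ij}u_{j,k}+h_{i,k+1}-h_{i,k}$, where $h_{i,k}=\hat\nabla f_i(x_{i,k},y_{i,k}^{(T)})$ is the hypergradient estimate below. Write $\bar x_k=\frac1n\sum_ix_{i,k}$ and $\partial\Phi(X_0)=[h_{1,0},\dots,h_{n,0}]$, with spectral norm $\|\partial\Phi(X_0)\|$. The inner iterates are warm started: $y_{i,k}^{(0)}=y_{i,k-1}^{(T)}$ for $k\ge1$, and $y_{i,0}^{(0)}$ is arbitrary. * *Homogeneous branch* (used if $g_1=\dots=g_n$): $y^{(t+1)}_{i,k}=y^{(t)}_{i,k}-\eta_y\nabla_yg_i(x_{i,k},y^{(t)}_{i,k})$ for $t<T$; $v_{i,k}^{(N)}$ is obtained by $N$ conjugate gradient steps for $\nabla_y^2g_i(x_{i,k},y_{i,k}^{(T)})v=\nabla_yf_i(x_{i,k},y_{i,k}^{(T)})$ from $v_{i,k}^{(0)}=v_{i,k-1}^{(N)}$ ($v_{i,0}^{(0)}$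 arbitrary); $h_{i,k}=\nabla_xf_i-\nabla_{xy}g_i\,v_{i,k}^{(N)}$ at $(x_{i,k},y_{i,k}^{(T)})$. * *Heterogeneous branch* (any $g_i$): for $t<T$, $y^{(t+1)}_{i,k}=\sum_jw_{ij}y^{(t)}_{j,k}-\eta_ys^{(t)}_{i,k}$ and $s^{(t+1)}_{i,k}=\sum_jw_{ij}s^{(t)}_{j,k}+\nabla_yg_i(x_{i,k},y^{(t+1)}_{i,k})-\nabla_yg_i(x_{i,k},y^{(t)}_{i,k})$, with $s_{i,0}^{(0)}=\nabla_yg_i(x_{i,0},y_{i,0}^{(0)})$; for $k\ge1$ the trackers are either *carried over*, $s_{i,k}^{(0)}=s_{i,k-1}^{(T)}+\nabla_yg_i(x_{i,k},y^{(0)}_{i,k})-\nabla_yg_i(x_{i,k-1},y^{(0)}_{i,k})$, or *restarted*, $s_{i,k}^{(0)}=\nabla_yg_i(x_{i,k},y_{i,k}^{(0)})$. Then $h_{i,k}=\nabla_xf_i-[Z_{i,k}^{(N)}]^{\mathsf T}\nabla_yf_i$ at $(x_{i,k},y_{i,k}^{(T)})$, where $Z_{i,k}^{(N)}\in\mathbb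 R^{q\times p}$ is obtained by $N$ steps, with step size $\gamma$, of the same gradient tracking scheme for $\min_Z\frac1n\sum_i\big(\frac12\mathrm{Tr}(Z^{\mathsf T}H_iZ)-\mathrm{Tr}(J_iZ)\big)$, $H_i=\nabla_y^2g_i(x_{i,k},y_{i,k}^{(T)})$, $J_i=\nabla_{xy}g_i(x_{i,k},y_{i,k}^{(T)})$, started in every outer iteration at given $Z_i^{(0)}$ with the local gradients as trackers. **Theorem.** Under these assumptions $\Phi$ is differentiable, and the following holds. 1. *(Homogeneous lower levels.)* There are constants $c,C>0$ depending only on $L,L_{f,0},L_{g,2}$ such that, if $g_1=\dots=g_n$ and the homogeneous branch is used with $0<\eta_x<\frac{(1-\rho)^2}{4\sqrt{2n}L_\Phi}$, $0<\eta_y\le\frac2{\mu+L}$, and $T,N$ so large that $$\Big(1-\frac{2\eta_y\mu L}{\mu+L}\Big)^T\le\frac{1}{c\,\kappa^{5}},\qquad\Big(\frac{\sqrt\kappa-1}{\sqrt\kappa+1}\Big)^{2N}\le\frac1{c\,\kappa^{4}}$$ (that is, $T$ and $N$ are at least of order $\log\kappa$ relative to the logarithmic rates of the two inner solvers), then for all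 $K\ge0$ $$\frac1{K+1}\sum_{k=0}^K\|\nabla\Phi(\bar x_k)\|^2\le\frac{4}{\eta_x(K+1)}\big(\Phi(\bar x_0)-\inf\Phi\big)+\frac{C_2}{K+1},\qquad C_2=C\,\big(c_1+c_2+\|\partial\Phi(X_0)\|^2\big),$$ where, with $y_i^*(x)=\arg\min_yg_i(x,y)$, $c_1=\sum_i\|y_{i,0}^{(0)}-y_i^*(x_{i,0})\|^2$, $c_2=\sum_i\|v_{i,0}^*-v_{i,0}^{(0)}\|^2$, $v_{i,0}^*=[\nabla_y^2g_i]^{-1}\nabla_yf_i$ at $(x_{i,0},y_i^*(x_{i,0}))$. In particular the rate is $O(1/K)$. 2. *(Heterogeneous lower levels.)* There are $\bar\eta,\bar\gamma>0$ depending only on $L,\mu,\rho$ such that for all constant step sizes $0<\eta_y\le\bar\eta$, $0<\gamma\le\bar\gamma$ there is $\alpha\in(0,1)$ depending only on $L,\mu,\rho,\eta_y,\gamma$ such that, if $0<\eta_x<\frac{(1-\rho)^2}{4\sqrt{6n}\,\kappa L_f}$, then there is $C>0$ depending only on $L,\mu,\rho,\eta_y,\gamma,n,L_{f,0},L_{g,2},\eta_x$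 with the following property. In the heterogeneous branch, for all $T,N,K\ge0$, $$\frac1{K+1}\sum_{k=0}^K\|\nabla\Phi(\bar x_k)\|^2\le\frac{6}{\eta_x(K+1)}\big(\Phi(\bar x_0)-\inf\Phi\big)+\frac{\|\partial\Phi(X_0)\|^2}{K+1}+\tilde C_2,$$ $$\tilde C_2=C\,(1+D_0+\zeta)\Big(\alpha^T+\alpha^N+\frac1{K+1}\Big),\qquad D_0=\sum_i\big(\|y_{i,0}^{(0)}-y^*(x_{i,0})\|^2+\|\nabla_yg_i(x_{i,0},y_{i,0}^{(0)})\|^2+\|Z_i^{(0)}\|^2\big).$$ Here $\zeta=0$ if the inner trackers are carried over. If they are restarted, $\zeta\ge0$ is any upper bound, for $0\le k\le K$, of $\sum_i\|\nabla_yg_i(x_{i,k},\tilde y_k)\|^2$, where $\tilde y_k=\arg\min_y\frac1n\sum_ig_i(x_{i,k},y)$. -/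

import Mathlib

namespace DBOGT

/-- `ℝ^d` with its Euclidean norm. -/
abbrev Vec (d : ℕ) := EuclideanSpace ℝ (Fin d)

noncomputable section

/-! ### Functions of two variables and the regularity assumptions -/

/-- A function `h (x, y)` as a function on `ℝ^p × ℝ^q` with the Euclidean norm
`‖(x, y)‖² = ‖x‖² + ‖y‖²`. -/
def joint {p q : ℕ} (h : Vec p → Vec q → ℝ) : WithLp 2 (Vec p × Vec q) → ℝ :=
  fun z => h z.fst z.snd

/-- `F` is Lipschitz continuous with constant `K`. -/
def Lip {E F : Type*} [SeminormedAddCommGroup E] [SeminormedAddCommGroup F]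
    (K : ℝ) (φ : E → F) : Prop :=
  ∀ z z', ‖φ z - φ z'‖ ≤ K * ‖z - z'‖

/-- `∇_x h (x, y)`. -/
def gradX {p q : ℕ} (h : Vec p → Vec q → ℝ) (x : Vec p) (y : Vec q) : Vec p :=
  gradient (fun x' => h x' y) x

/-- `∇_y h (x, y)`. -/
def gradY {p q : ℕ} (h : Vec p → Vec q → ℝ) (x : Vec p) (y : Vec q) : Vec q :=
  gradient (fun y' => h x y') y

/-- `∇_y² h (x, y)`, a `q × q` matrix, as a linear map. -/
def hessY {p q : ℕ} (h : Vec p → Vec q → ℝ) (x : Vec p) (y : Vec q) : Vec q →L[ℝ] Vec q :=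
  fderiv ℝ (fun y' => gradY h x y') y

/-- `∇_{xy} h (x, y)`, a `p × q` matrix, as a linear map `ℝ^q → ℝ^p`. -/
def jacXY {p q : ℕ} (h : Vec p → Vec q → ℝ) (x : Vec p) (y : Vec q) : Vec q →L[ℝ] Vec p :=
  fderiv ℝ (fun y' => gradX h x y') y

/-- The smoothness and strong convexity assumptions on the upper level functions `f i` and the
lower level functions `g i`: `f i`, `∇ f i`, `∇ g i`, `∇² g i` are Lipschitz continuous (in `(x, y)`
jointly) with constants `Lf0`, `L`, `L`, `Lg2`, and every `g i x` is `μ`-strongly convex. -/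
structure Regular {n p q : ℕ} (L Lf0 Lg2 μ : ℝ) (f g : Fin n → Vec p → Vec q → ℝ) : Prop where
  f_diff : ∀ i, Differentiable ℝ (joint (f i))
  f_lip : ∀ i, Lip Lf0 (joint (f i))
  f_grad_lip : ∀ i, Lip L (gradient (joint (f i)))
  g_diff : ∀ i, ContDiff ℝ 2 (joint (g i))
  g_grad_lip : ∀ i, Lip L (gradient (joint (g i)))
  g_hess_lip : ∀ i, Lip Lg2 (fderiv ℝ (gradient (joint (g i))))
  g_strong : ∀ i x, StrongConvexOn Set.univ μ (g i x)

/-! ### The bilevel problem -/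

/-- A minimizer of `φ` (the minimizer whenever it is unique). -/
def argmin {q : ℕ} (φ : Vec q → ℝ) : Vec q :=
  Classical.epsilon fun y => ∀ y', φ y ≤ φ y'

/-- The global lower level solution `y*(x) = argmin_y (1/n) ∑ i, g i x y`. -/
def yStar {n p q : ℕ} (g : Fin n → Vec p → Vec q → ℝ) (x : Vec p) : Vec q :=
  argmin fun y => (1 / (n : ℝ)) * ∑ i, g i x y

/-- The objective `Φ(x) = (1/n) ∑ i, f i (x, y*(x))`. -/
def Phi {n p q : ℕ} (f g : Fin n → Vec p → Vec q → ℝ) (x : Vec p) : ℝ :=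
  (1 / (n : ℝ)) * ∑ i, f i x (yStar g x)

/-! ### Constants -/

/-- The Lipschitz constant `L_Φ` of the hypergradient. -/
def LPhi (L Lf0 Lg2 μ : ℝ) : ℝ :=
  L + (2 * L ^ 2 + Lg2 * Lf0 ^ 2) / μ + (L * Lf0 * Lg2 + L ^ 3 + Lg2 * Lf0 * L) / μ ^ 2
    + Lg2 * L ^ 2 * Lf0 / μ ^ 3

/-- The Lipschitz constant `L_f` of the hypergradient surrogate. -/
def Lf (L Lf0 Lg2 μ : ℝ) : ℝ :=
  L + L ^ 2 / μ + Lf0 * (Lg2 / μ + Lg2 * L / μ ^ 2)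

/-- `δ_y^T`, with `δ_y = 1 - 2 η_y μ L / (μ + L)` (one lower level gradient step). -/
def deltaY (L μ ηy : ℝ) (T : ℕ) : ℝ := (1 - 2 * ηy * μ * L / (μ + L)) ^ T

/-- `δ_κ^N = ((√κ - 1) / (√κ + 1))^(2N)`, with `κ = L / μ`. -/
def deltaK (L μ : ℝ) (N : ℕ) : ℝ := ((√(L / μ) - 1) / (√(L / μ) + 1)) ^ (2 * N)

/-- `ρ = max {|λ_2|, |λ_n|} = max {|λ_k| : 2 ≤ k ≤ n}`, where `λ_1 ≥ ⋯ ≥ λ_n` are the eigenvalues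
of `W` (`ρ = 0` if `n = 1`). The indices below start at `0`. -/
def rho {n : ℕ} (W : Matrix (Fin n) (Fin n) ℝ) (hW : W.IsHermitian) : ℝ :=
  ⨆ k : {k : Fin (Fintype.card (Fin n)) // 0 < (k : ℕ)}, |hW.eigenvalues₀ k|

/-! ### Building blocks of the algorithm -/

/-- The average over the agents. -/
def avg {n : ℕ} {E : Type*} [AddCommGroup E] [Module ℝ E] (z : Fin n → E) : E :=
  (1 / (n : ℝ)) • ∑ i, z i

/-- One round of communication, `z_i ↦ ∑ j, w_ij z_j`. -/
def mix {n : ℕ} {E : Type*} [AddCommGroup E] [Module ℝ E] (W : Matrix (Fin n) (Fin n) ℝ)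
    (z : Fin n → E) : Fin n → E :=
  fun i => ∑ j, W i j • z j

/-- One step of decentralized gradient descent with gradient tracking: `zs = (z, s)` holds the
iterates and the trackers of all agents, `G i` is the gradient of agent `i`. -/
def gtStep {n : ℕ} {E : Type*} [AddCommGroup E] [Module ℝ E] (W : Matrix (Fin n) (Fin n) ℝ)
    (γ : ℝ) (G : Fin n → E → E) (zs : (Fin n → E) × (Fin n → E)) :
    (Fin n → E) × (Fin n → E) :=
  let z' : Fin n → E := fun i => mix W zs.1 i - γ • zs.2 i
  (z', fun i => mix W zs.2 i + G i (z' i) - G i (zs.1 i))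

/-- State of the conjugate gradient method: iterate, residual, search direction. -/
structure CGState (q : ℕ) where
  v : Vec q
  r : Vec q
  d : Vec q

/-- One conjugate gradient step for `A v = b`. (Division by zero gives zero, so the iterate stays
where it is once the residual vanishes.) -/
def cgStep {q : ℕ} (A : Vec q →L[ℝ] Vec q) (s : CGState q) : CGState q :=
  let a : ℝ := ‖s.r‖ ^ 2 / inner ℝ s.d (A s.d)
  let r' : Vec q := s.r - a • A s.d
  { v := s.v + a • s.d
    r := r'
    d := r' + (‖r'‖ ^ 2 / ‖s.r‖ ^ 2) • s.d }

/-- `N` conjugate gradient steps for `A v = b`, started at `v₀`. -/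
def cg {q : ℕ} (A : Vec q →L[ℝ] Vec q) (b v₀ : Vec q) (N : ℕ) : Vec q :=
  ((cgStep A)^[N] { v := v₀, r := b - A v₀, d := b - A v₀ }).v

/-- The decentralized Jacobian-Hessian-inverse product oracle: `N` gradient tracking steps with
step size `γ` for `min_Z (1/n) ∑ i, (Tr (Zᵀ H_i Z) / 2 - Tr (J_i Z))` over `q × p` matrices `Z`,
started at `Z₀`; the gradient of the `i`-th summand is `H_i Z - J_iᵀ`. -/
def jhip {n p q : ℕ} (W : Matrix (Fin n) (Fin n) ℝ) (γ : ℝ)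
    (H : Fin n → Vec q →L[ℝ] Vec q) (J : Fin n → Vec q →L[ℝ] Vec p)
    (Z₀ : Fin n → Vec p →L[ℝ] Vec q) (N : ℕ) : Fin n → Vec p →L[ℝ] Vec q :=
  let G : Fin n → (Vec p →L[ℝ] Vec q) → (Vec p →L[ℝ] Vec q) :=
    fun i Z => (H i).comp Z - ContinuousLinearMap.adjoint (J i)
  ((gtStep W γ G)^[N] (Z₀, fun i => G i (Z₀ i))).1

/-- Spectral norm of the `p × n` matrix with columns `M i`. -/
def specNorm {n p : ℕ} (M : Fin n → Vec p) : ℝ :=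
  ‖∑ i, (EuclideanSpace.proj i : Vec n →L[ℝ] ℝ).smulRight (M i)‖

/-! ### DBOGT when the lower level functions coincide -/

/-- What the agents hold at the end of outer iteration `k`: `x_{i,k}`, the inner output
`y_{i,k}^{(T)}`, the conjugate gradient output `v_{i,k}^{(N)}`, the hypergradient estimate
`h_i = ∇̂ f_i (x_{i,k}, y_{i,k}^{(T)})`, and the outer tracker `u_{i,k}`. -/
structure HomState (n p q : ℕ) where
  x : Fin n → Vec p
  y : Fin n → Vec q
  v : Fin n → Vec q
  h : Fin n → Vec p
  u : Fin n → Vec p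

/-- `T` local gradient steps on `g_i (x_i, ·)`. -/
def homInner {n p q : ℕ} (g : Fin n → Vec p → Vec q → ℝ) (ηy : ℝ) (T : ℕ)
    (x : Fin n → Vec p) (y : Fin n → Vec q) : Fin n → Vec q :=
  fun i => (fun y' => y' - ηy • gradY (g i) (x i) y')^[T] (y i)

/-- `N` conjugate gradient steps for `∇_y² g_i (x_i, y_i) v = ∇_y f_i (x_i, y_i)`. -/
def homCG {n p q : ℕ} (f g : Fin n → Vec p → Vec q → ℝ) (N : ℕ)
    (x : Fin n → Vec p) (y v : Fin n → Vec q) : Fin n → Vec q :=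
  fun i => cg (hessY (g i) (x i) (y i)) (gradY (f i) (x i) (y i)) (v i) N

/-- `∇_x f_i (x_i, y_i) - ∇_{xy} g_i (x_i, y_i) v_i`. -/
def homHyper {n p q : ℕ} (f g : Fin n → Vec p → Vec q → ℝ)
    (x : Fin n → Vec p) (y v : Fin n → Vec q) : Fin n → Vec p :=
  fun i => gradX (f i) (x i) (y i) - jacXY (g i) (x i) (y i) (v i)

/-- DBOGT with the lower level gradient steps and the conjugate gradient steps done locally, both
warm started; `x_{i,0} = 0` and `u_{i,0} = ∇̂ f_i (x_{i,0}, y_{i,0}^{(T)})`. -/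
def hom {n p q : ℕ} (f g : Fin n → Vec p → Vec q → ℝ) (W : Matrix (Fin n) (Fin n) ℝ)
    (ηx ηy : ℝ) (T N : ℕ) (y₀ v₀ : Fin n → Vec q) : ℕ → HomState n p q
  | 0 =>
    let x : Fin n → Vec p := fun _ => 0
    let y := homInner g ηy T x y₀
    let v := homCG f g N x y v₀
    let h := homHyper f g x y v
    { x := x, y := y, v := v, h := h, u := h }
  | k + 1 =>
    let s := hom f g W ηx ηy T N y₀ v₀ k
    let x : Fin n → Vec p := fun i => mix W s.x i - ηx • s.u i
    let y := homInner g ηy T x s.y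
    let v := homCG f g N x y s.v
    let h := homHyper f g x y v
    { x := x, y := y, v := v, h := h, u := fun i => mix W s.u i + h i - s.h i }

/-- `c₁ = ∑ i, ‖y_{i,0}^{(0)} - y_i^*(x_{i,0})‖²`, where `y_i^*(x) = argmin_y g_i (x, y)`. -/
def homC1 {n p q : ℕ} (g : Fin n → Vec p → Vec q → ℝ) (y₀ : Fin n → Vec q) : ℝ :=
  ∑ i, ‖y₀ i - argmin (g i 0)‖ ^ 2

/-- `c₂ = ∑ i, ‖v_{i,0}^* - v_{i,0}^{(0)}‖²`, where
`v_{i,0}^* = [∇_y² g_i (x, y_i^*(x))]⁻¹ ∇_y f_i (x, y_i^*(x))` at `x = x_{i,0} = 0`. -/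
def homC2 {n p q : ℕ} (f g : Fin n → Vec p → Vec q → ℝ) (v₀ : Fin n → Vec q) : ℝ :=
  ∑ i, ‖(hessY (g i) 0 (argmin (g i 0))).inverse (gradY (f i) 0 (argmin (g i 0))) - v₀ i‖ ^ 2

/-! ### DBOGT when the lower level functions may differ -/

/-- How the inner gradient trackers start in the outer iterations `k ≥ 1`: carried over from the
previous inner loop, as the inner iterates are, or restarted at the local gradients. -/
inductive TrackerStart
  | carried
  | restarted

/-- What the agents hold at the end of outer iteration `k`: `x_{i,k}`, the inner output
`y_{i,k}^{(T)}`, its tracker `s_{i,k}^{(T)}`, the hypergradient estimate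
`h_i = ∇̂ f_i (x_{i,k}, y_{i,k}^{(T)})`, and the outer tracker `u_{i,k}`. -/
structure HetState (n p q : ℕ) where
  x : Fin n → Vec p
  y : Fin n → Vec q
  s : Fin n → Vec q
  h : Fin n → Vec p
  u : Fin n → Vec p

/-- `T` gradient tracking steps for `min_y (1/n) ∑ i, g_i (x_i, y)`, from iterates and trackers
`ys = (y, s)`. -/
def hetInner {n p q : ℕ} (g : Fin n → Vec p → Vec q → ℝ) (W : Matrix (Fin n) (Fin n) ℝ)
    (ηy : ℝ) (T : ℕ) (x : Fin n → Vec p) (ys : (Fin n → Vec q) × (Fin n → Vec q)) :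
    (Fin n → Vec q) × (Fin n → Vec q) :=
  (gtStep W ηy fun i y => gradY (g i) (x i) y)^[T] ys

/-- `∇_x f_i (x_i, y_i) - Z_iᵀ ∇_y f_i (x_i, y_i)`, with `Z_i` the output of the oracle `jhip` for
`H_i = ∇_y² g_i (x_i, y_i)` and `J_i = ∇_{xy} g_i (x_i, y_i)`. -/
def hetHyper {n p q : ℕ} (f g : Fin n → Vec p → Vec q → ℝ) (W : Matrix (Fin n) (Fin n) ℝ)
    (γ : ℝ) (N : ℕ) (Z₀ : Fin n → Vec p →L[ℝ] Vec q)
    (x : Fin n → Vec p) (y : Fin n → Vec q) : Fin n → Vec p :=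
  let Z := jhip W γ (fun i => hessY (g i) (x i) (y i)) (fun i => jacXY (g i) (x i) (y i)) Z₀ N
  fun i => gradX (f i) (x i) (y i) - ContinuousLinearMap.adjoint (Z i) (gradY (f i) (x i) (y i))

/-- DBOGT with gradient tracking in the inner loop (warm started iterates) and the oracle `jhip`
(started at `Z₀` in every outer iteration); `x_{i,0} = 0`,
`s_{i,0}^{(0)} = ∇_y g_i (x_{i,0}, y_{i,0}^{(0)})`, `u_{i,0} = ∇̂ f_i (x_{i,0}, y_{i,0}^{(T)})`. -/
def het {n p q : ℕ} (f g : Fin n → Vec p → Vec q → ℝ) (W : Matrix (Fin n) (Fin n) ℝ)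
    (ηx ηy γ : ℝ) (T N : ℕ) (start : TrackerStart) (y₀ : Fin n → Vec q)
    (Z₀ : Fin n → Vec p →L[ℝ] Vec q) : ℕ → HetState n p q
  | 0 =>
    let x : Fin n → Vec p := fun _ => 0
    let ys := hetInner g W ηy T x (y₀, fun i => gradY (g i) (x i) (y₀ i))
    let h := hetHyper f g W γ N Z₀ x ys.1
    { x := x, y := ys.1, s := ys.2, h := h, u := h }
  | k + 1 =>
    let c := het f g W ηx ηy γ T N start y₀ Z₀ k
    let x : Fin n → Vec p := fun i => mix W c.x i - ηx • c.u i
    let s₀ : Fin n → Vec q := fun i =>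
      match start with
      | .carried => c.s i + gradY (g i) (x i) (c.y i) - gradY (g i) (c.x i) (c.y i)
      | .restarted => gradY (g i) (x i) (c.y i)
    let ys := hetInner g W ηy T x (c.y, s₀)
    let h := hetHyper f g W γ N Z₀ x ys.1
    { x := x, y := ys.1, s := ys.2, h := h, u := fun i => mix W c.u i + h i - c.h i }

/-- The initial error
`∑ i, (‖y_{i,0}^{(0)} - y*(x_0)‖² + ‖∇_y g_i (x_0, y_{i,0}^{(0)})‖² + ‖Z_i^{(0)}‖²)`, `x_0 = 0`. -/
def hetD0 {n p q : ℕ} (g : Fin n → Vec p → Vec q → ℝ) (y₀ : Fin n → Vec q)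
    (Z₀ : Fin n → Vec p →L[ℝ] Vec q) : ℝ :=
  ∑ i, (‖y₀ i - yStar g 0‖ ^ 2 + ‖gradY (g i) 0 (y₀ i)‖ ^ 2 + ‖Z₀ i‖ ^ 2)

/-- The lower level heterogeneity `∑ i, ‖∇_y g_i (x_i, ỹ)‖²` at the minimizer `ỹ` of
`y ↦ (1/n) ∑ j, g_j (x_j, y)`. -/
def hetero {n p q : ℕ} (g : Fin n → Vec p → Vec q → ℝ) (x : Fin n → Vec p) : ℝ :=
  ∑ i, ‖gradY (g i) (x i) (argmin fun y => (1 / (n : ℝ)) * ∑ j, g j (x j) y)‖ ^ 2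

end

end DBOGT

open DBOGT

open DBOGT

namespace DBOGT

/-! ### Stacked vectors -/

section Stacked

variable {n d : ℕ}

/-! Both branches are gradient tracking with inexact gradients `h`. Double stochasticity gives the
invariant `avg (u k) = avg (h k)`, so the mean iterate performs plain gradient descent along `avg (h
k)`. The deviations of iterates and trackers from their means contract by the factor `ρ`, because
mixing is a strict contraction on the orthogonal complement of the constants (`norm_mulVec_le_rho`).
Consensus error, tracking error and displacement drive each other in a loop whose gain is small
under the step size condition (`coupled_sum_le`). With the descent lemma this yields
`TrackingRun.sum_norm_gradient_le`: the sum of `‖∇Φ‖²` is controlled by the initial gap, the initial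
tracking error and the summed squared error of `h` against an exact map `F`, while half of the sum
of `‖avg (h k)‖²` is kept on the left to absorb feedback. What is needed from `F` is that it is
Lipschitz and that its average on constant stacks is `∇Φ`. The latter is implicit differentiation of
the lower level solution (`hasFDerivAt_yStar`, `hasGradientAt_Phi`).

In the homogeneous branch the inner solvers contract linearly: gradient descent by cocoercivity
(`norm_gradient_step_sq_le`), conjugate gradients by optimality over a Krylov space and Chebyshev
polynomials (`norm_sub_cg_sq_le`). Because of the warm start, the combined inner error contracts up
to the displacement of the outer iterates (`homErr_succ_le`). The displacements are in turn bounded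
by inner errors and by the sum kept on the left, so for large `T` and `N` the whole error is
summable and the rate is `O(1/K)`.

In the heterogeneous branch a weighted sum of mean, consensus and tracker errors is a Lyapunov
function of the inner tracking scheme (`trackErr_iterate_le`). It serves for the lower level problem
and, vector by vector, for the oracle `jhip`. Since `∇f` is bounded, the estimates `h` and hence the
displacements are bounded a priori, so the inner error stays of order `α ^ T` in all outer
iterations as soon as `α ^ T` beats the growth caused by the moving target (`het_trackErr_le`). If
it does not, then `α ^ T` is bounded below and the claim follows from the uniform bound on `∇Φ`. -/

/-- The Euclidean norm of a stacked vector. -/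
noncomputable def l2 (z : Fin n → Vec d) : ℝ := ‖(WithLp.toLp 2 z : PiLp 2 fun _ => Vec d)‖

/-- The deviation of a stacked vector from its average. -/
noncomputable def dev (z : Fin n → Vec d) : Fin n → Vec d := fun i => z i - avg z

lemma l2_nonneg (z : Fin n → Vec d) : 0 ≤ l2 z := norm_nonneg _

lemma l2_sq (z : Fin n → Vec d) : l2 z ^ 2 = ∑ i, ‖z i‖ ^ 2 := by
  rw [l2, PiLp.norm_sq_eq_of_L2]

lemma l2_add_le (z w : Fin n → Vec d) : l2 (z + w) ≤ l2 z + l2 w := by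
  simpa only [l2, WithLp.toLp_add] using norm_add_le _ _

lemma l2_sub_le (z w : Fin n → Vec d) : l2 (z - w) ≤ l2 z + l2 w := by
  simpa only [l2, WithLp.toLp_sub] using norm_sub_le _ _

lemma l2_smul (c : ℝ) (z : Fin n → Vec d) : l2 (c • z) = |c| * l2 z := by
  simp only [l2, WithLp.toLp_smul, norm_smul, Real.norm_eq_abs]

lemma l2_sub_comm (z w : Fin n → Vec d) : l2 (z - w) = l2 (w - z) := by
  simpa only [l2, WithLp.toLp_sub] using norm_sub_rev _ _

lemma l2_sub_le_add (z w v : Fin n → Vec d) : l2 (z - v) ≤ l2 (z - w) + l2 (w - v) := by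
  simpa using l2_add_le (z - w) (w - v)

lemma l2_le_of_forall_le {d' : ℕ} {z : Fin n → Vec d} {w : Fin n → Vec d'} {c : ℝ} (hc : 0 ≤ c)
    (h : ∀ i, ‖z i‖ ≤ c * ‖w i‖) : l2 z ≤ c * l2 w := by
  refine le_of_sq_le_sq ?_ (mul_nonneg hc (l2_nonneg w))
  rw [mul_pow, l2_sq, l2_sq, Finset.mul_sum]
  refine Finset.sum_le_sum fun i _ => ?_
  rw [← mul_pow]
  exact pow_le_pow_left₀ (norm_nonneg _) (h i) 2

lemma norm_le_l2 (z : Fin n → Vec d) (i : Fin n) : ‖z i‖ ≤ l2 z :=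
  PiLp.norm_apply_le (WithLp.toLp 2 z : PiLp 2 fun _ => Vec d) i

lemma l2_const (c : Vec d) : l2 (fun _ : Fin n => c) = √n * ‖c‖ := by
  refine (sq_eq_sq₀ (l2_nonneg _) (by positivity)).1 ?_
  rw [l2_sq, mul_pow, Real.sq_sqrt (by positivity)]
  simp

lemma avg_add (z w : Fin n → Vec d) : avg (z + w) = avg z + avg w := by
  simp [avg, Finset.sum_add_distrib]

lemma avg_sub (z w : Fin n → Vec d) : avg (z - w) = avg z - avg w := by
  simp [avg, Finset.sum_sub_distrib, smul_sub]

lemma avg_smul (c : ℝ) (z : Fin n → Vec d) : avg (c • z) = c • avg z := by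
  simp [avg, ← Finset.smul_sum, smul_comm c]

lemma avg_const (hn : 0 < n) (c : Vec d) : avg (fun _ : Fin n => c) = c := by
  have : (n : ℝ) ≠ 0 := by positivity
  simp [avg, ← Nat.cast_smul_eq_nsmul ℝ, smul_smul, this]

lemma sum_eq_smul_avg (hn : 0 < n) (z : Fin n → Vec d) : ∑ i, z i = (n : ℝ) • avg z := by
  have : (n : ℝ) ≠ 0 := by positivity
  simp [avg, smul_smul, this]

/-- Pythagoras: deviations sum to zero, so the cross term vanishes. All comparisons between a stack,
its deviation and its mean below come from this identity. -/
lemma l2_sq_eq_dev (hn : 0 < n) (z : Fin n → Vec d) (c : Vec d) :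
    l2 (fun i => z i - c) ^ 2 = l2 (dev z) ^ 2 + n * ‖avg z - c‖ ^ 2 := by
  have h1 : ∀ i, ‖z i - c‖ ^ 2 =
      ‖dev z i‖ ^ 2 + 2 * inner ℝ (dev z i) (avg z - c) + ‖avg z - c‖ ^ 2 := fun i => by
    rw [← norm_add_sq_real]; simp [dev]
  have h2 : ∑ i, dev z i = 0 := by
    simp only [dev]
    rw [Finset.sum_sub_distrib, sum_eq_smul_avg hn]
    simp [Nat.cast_smul_eq_nsmul]
  rw [l2_sq, l2_sq, Finset.sum_congr rfl fun i _ => h1 i, Finset.sum_add_distrib,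
    Finset.sum_add_distrib, ← Finset.mul_sum, ← sum_inner, h2]
  simp

lemma l2_sq_eq_dev_add (hn : 0 < n) (z : Fin n → Vec d) :
    l2 z ^ 2 = l2 (dev z) ^ 2 + n * ‖avg z‖ ^ 2 := by
  simpa using l2_sq_eq_dev hn z 0

lemma l2_dev_le_sub (hn : 0 < n) (z : Fin n → Vec d) (c : Vec d) :
    l2 (dev z) ≤ l2 (fun i => z i - c) := by
  refine le_of_sq_le_sq ?_ (l2_nonneg _)
  rw [l2_sq_eq_dev hn z c]
  have : 0 ≤ (n : ℝ) * ‖avg z - c‖ ^ 2 := by positivity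
  linarith

lemma l2_dev_le (hn : 0 < n) (z : Fin n → Vec d) : l2 (dev z) ≤ l2 z := by
  simpa using l2_dev_le_sub hn z 0

lemma sqrt_mul_norm_avg_sub_le (hn : 0 < n) (z : Fin n → Vec d) (c : Vec d) :
    √n * ‖avg z - c‖ ≤ l2 (fun i => z i - c) := by
  refine le_of_sq_le_sq ?_ (l2_nonneg _)
  rw [l2_sq_eq_dev hn z c, mul_pow, Real.sq_sqrt (by positivity)]
  have := sq_nonneg (l2 (dev z))
  linarith

lemma sqrt_mul_norm_avg_le (hn : 0 < n) (z : Fin n → Vec d) : √n * ‖avg z‖ ≤ l2 z := by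
  simpa using sqrt_mul_norm_avg_sub_le hn z 0

lemma l2_sub_const_le (z : Fin n → Vec d) (c : Vec d) :
    l2 (fun i => z i - c) ≤ l2 (dev z) + √n * ‖avg z - c‖ := by
  rw [← l2_const]
  convert l2_add_le (dev z) (fun _ => avg z - c) using 2
  ext1 i; simp [dev]

lemma dev_add (z w : Fin n → Vec d) : dev (z + w) = dev z + dev w := by
  ext1 i; simp only [dev, avg_add, Pi.add_apply]; abel

lemma dev_sub (z w : Fin n → Vec d) : dev (z - w) = dev z - dev w := by
  ext1 i; simp only [dev, avg_sub, Pi.sub_apply]; abel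

lemma dev_smul (c : ℝ) (z : Fin n → Vec d) : dev (c • z) = c • dev z := by
  ext1 i; simp only [dev, avg_smul, Pi.smul_apply, smul_sub]

lemma avg_dev (hn : 0 < n) (z : Fin n → Vec d) : avg (dev z) = 0 := by
  have : dev z = z - fun _ => avg z := rfl
  rw [this, avg_sub, avg_const hn, sub_self]

/-! ### Communication -/

lemma avg_mix {W : Matrix (Fin n) (Fin n) ℝ} (hW : W ∈ doublyStochastic ℝ (Fin n))
    (z : Fin n → Vec d) : avg (mix W z) = avg z := by
  simp only [avg, mix]
  rw [Finset.sum_comm]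
  simp_rw [← Finset.sum_smul, sum_col_of_mem_doublyStochastic hW, one_smul]

lemma mix_const {W : Matrix (Fin n) (Fin n) ℝ} (hW : W ∈ doublyStochastic ℝ (Fin n))
    (c : Vec d) : mix W (fun _ => c) = fun _ => c := by
  ext1 i
  simp only [mix, ← Finset.sum_smul, sum_row_of_mem_doublyStochastic hW, one_smul]

lemma mix_sub (W : Matrix (Fin n) (Fin n) ℝ) (z w : Fin n → Vec d) :
    mix W (z - w) = mix W z - mix W w := by
  ext1 i; simp [mix, smul_sub, Finset.sum_sub_distrib]

lemma dev_mix {W : Matrix (Fin n) (Fin n) ℝ} (hW : W ∈ doublyStochastic ℝ (Fin n))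
    (z : Fin n → Vec d) : dev (mix W z) = mix W (dev z) := by
  have : dev z = z - fun _ => avg z := rfl
  rw [this, mix_sub, mix_const hW]
  ext1 i; simp [dev, avg_mix hW]

lemma rho_nonneg (W : Matrix (Fin n) (Fin n) ℝ) (hW : W.IsHermitian) : 0 ≤ rho W hW :=
  Real.iSup_nonneg fun _ => abs_nonneg _

lemma abs_eigenvalues₀_le_rho (W : Matrix (Fin n) (Fin n) ℝ) (hW : W.IsHermitian)
    (k : Fin (Fintype.card (Fin n))) (hk : 0 < (k : ℕ)) : |hW.eigenvalues₀ k| ≤ rho W hW :=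
  le_ciSup (f := fun k : {k : Fin (Fintype.card (Fin n)) // 0 < (k : ℕ)} => |hW.eigenvalues₀ k|)
    (Set.finite_range _).bddAbove ⟨k, hk⟩

/-- The all-ones vector is fixed by `W`. Eigenvectors of index at least one have eigenvalue
different from `1`, as `ρ < 1`, and are therefore orthogonal to it; so the remaining eigenvector is
proportional to the ones. A vector of mean zero thus has no component along it, and Parseval leaves
only eigenvalues bounded by `ρ`. -/
lemma norm_mulVec_le_rho {W : Matrix (Fin n) (Fin n) ℝ} (hW : W.IsHermitian)
    (hWd : W ∈ doublyStochastic ℝ (Fin n)) (hρ : rho W hW < 1) (v : EuclideanSpace ℝ (Fin n))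
    (hv : ∑ i, v i = 0) :
    ‖W.toEuclideanLin v‖ ≤ rho W hW * ‖v‖ := by
  set A := W.toEuclideanLin with hA
  have hsym : A.IsSymmetric := Matrix.isSymmetric_toEuclideanLin_iff.mpr hW
  set b := hsym.eigenvectorBasis finrank_euclideanSpace with hb
  have hev : ∀ k, A (b k) = hW.eigenvalues₀ k • b k := fun k =>
    hsym.apply_eigenvectorBasis finrank_euclideanSpace k
  set one : EuclideanSpace ℝ (Fin n) := WithLp.toLp 2 fun _ => 1 with hone
  have hA1 : A one = one := by
    ext i
    simp [hA, hone, Matrix.toLpLin_apply, Matrix.mulVec, dotProduct,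
      sum_row_of_mem_doublyStochastic hWd]
  have hv1 : inner ℝ one v = 0 := by
    simp [hone, PiLp.inner_apply, hv]
  have h1 : ∀ k : Fin (Fintype.card (Fin n)), 0 < (k : ℕ) → inner ℝ (b k) one = (0 : ℝ) := fun k hk => by
    have h := hsym (b k) one
    rw [hev, hA1, real_inner_smul_left] at h
    have hlt := (abs_eigenvalues₀_le_rho W hW k hk).trans_lt hρ
    have : hW.eigenvalues₀ k ≠ 1 := fun h => by simp [h] at hlt
    by_contra hne
    exact this (mul_right_cancel₀ hne (by linarith))
  have h0 : ∀ k : Fin (Fintype.card (Fin n)), (k : ℕ) = 0 → inner ℝ (b k) v = (0 : ℝ) := fun k hk => by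
    have hexp : one = (inner ℝ (b k) one : ℝ) • b k := by
      conv_lhs => rw [← b.sum_repr' one]
      refine Finset.sum_eq_single k (fun j _ hj => ?_) (by simp)
      rw [h1 j (Nat.pos_of_ne_zero fun h => hj (Fin.ext (h.trans hk.symm))), zero_smul]
    have hne : (inner ℝ (b k) one : ℝ) ≠ 0 := fun h => by
      rw [h, zero_smul] at hexp
      have hn : 0 < n := by
        have := k.2
        simp at this; omega
      have := congrArg (fun w : EuclideanSpace ℝ (Fin n) => w ⟨0, hn⟩) hexp
      simp [hone] at this
    rw [hexp, real_inner_smul_left] at hv1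
    exact (mul_eq_zero.1 hv1).resolve_left hne
  have hcoef : ∀ k, inner ℝ (b k) (A v) = hW.eigenvalues₀ k * inner ℝ (b k) v := fun k => by
    rw [← hsym, hev, real_inner_smul_left]
  refine le_of_sq_le_sq ?_ (mul_nonneg (rho_nonneg W hW) (norm_nonneg _))
  rw [mul_pow, ← b.sum_sq_norm_inner_right, ← b.sum_sq_norm_inner_right v, Finset.mul_sum]
  refine Finset.sum_le_sum fun k _ => ?_
  rw [hcoef, norm_mul, mul_pow]
  rcases Nat.eq_zero_or_pos (k : ℕ) with hk | hk
  · simp [h0 k hk]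
  · refine mul_le_mul_of_nonneg_right ?_ (by positivity)
    exact pow_le_pow_left₀ (norm_nonneg _) (abs_eigenvalues₀_le_rho W hW k hk) 2

/-- Mixing acts separately on each of the `d` coordinates, and each coordinate of a deviation is a
vector in `ℝ^n` of mean zero. -/
lemma l2_dev_mix_le {W : Matrix (Fin n) (Fin n) ℝ} (hW : W.IsHermitian)
    (hWd : W ∈ doublyStochastic ℝ (Fin n)) (hρ : rho W hW < 1) (z : Fin n → Vec d) :
    l2 (dev (mix W z)) ≤ rho W hW * l2 (dev z) := by
  rcases Nat.eq_zero_or_pos n with rfl | hn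
  · have h0 : ∀ w : Fin 0 → Vec d, l2 w = 0 := fun w => by simpa using l2_sq w
    simp [h0]
  rw [dev_mix hWd]
  refine le_of_sq_le_sq ?_ (mul_nonneg (rho_nonneg W hW) (l2_nonneg _))
  have key : ∀ w : Fin n → Vec d, l2 w ^ 2 =
      ∑ c, ‖(WithLp.toLp 2 fun i => w i c : EuclideanSpace ℝ (Fin n))‖ ^ 2 := fun w => by
    simp_rw [l2_sq, EuclideanSpace.norm_sq_eq]
    exact Finset.sum_comm
  rw [mul_pow, key, key (dev z), Finset.mul_sum]
  refine Finset.sum_le_sum fun c _ => ?_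
  rw [← mul_pow]
  refine pow_le_pow_left₀ (norm_nonneg _) ?_ 2
  have hmix : (WithLp.toLp 2 fun i => mix W (dev z) i c : EuclideanSpace ℝ (Fin n)) =
      W.toEuclideanLin (WithLp.toLp 2 fun i => dev z i c) := by
    ext i
    simp [mix, Matrix.toLpLin_apply, Matrix.mulVec, dotProduct]
  rw [hmix]
  refine norm_mulVec_le_rho hW hWd hρ (WithLp.toLp 2 fun i => dev z i c) ?_
  · have h := avg_dev hn z
    have h2 : ∑ i, dev z i = 0 := by rw [sum_eq_smul_avg hn, h, smul_zero]
    simpa using congrArg (fun v : Vec d => v c) h2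

/-- Mixing leaves the mean alone, so only deviations move; the factor is `1 + ρ ≤ 2`. -/
lemma l2_mix_sub_le {W : Matrix (Fin n) (Fin n) ℝ} (hW : W.IsHermitian)
    (hWd : W ∈ doublyStochastic ℝ (Fin n)) (hρ : rho W hW < 1) (z : Fin n → Vec d) :
    l2 (mix W z - z) ≤ 2 * l2 (dev z) := by
  have h : mix W z - z = dev (mix W z) - dev z := by
    ext1 i; simp [dev, avg_mix hWd]
  rw [h]
  refine (l2_sub_le _ _).trans ?_
  have h1 := l2_dev_mix_le hW hWd hρ z
  have h2 := mul_le_mul_of_nonneg_right hρ.le (l2_nonneg (dev z))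
  linarith

/-- The Frobenius norm is at most `√n` times the spectral norm. -/
lemma l2_sq_le_specNorm (h : Fin n → Vec d) : l2 h ^ 2 ≤ n * specNorm h ^ 2 := by
  have key : ∀ i, ‖h i‖ ≤ specNorm h := fun i => by
    have := (∑ j, (EuclideanSpace.proj j : Vec n →L[ℝ] ℝ).smulRight (h j)).le_opNorm
      (EuclideanSpace.single i 1)
    simpa [specNorm, Pi.single_apply] using this
  rw [l2_sq]
  refine (Finset.sum_le_sum fun i _ => pow_le_pow_left₀ (norm_nonneg _) (key i) 2).trans ?_
  simp

end Stacked

end DBOGT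

namespace DBOGT

/-! ### Smooth and strongly convex functions -/

section Convex

variable {E : Type*} [NormedAddCommGroup E] [InnerProductSpace ℝ E]

/-- `G` is `μ`-strongly monotone. -/
def StronglyMonotone (μ : ℝ) (G : E → E) : Prop :=
  ∀ x y, μ * ‖x - y‖ ^ 2 ≤ inner ℝ (G x - G y) (x - y)

/-- Expanding the square gives the factor `1 - 2γμ + γ²L²`, which is at most `1 - γμ ≤ (1 - γμ/2)²`
because `γL² ≤ μ`. The bound `γμ ≤ 2` only makes the factor nonnegative, so that squares may be
compared. -/
lemma norm_step_sub_step_le {G : E → E} {μ L γ : ℝ} (hμ : StronglyMonotone μ G) (hL : Lip L G)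
    (hγ : 0 ≤ γ) (hγL : γ * L ^ 2 ≤ μ) (hγμ : γ * μ ≤ 2) (x y : E) :
    ‖(x - γ • G x) - (y - γ • G y)‖ ≤ (1 - γ * μ / 2) * ‖x - y‖ := by
  refine le_of_sq_le_sq ?_ (mul_nonneg (by linarith) (norm_nonneg _))
  have h1 : (x - γ • G x) - (y - γ • G y) = (x - y) - γ • (G x - G y) := by
    rw [smul_sub]; abel
  rw [h1, norm_sub_sq_real, inner_smul_right, norm_smul, Real.norm_of_nonneg hγ,
    real_inner_comm]
  have h2 := mul_le_mul_of_nonneg_left (hμ x y) hγ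
  have h3 := pow_le_pow_left₀ (norm_nonneg _) (hL x y) 2
  have h4 := mul_le_mul_of_nonneg_left h3 (sq_nonneg γ)
  have h5 := mul_le_mul_of_nonneg_right (mul_le_mul_of_nonneg_left hγL hγ) (sq_nonneg ‖x - y‖)
  nlinarith [sq_nonneg (γ * μ * ‖x - y‖)]

variable [CompleteSpace E]

lemma hasDerivAt_line {φ : E → ℝ} (hφ : Differentiable ℝ φ) (x v : E) (t : ℝ) :
    HasDerivAt (fun t : ℝ => φ (x + t • v)) (inner ℝ (gradient φ (x + t • v)) v) t := by
  have h1 : HasDerivAt (fun t : ℝ => x + t • v) v t := by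
    simpa using ((hasDerivAt_id t).smul_const v).const_add x
  have h2 := (hφ (x + t • v)).hasGradientAt.hasFDerivAt.comp_hasDerivAt t h1
  rwa [InnerProductSpace.toDual_apply_apply] at h2

/-- The descent lemma. -/
lemma le_add_inner_gradient_add {φ : E → ℝ} {L : ℝ} (hφ : Differentiable ℝ φ)
    (hL : Lip L (gradient φ)) (x y : E) :
    φ y ≤ φ x + inner ℝ (gradient φ x) (y - x) + L / 2 * ‖y - x‖ ^ 2 := by
  set v := y - x with hv
  -- `ψ` is the function along the segment minus its linear part and the quadratic majorant; the
  -- Lipschitz bound makes its derivative nonpositive, and `ψ 1 ≤ ψ 0` is the claim.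
  set ψ : ℝ → ℝ := fun t => φ (x + t • v) - (t * inner ℝ (gradient φ x) v + L / 2 * ‖v‖ ^ 2 * t ^ 2)
    with hψ
  have hd : ∀ t, HasDerivAt ψ (inner ℝ (gradient φ (x + t • v)) v -
      (inner ℝ (gradient φ x) v + L / 2 * ‖v‖ ^ 2 * (2 * t))) t := fun t => by
    refine (hasDerivAt_line hφ x v t).sub (HasDerivAt.add ?_ ?_)
    · simpa using (hasDerivAt_id t).mul_const (inner ℝ (gradient φ x) v)
    · simpa using ((hasDerivAt_id t).pow 2).const_mul (L / 2 * ‖v‖ ^ 2)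
  have hanti : AntitoneOn ψ (Set.Icc 0 1) := by
    refine antitoneOn_of_deriv_nonpos (convex_Icc 0 1)
      (fun t _ => (hd t).continuousAt.continuousWithinAt)
      (fun t _ => (hd t).differentiableAt.differentiableWithinAt) fun t ht => ?_
    rw [interior_Icc] at ht
    rw [(hd t).deriv]
    have h1 := real_inner_le_norm (gradient φ (x + t • v) - gradient φ x) v
    have h2 := hL (x + t • v) x
    rw [inner_sub_left] at h1
    rw [add_sub_cancel_left, norm_smul, Real.norm_of_nonneg ht.1.le] at h2
    nlinarith [mul_le_mul_of_nonneg_right h2 (norm_nonneg v)]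
  have h := hanti (Set.left_mem_Icc.2 zero_le_one) (Set.right_mem_Icc.2 zero_le_one) zero_le_one
  simp only [hψ, one_smul, zero_smul, hv, add_sub_cancel, add_zero] at h
  linarith

/-- Divide the strong convexity inequality on the segment by `t` and let `t` tend to `0` from the
right. -/
lemma add_inner_gradient_add_le {φ : E → ℝ} {μ : ℝ} (hφ : Differentiable ℝ φ)
    (hμ : StrongConvexOn Set.univ μ φ) (x y : E) :
    φ x + inner ℝ (gradient φ x) (y - x) + μ / 2 * ‖y - x‖ ^ 2 ≤ φ y := by
  set v := y - x with hv
  have h0 := hasDerivAt_line hφ x v 0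
  have h1 := h0.tendsto_slope_zero_right
  simp only [zero_add, zero_smul, add_zero, smul_eq_mul] at h1
  have h2 : Filter.Tendsto (fun t : ℝ => φ y - φ x - (1 - t) * (μ / 2 * ‖v‖ ^ 2))
      (nhdsWithin 0 (Set.Ioi 0)) (nhds (φ y - φ x - (1 - 0) * (μ / 2 * ‖v‖ ^ 2))) := by
    refine Filter.Tendsto.mono_left ?_ nhdsWithin_le_nhds
    exact (Continuous.tendsto (by fun_prop) 0)
  have h3 := le_of_tendsto_of_tendsto h1 h2 ?_
  · linarith
  filter_upwards [Ioo_mem_nhdsGT (zero_lt_one (α := ℝ))] with t ht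
  have h4 := hμ.2 (Set.mem_univ x) (Set.mem_univ y) (sub_nonneg.2 ht.2.le) ht.1.le (by ring)
  have h5 : (1 - t) • x + t • y = x + t • v := by rw [hv]; module
  rw [h5, norm_sub_rev x y, ← hv, smul_eq_mul, smul_eq_mul] at h4
  rw [inv_mul_le_iff₀ ht.1]
  nlinarith

lemma strong_monotone_gradient {φ : E → ℝ} {μ : ℝ} (hφ : Differentiable ℝ φ)
    (hμ : StrongConvexOn Set.univ μ φ) (x y : E) :
    μ * ‖x - y‖ ^ 2 ≤ inner ℝ (gradient φ x - gradient φ y) (x - y) := by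
  have h1 := add_inner_gradient_add_le hφ hμ x y
  have h2 := add_inner_gradient_add_le hφ hμ y x
  rw [← neg_sub x y, inner_neg_right, norm_neg] at h1
  rw [inner_sub_left]
  linarith

/-- The step `y - γ G y` with `γ = μ / L²` is a contraction, and its fixed point is a zero of `G`.
Minimizers exist by this route, without compactness. -/
lemma exists_zero_of_stronglyMonotone {G : E → E} {μ L : ℝ} (hμ0 : 0 < μ) (hμL : μ ≤ L)
    (hμ : StronglyMonotone μ G) (hL : Lip L G) : ∃ y, G y = 0 := by
  have hL0 : 0 < L := hμ0.trans_le hμL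
  set γ := μ / L ^ 2 with hγ
  have hγ0 : 0 < γ := by positivity
  have hγμ : γ * μ ≤ 1 := by
    rw [hγ, div_mul_eq_mul_div, div_le_one (by positivity)]
    nlinarith
  have hc : ContractingWith ⟨1 - γ * μ / 2, by linarith⟩ (fun y => y - γ • G y) := by
    refine ⟨?_, LipschitzWith.of_dist_le_mul fun x y => ?_⟩
    · have h1 := mul_pos hγ0 hμ0
      have h2 : 1 - γ * μ / 2 < 1 := by linarith
      exact h2
    · rw [dist_eq_norm, dist_eq_norm]
      exact norm_step_sub_step_le hμ hL hγ0.le (by rw [hγ]; field_simp; rfl) (by linarith) x y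
  have := hc.fixedPoint_isFixedPt
  refine ⟨hc.fixedPoint, ?_⟩
  have h : γ • G hc.fixedPoint = 0 := by
    have h1 : hc.fixedPoint - γ • G hc.fixedPoint = hc.fixedPoint := this
    simpa using h1
  exact (smul_eq_zero.1 h).resolve_left hγ0.ne'

/-- A zero of the gradient exists and is a global minimizer by convexity, so the choice in `argmin`
is not vacuous and Fermat's rule applies to it. This stationarity equation is how `argmin` is used
in what follows. -/
lemma gradient_argmin {q : ℕ} {φ : Vec q → ℝ} {μ L : ℝ} (hμ0 : 0 < μ) (hμL : μ ≤ L)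
    (hconv : ∀ x y, φ x + inner ℝ (gradient φ x) (y - x) ≤ φ y)
    (hμ : StronglyMonotone μ (gradient φ)) (hL : Lip L (gradient φ)) :
    gradient φ (argmin φ) = 0 := by
  obtain ⟨y, hy⟩ := exists_zero_of_stronglyMonotone hμ0 hμL hμ hL
  have hmin : ∃ y, ∀ y', φ y ≤ φ y' := ⟨y, fun y' => by simpa [hy] using hconv y y'⟩
  have h : ∀ y', φ (argmin φ) ≤ φ y' := Classical.epsilon_spec hmin
  have h2 : IsLocalMin φ (argmin φ) := Filter.Eventually.of_forall h
  rw [gradient, h2.fderiv_eq_zero, map_zero]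

lemma norm_gradient_le_of_lip {φ : E → ℝ} {K : ℝ} (hK : 0 ≤ K) (hφ : Lip K φ) (x : E) :
    ‖gradient φ x‖ ≤ K := by
  rw [gradient, LinearIsometryEquiv.norm_map]
  have : LipschitzWith ⟨K, hK⟩ φ := LipschitzWith.of_dist_le_mul fun x y => by
    rw [dist_eq_norm, dist_eq_norm]; exact hφ x y
  exact norm_fderiv_le_of_lipschitz ℝ this

/-- One gradient step on a smooth strongly convex function. -/
lemma norm_gradient_step_sq_le {φ : E → ℝ} {μ L η : ℝ} (hμ0 : 0 < μ) (hμL : μ ≤ L)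
    (hφ : Differentiable ℝ φ) (hμ : StrongConvexOn Set.univ μ φ) (hL : Lip L (gradient φ))
    (hη : 0 < η) (hη' : η ≤ 2 / (μ + L)) {x : E} (hx : gradient φ x = 0) (y : E) :
    ‖y - η • gradient φ y - x‖ ^ 2 ≤ (1 - 2 * η * μ * L / (μ + L)) * ‖y - x‖ ^ 2 := by
  set v := y - x with hv
  set D := gradient φ y with hD
  set d := D - μ • v with hd
  have hL0 : 0 < L := hμ0.trans_le hμL
  -- cocoercivity of the gradient of `φ - μ / 2 * ‖·‖ ^ 2`
  have hco : ∀ t : ℝ, (2 * t - (L - μ) * t ^ 2) * ‖d‖ ^ 2 ≤ inner ℝ d v := fun t => by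
    have u1 := le_add_inner_gradient_add hφ hL y (y - t • d)
    have l1 := add_inner_gradient_add_le hφ hμ x (y - t • d)
    have u2 := le_add_inner_gradient_add hφ hL x (x + t • d)
    have l2 := add_inner_gradient_add_le hφ hμ y (x + t • d)
    rw [show y - t • d - y = -(t • d) by abel, ← hD] at u1
    rw [show y - t • d - x = v - t • d by rw [hv]; abel, hx] at l1
    rw [show x + t • d - x = t • d by abel, hx] at u2
    rw [show x + t • d - y = -(v - t • d) by rw [hv]; abel, ← hD] at l2
    simp only [norm_neg, inner_neg_right, inner_zero_left, inner_sub_right, inner_smul_right,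
      norm_sub_sq_real, norm_smul, mul_pow, Real.norm_eq_abs, sq_abs] at u1 l1 u2 l2
    have e1 : inner ℝ D d = ‖d‖ ^ 2 + μ * inner ℝ d v := by
      rw [show D = d + μ • v by rw [hd]; abel, inner_add_left, real_inner_self_eq_norm_sq,
        real_inner_smul_left, real_inner_comm]
    have e2 : inner ℝ D v = inner ℝ d v + μ * ‖v‖ ^ 2 := by
      rw [show D = d + μ • v by rw [hd]; abel, inner_add_left, real_inner_smul_left,
        real_inner_self_eq_norm_sq]
    have e3 : inner ℝ v d = inner ℝ d v := real_inner_comm _ _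
    simp only [e1, e2, e3] at u1 l1 l2
    nlinarith
  -- For `μ < L` the optimal choice is `t = 1 / (L - μ)`. For `μ = L` the quadratic term in `t`
  -- disappears, and since `t` is arbitrary, `d` must vanish.
  have hd2 : ‖d‖ ^ 2 ≤ (L - μ) * inner ℝ d v := by
    rcases hμL.eq_or_lt with h | h
    · have h0 : ‖d‖ ^ 2 ≤ 0 := by
        by_contra! hpos
        have h2 := hco (inner ℝ d v / ‖d‖ ^ 2 + 1)
        rw [h, sub_self, zero_mul, sub_zero] at h2
        have e : inner ℝ d v / ‖d‖ ^ 2 * ‖d‖ ^ 2 = inner ℝ d v := div_mul_cancel₀ _ hpos.ne'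
        have h3 := hco 1
        rw [h, sub_self, zero_mul, sub_zero] at h3
        nlinarith
      rw [h, sub_self, zero_mul]; exact h0
    · have h1 := hco (1 / (L - μ))
      have hpos : 0 < L - μ := sub_pos.2 h
      have e : 2 * (1 / (L - μ)) - (L - μ) * (1 / (L - μ)) ^ 2 = 1 / (L - μ) := by
        field_simp; ring
      rw [e, one_div, inv_mul_le_iff₀ hpos] at h1
      exact h1
  have e : y - η • D - x = v - η • D := by rw [hv]; abel
  have hDd : D = d + μ • v := by rw [hd]; abel
  have n1 : ‖D‖ ^ 2 = ‖d‖ ^ 2 + 2 * (μ * inner ℝ d v) + μ ^ 2 * ‖v‖ ^ 2 := by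
    rw [hDd, norm_add_sq_real, inner_smul_right, norm_smul, mul_pow, Real.norm_eq_abs, sq_abs]
  have n2 : inner ℝ v D = inner ℝ d v + μ * ‖v‖ ^ 2 := by
    rw [hDd, inner_add_right, inner_smul_right, real_inner_self_eq_norm_sq, real_inner_comm]
  -- The interpolation inequality for smooth strongly convex functions: both sides rewritten in `d`
  -- and `v` reduce it to the cocoercivity of `d`.
  have key : ‖D‖ ^ 2 + μ * L * ‖v‖ ^ 2 ≤ (μ + L) * inner ℝ v D := by
    rw [n1, n2]; nlinarith
  have hs : 0 < μ + L := by linarith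
  rw [e, norm_sub_sq_real, inner_smul_right, norm_smul, Real.norm_of_nonneg hη.le, mul_pow]
  have hη2 : η * (μ + L) ≤ 2 := by rwa [le_div_iff₀ hs] at hη'
  have k1 : η * (‖D‖ ^ 2 + μ * L * ‖v‖ ^ 2) / (μ + L) ≤ η * inner ℝ v D := by
    rw [div_le_iff₀ hs]; nlinarith [mul_le_mul_of_nonneg_left key hη.le]
  have k2 : η ^ 2 * ‖D‖ ^ 2 ≤ 2 * (η * ‖D‖ ^ 2 / (μ + L)) := by
    rw [← mul_div_assoc, le_div_iff₀ hs]
    nlinarith [mul_le_mul_of_nonneg_right hη2 (mul_nonneg hη.le (sq_nonneg ‖D‖))]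
  have k3 : η * (‖D‖ ^ 2 + μ * L * ‖v‖ ^ 2) / (μ + L) =
    η * ‖D‖ ^ 2 / (μ + L) + η * μ * L / (μ + L) * ‖v‖ ^ 2 := by ring
  have k4 : (1 - 2 * η * μ * L / (μ + L)) * ‖v‖ ^ 2 =
    ‖v‖ ^ 2 - 2 * (η * μ * L / (μ + L) * ‖v‖ ^ 2) := by ring
  rw [k4]
  linarith

end Convex

end DBOGT

namespace DBOGT

/-! ### The conjugate gradient method -/

section CG

open Polynomial

variable {q : ℕ}

/-- The recursion satisfied by the residuals and search directions of the conjugate gradient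
method. -/
structure CGRec (A : Vec q →L[ℝ] Vec q) (r d : ℕ → Vec q) (a b : ℕ → ℝ) : Prop where
  zero : d 0 = r 0
  r_succ : ∀ m, r (m + 1) = r m - a m • A (d m)
  d_succ : ∀ m, d (m + 1) = r (m + 1) + b m • d m
  a_eq : ∀ m, a m = ‖r m‖ ^ 2 / inner ℝ (d m) (A (d m))
  b_eq : ∀ m, b m = ‖r (m + 1)‖ ^ 2 / ‖r m‖ ^ 2

/-- The span of the first `m` search directions. -/
def searchSpan (d : ℕ → Vec q) (m : ℕ) : Submodule ℝ (Vec q) := Submodule.span ℝ (d '' Set.Iio m)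

lemma searchSpan_mono (d : ℕ → Vec q) {m m' : ℕ} (h : m ≤ m') : searchSpan d m ≤ searchSpan d m' :=
  Submodule.span_mono (Set.image_mono fun _ hx => lt_of_lt_of_le hx h)

lemma mem_searchSpan (d : ℕ → Vec q) {j m : ℕ} (h : j < m) : d j ∈ searchSpan d m :=
  Submodule.subset_span ⟨j, h, rfl⟩

lemma inner_eq_zero_of_mem_searchSpan {d : ℕ → Vec q} {m : ℕ} {x k : Vec q}
    (h : ∀ j < m, inner ℝ x (d j) = (0 : ℝ)) (hk : k ∈ searchSpan d m) :
    inner ℝ x k = (0 : ℝ) := by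
  induction hk using Submodule.span_induction with
  | mem y hy => obtain ⟨j, hj, rfl⟩ := hy; exact h j hj
  | zero => simp
  | add y z _ _ hy hz => rw [inner_add_right, hy, hz, add_zero]
  | smul c y _ hy => rw [inner_smul_right, hy, mul_zero]

variable {A : Vec q →L[ℝ] Vec q} {r d : ℕ → Vec q} {a b : ℕ → ℝ}

lemma CGRec.r_mem (h : CGRec A r d a b) (m : ℕ) : r m ∈ searchSpan d (m + 1) := by
  cases m with
  | zero => rw [← h.zero]; exact mem_searchSpan d zero_lt_one
  | succ m =>
    rw [show r (m + 1) = d (m + 1) - b m • d m by rw [h.d_succ]; abel]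
    exact Submodule.sub_mem _ (mem_searchSpan d (by omega))
      (Submodule.smul_mem _ _ (mem_searchSpan d (by omega)))

/-- As long as the step length is nonzero, the residual recursion can be solved for `A (d m)`, which
becomes a multiple of a difference of two residuals. -/
lemma CGRec.map_d_mem (h : CGRec A r d a b) {m : ℕ} (hm : a m ≠ 0) :
    A (d m) ∈ searchSpan d (m + 2) := by
  have : A (d m) = (a m)⁻¹ • (r m - r (m + 1)) := by
    rw [h.r_succ, sub_sub_cancel, smul_smul, inv_mul_cancel₀ hm, one_smul]
  rw [this]
  exact Submodule.smul_mem _ _ (Submodule.sub_mem _ (searchSpan_mono d (by omega) (h.r_mem m))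
    (h.r_mem (m + 1)))

/-- The three claims need a joint induction. Orthogonality of the new residual to the last direction
is the choice of `a`, to older ones it is conjugacy. Conjugacy of the new direction to the last one
is the choice of `b`; to an older `d j` it holds because `A (d j)` already lies in the span to which
the new residual is orthogonal. Nonvanishing residuals give nonzero directions, hence nonzero `a`.
-/
lemma CGRec.orthogonal (h : CGRec A r d a b) (hsym : ∀ x y, inner ℝ (A x) y = inner ℝ x (A y))
    (hpos : ∀ x, x ≠ 0 → 0 < inner ℝ (A x) x) (m : ℕ) (hr : ∀ j ≤ m, r j ≠ 0) :
    (∀ j < m, inner ℝ (r m) (d j) = (0 : ℝ)) ∧ (∀ j < m, inner ℝ (A (d m)) (d j) = (0 : ℝ)) ∧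
      (∀ j ≤ m, a j ≠ 0) := by
  have hrd : ∀ m, (∀ j < m, inner ℝ (r m) (d j) = (0 : ℝ)) → inner ℝ (r m) (d m) = ‖r m‖ ^ 2 := by
    intro m hm
    cases m with
    | zero => rw [h.zero, real_inner_self_eq_norm_sq]
    | succ m =>
      rw [h.d_succ, inner_add_right, inner_smul_right, hm m (by omega), real_inner_self_eq_norm_sq]
      ring
  have hdA : ∀ m, r m ≠ 0 → (∀ j < m, inner ℝ (r m) (d j) = (0 : ℝ)) →
      0 < inner ℝ (d m) (A (d m)) ∧ a m ≠ 0 := by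
    intro m hm0 hm
    have hd : d m ≠ 0 := fun h0 => by
      have := hrd m hm
      rw [h0, inner_zero_right] at this
      exact hm0 (by simpa using this.symm)
    have h1 : 0 < inner ℝ (d m) (A (d m)) := by rw [real_inner_comm]; exact hpos _ hd
    refine ⟨h1, ?_⟩
    rw [h.a_eq]
    exact div_ne_zero (by simpa using hm0) h1.ne'
  induction m with
  | zero =>
    refine ⟨by simp, by simp, fun j hj => ?_⟩
    obtain rfl : j = 0 := by omega
    exact (hdA 0 (hr 0 le_rfl) (by simp)).2
  | succ m ih =>
    obtain ⟨i1, i2, i3⟩ := ih fun j hj => hr j (by omega)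
    obtain ⟨hpm, ham⟩ := hdA m (hr m (by omega)) i1
    have hr0 : ‖r m‖ ^ 2 ≠ 0 := by simpa using hr m (by omega)
    have o1 : ∀ j < m + 1, inner ℝ (r (m + 1)) (d j) = (0 : ℝ) := fun j hj => by
      rw [h.r_succ, inner_sub_left, real_inner_smul_left]
      rcases Nat.lt_succ_iff_lt_or_eq.1 hj with hj | rfl
      · rw [i1 j hj, i2 j hj]; ring
      · rw [hrd j i1, h.a_eq, real_inner_comm (d j), div_mul_cancel₀ _ hpm.ne', sub_self]
    refine ⟨o1, fun j hj => ?_, fun j hj => ?_⟩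
    · rw [h.d_succ, map_add, map_smul, inner_add_left, real_inner_smul_left]
      rcases Nat.lt_succ_iff_lt_or_eq.1 hj with hj | rfl
      · rw [i2 j hj, hsym, inner_eq_zero_of_mem_searchSpan o1
          (searchSpan_mono d (by omega) (h.map_d_mem (i3 j hj.le)))]
        ring
      · have e1 : inner ℝ (r (j + 1)) (A (d j)) = - (a j)⁻¹ * ‖r (j + 1)‖ ^ 2 := by
          have : A (d j) = (a j)⁻¹ • (r j - r (j + 1)) := by
            rw [h.r_succ, sub_sub_cancel, smul_smul, inv_mul_cancel₀ ham, one_smul]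
          rw [this, inner_smul_right, inner_sub_right, inner_eq_zero_of_mem_searchSpan o1
            (h.r_mem j), real_inner_self_eq_norm_sq]
          ring
        rw [hsym, e1, hsym, h.b_eq, h.a_eq]
        field_simp
        ring
    · rcases Nat.lt_succ_iff_lt_or_eq.1 (Nat.lt_succ_of_le hj) with hj | rfl
      · exact i3 j (by omega)
      · exact (hdA (m + 1) (hr _ le_rfl) o1).2

lemma CGRec.map_mem (h : CGRec A r d a b) {m : ℕ} (ha : ∀ j < m, a j ≠ 0) {k : Vec q}
    (hk : k ∈ searchSpan d m) : A k ∈ searchSpan d (m + 1) := by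
  induction hk using Submodule.span_induction with
  | mem y hy =>
    obtain ⟨j, hj, rfl⟩ := hy
    have hj : j < m := hj
    exact searchSpan_mono d (by omega) (h.map_d_mem (ha j hj))
  | zero => simp
  | add y z _ _ hy hz => rw [map_add]; exact Submodule.add_mem _ hy hz
  | smul c y _ hy => rw [map_smul]; exact Submodule.smul_mem _ _ hy

lemma CGRec.pow_mem (h : CGRec A r d a b) (i : ℕ) (ha : ∀ j < i, a j ≠ 0) :
    ((A : Vec q →ₗ[ℝ] Vec q) ^ i) (r 0) ∈ searchSpan d (i + 1) := by
  induction i with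
  | zero => simpa using h.r_mem 0
  | succ i ih =>
    rw [pow_succ', Module.End.mul_apply]
    refine h.map_mem (m := i + 1) ha (ih fun j hj => ha j (by omega))

/-- Both vectors differ from `e 0` by an element of the search space: `e m` by the steps taken, and
`P(A) e 0` because `P - 1` is divisible by `X`, so that the difference is a polynomial of degree
below `m` in `A` applied to `r 0`. Every such polynomial is therefore a competitor for the conjugate
gradient iterate. -/
lemma CGRec.aeval_sub_mem (h : CGRec A r d a b) {m : ℕ} (ha : ∀ j < m, a j ≠ 0) (e : ℕ → Vec q)
    (he : ∀ m, e (m + 1) = e m - a m • d m) (he0 : A (e 0) = r 0) (P : ℝ[X])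
    (hP : P.natDegree ≤ m) (hP0 : P.eval 0 = 1) :
    aeval (A : Vec q →ₗ[ℝ] Vec q) P (e 0) - e m ∈ searchSpan d m := by
  have h1 : ∀ m, e 0 - e m ∈ searchSpan d m := fun m => by
    induction m with
    | zero => simp
    | succ m ih =>
      rw [he, show e 0 - (e m - a m • d m) = (e 0 - e m) + a m • d m by abel]
      exact Submodule.add_mem _ (searchSpan_mono d (by omega) ih)
        (Submodule.smul_mem _ _ (mem_searchSpan d (by omega)))
  have h2 : aeval (A : Vec q →ₗ[ℝ] Vec q) P (e 0) =
      aeval (A : Vec q →ₗ[ℝ] Vec q) P.divX (r 0) + e 0 := by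
    conv_lhs => rw [← divX_mul_X_add P]
    rw [← coeff_zero_eq_eval_zero] at hP0
    simp [hP0, Module.End.mul_apply, he0]
  rw [h2, add_sub_assoc]
  refine Submodule.add_mem _ ?_ (h1 m)
  rcases Nat.eq_zero_or_pos m with rfl | hm
  · have : P.divX = 0 := divX_eq_zero_iff.2 (eq_C_of_natDegree_le_zero hP)
    simp [this]
  · rw [aeval_eq_sum_range' (n := m) (by rw [natDegree_divX_eq_natDegree_tsub_one]; omega)]
    simp only [LinearMap.sum_apply, LinearMap.smul_apply]
    refine Submodule.sum_mem _ fun i hi => Submodule.smul_mem _ _ ?_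
    have hi := Finset.mem_range.1 hi
    exact searchSpan_mono d (by omega) (h.pow_mem i fun j hj => ha j (by omega))

/-- A polynomial in a symmetric operator is small in the energy norm if the polynomial is small on
the spectrum. -/
lemma inner_aeval_le {L μ ε : ℝ} (hsym : ∀ x y, inner ℝ (A x) y = inner ℝ x (A y)) (hμ0 : 0 < μ)
    (hμ : ∀ x, μ * ‖x‖ ^ 2 ≤ inner ℝ (A x) x) (hL : ‖A‖ ≤ L) (P : ℝ[X])
    (hP : ∀ t, μ ≤ t → t ≤ L → |P.eval t| ≤ ε) (e : Vec q) :
    inner ℝ (A (aeval (A : Vec q →ₗ[ℝ] Vec q) P e)) (aeval (A : Vec q →ₗ[ℝ] Vec q) P e)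
      ≤ L * ε ^ 2 * ‖e‖ ^ 2 := by
  set A' : Vec q →ₗ[ℝ] Vec q := (A : Vec q →ₗ[ℝ] Vec q) with hA'
  have hs : A'.IsSymmetric := fun x y => hsym x y
  set b := hs.eigenvectorBasis (finrank_euclideanSpace_fin (𝕜 := ℝ) (n := q)) with hb
  set l := hs.eigenvalues (finrank_euclideanSpace_fin (𝕜 := ℝ) (n := q)) with hl
  have hev : ∀ k, A' (b k) = l k • b k := fun k => hs.apply_eigenvectorBasis _ k
  have hin : ∀ k x, inner ℝ (b k) (A' x) = l k * inner ℝ (b k) x := fun k x => by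
    rw [← hs, hev, real_inner_smul_left]
  have hlow : ∀ k, μ ≤ l k ∧ l k ≤ L := fun k => by
    have h1 := hμ (b k)
    have h2 : inner ℝ (A (b k)) (b k) = l k := by
      have : A (b k) = l k • b k := hev k
      rw [this, real_inner_smul_left, real_inner_self_eq_norm_sq, b.orthonormal.1 k]; simp
    have h3 := real_inner_le_norm (A (b k)) (b k)
    have h4 := A.le_opNorm (b k)
    rw [h2, b.orthonormal.1 k] at h1 h3
    rw [b.orthonormal.1 k] at h4
    constructor <;> linarith
  have hpow : ∀ k x (i : ℕ), inner ℝ (b k) ((A' ^ i) x) = l k ^ i * inner ℝ (b k) x := by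
    intro k x i
    induction i with
    | zero => simp
    | succ i ih => rw [pow_succ', Module.End.mul_apply, hin, ih]; ring
  have hpoly : ∀ k x, inner ℝ (b k) (aeval A' P x) = P.eval (l k) * inner ℝ (b k) x := by
    intro k x
    rw [aeval_eq_sum_range, eval_eq_sum_range, LinearMap.sum_apply, inner_sum, Finset.sum_mul]
    refine Finset.sum_congr rfl fun i _ => ?_
    rw [LinearMap.smul_apply, inner_smul_right, hpow]; ring
  have hε : ∀ k, P.eval (l k) ^ 2 ≤ ε ^ 2 := fun k => by
    rw [← sq_abs]
    exact pow_le_pow_left₀ (abs_nonneg _) (hP _ (hlow k).1 (hlow k).2) 2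
  have e1 : inner ℝ (A' (aeval A' P e)) (aeval A' P e) =
      ∑ k, l k * P.eval (l k) ^ 2 * inner ℝ (b k) e ^ 2 := by
    rw [← b.sum_inner_mul_inner]
    refine Finset.sum_congr rfl fun k _ => ?_
    rw [real_inner_comm, hin, hpoly]; ring
  have e2 : ‖e‖ ^ 2 = ∑ k, inner ℝ (b k) e ^ 2 := by
    rw [← b.sum_sq_norm_inner_right]
    simp
  have e3 : inner ℝ (A (aeval A' P e)) (aeval A' P e) =
    inner ℝ (A' (aeval A' P e)) (aeval A' P e) := rfl
  rw [e3, e1, e2, Finset.mul_sum]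
  refine Finset.sum_le_sum fun k _ => mul_le_mul_of_nonneg_right ?_ (sq_nonneg _)
  obtain ⟨k1, k2⟩ := hlow k
  exact mul_le_mul k2 (hε k) (sq_nonneg _) (by linarith)

/-- The Chebyshev polynomial that is normalized at `0` and small on `[μ, L]`. -/
lemma exists_small_polynomial {L μ : ℝ} (hμ : 0 < μ) (hμL : μ ≤ L) (N : ℕ) :
    ∃ P : ℝ[X], P.natDegree ≤ N ∧ P.eval 0 = 1 ∧ ∀ t, μ ≤ t → t ≤ L →
      |P.eval t| ≤ 2 * ((√(L / μ) - 1) / (√(L / μ) + 1)) ^ N := by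
  -- For `μ = L` the interval is a point and the Chebyshev rescaling degenerates; `1 - X / μ`
  -- vanishes there, and for `N = 0` the constant `1` is enough.
  rcases hμL.eq_or_lt with rfl | hlt
  · rcases Nat.eq_zero_or_pos N with rfl | hN
    · exact ⟨1, by simp, by simp, by simp⟩
    · refine ⟨1 - C μ⁻¹ * X, ?_, by simp, fun t h1 h2 => ?_⟩
      · refine (natDegree_sub_le _ _).trans ?_
        rw [natDegree_one]
        exact max_le (by omega) ((natDegree_C_mul_le _ _).trans (natDegree_X_le.trans hN))
      · obtain rfl := le_antisymm h1 h2
        simp [hμ.ne', hN.ne']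
  · set s := √(L / μ) with hs
    have hs1 : 1 < s := by
      rw [hs, Real.lt_sqrt (by norm_num), one_pow, one_lt_div hμ]
      exact hlt
    have hss : s ^ 2 = L / μ := Real.sq_sqrt (div_nonneg (hμ.trans hlt).le hμ.le)
    have hL : L = s ^ 2 * μ := by rw [hss, div_mul_cancel₀ _ hμ.ne']
    set w := (s + 1) / (s - 1) with hw
    have hs0 : 0 < s - 1 := by linarith
    have hs2 : s ^ 2 - 1 ≠ 0 := by nlinarith
    have hw0 : 0 < w := by positivity
    -- The point `0` is mapped to a hyperbolic cosine of `log w`, so the Chebyshev polynomial there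
    -- is `cosh (N log w) ≥ w ^ N / 2`, whereas it is at most `1` on the image of `[μ, L]`.
    have hx0 : (L + μ) / (L - μ) = Real.cosh (Real.log w) := by
      rw [Real.cosh_log hw0, hw, inv_div, hL]
      have h1 : s ^ 2 * μ - μ ≠ 0 := by
        rw [show s ^ 2 * μ - μ = (s ^ 2 - 1) * μ by ring]; exact mul_ne_zero hs2 hμ.ne'
      have h2 : s + 1 ≠ 0 := by positivity
      field_simp
      ring
    set τ := (Chebyshev.T ℝ N).eval ((L + μ) / (L - μ)) with hτ
    have hτge : w ^ N / 2 ≤ τ := by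
      rw [hτ, hx0, Chebyshev.T_real_cosh, Real.cosh_eq]
      have : Real.exp ((N : ℤ) * Real.log w) = w ^ N := by
        rw [Int.cast_natCast, mul_comm, Real.exp_mul, Real.exp_log hw0, Real.rpow_natCast]
      rw [this]
      have := Real.exp_pos (-((N : ℤ) * Real.log w))
      linarith
    have hτ0 : 0 < τ := lt_of_lt_of_le (by positivity) hτge
    have hLμ : 0 < L - μ := by linarith
    refine ⟨C τ⁻¹ * (Chebyshev.T ℝ N).comp (C (-(2 / (L - μ))) * X + C ((L + μ) / (L - μ))),
      ?_, ?_, fun t h1 h2 => ?_⟩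
    · refine (natDegree_C_mul_le _ _).trans (natDegree_comp_le.trans ?_)
      rw [Chebyshev.natDegree_T, Int.natAbs_natCast]
      exact (Nat.mul_le_mul_left N natDegree_linear_le).trans (by simp)
    · simp [hτ0.ne', ← hτ]
    · have hT : |(Chebyshev.T ℝ N).eval (-(2 / (L - μ)) * t + (L + μ) / (L - μ))| ≤ 1 := by
        have e : -(2 / (L - μ)) * t + (L + μ) / (L - μ) = (L + μ - 2 * t) / (L - μ) := by ring
        rw [e, ← Real.cos_arccos (x := (L + μ - 2 * t) / (L - μ)), Chebyshev.T_real_cos]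
        · exact Real.abs_cos_le_one _
        · rw [le_div_iff₀ hLμ]; linarith
        · rw [div_le_iff₀ hLμ]; linarith
      have e2 : 2 * ((s - 1) / (s + 1)) ^ N = (w ^ N / 2)⁻¹ := by
        rw [hw, inv_div, div_pow, div_pow]
        field_simp
      rw [e2]
      simp only [eval_mul, eval_C, eval_comp, eval_add, eval_X, abs_mul]
      rw [abs_of_pos (inv_pos.2 hτ0)]
      calc _ ≤ τ⁻¹ * 1 := mul_le_mul_of_nonneg_left hT (inv_pos.2 hτ0).le
        _ ≤ _ := by rw [mul_one]; exact inv_anti₀ (by positivity) hτge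

/-- Convergence rate of the conjugate gradient method. -/
theorem norm_sub_cg_sq_le {L μ : ℝ} (A : Vec q →L[ℝ] Vec q) (hμ0 : 0 < μ) (hμL : μ ≤ L)
    (hsym : ∀ x y, inner ℝ (A x) y = inner ℝ x (A y))
    (hμ : ∀ x, μ * ‖x‖ ^ 2 ≤ inner ℝ (A x) x) (hL : ‖A‖ ≤ L) (b v₀ v : Vec q) (hv : A v = b)
    (N : ℕ) : ‖v - cg A b v₀ N‖ ^ 2 ≤ 4 * (L / μ) * deltaK L μ N * ‖v - v₀‖ ^ 2 := by
  set s : ℕ → CGState q := fun m => (cgStep A)^[m] { v := v₀, r := b - A v₀, d := b - A v₀ } with hs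
  have hsucc : ∀ m, s (m + 1) = cgStep A (s m) := fun m => Function.iterate_succ_apply' _ _ _
  set al : ℕ → ℝ := fun m => ‖(s m).r‖ ^ 2 / inner ℝ (s m).d (A (s m).d) with hal
  set be : ℕ → ℝ := fun m => ‖(s (m + 1)).r‖ ^ 2 / ‖(s m).r‖ ^ 2 with hbe
  have hrec : CGRec A (fun m => (s m).r) (fun m => (s m).d) al be := by
    refine ⟨rfl, fun m => ?_, fun m => ?_, fun m => rfl, fun m => rfl⟩
    · simp only [hsucc, cgStep, hal]
    · simp only [hbe, hsucc, cgStep]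
  set e : ℕ → Vec q := fun m => v - (s m).v with he
  have hesucc : ∀ m, e (m + 1) = e m - al m • (s m).d := fun m => by
    simp only [he, hsucc, cgStep, hal]; abel
  have hAe : ∀ m, A (e m) = (s m).r := fun m => by
    induction m with
    | zero => simp [he, hs, hv]
    | succ m ih => rw [hesucc, map_sub, map_smul, ih]; exact (hrec.r_succ m).symm
  have hpos : ∀ x, x ≠ 0 → 0 < inner ℝ (A x) x := fun x hx =>
    lt_of_lt_of_le (mul_pos hμ0 (by positivity)) (hμ x)
  have hL0 : 0 < L := hμ0.trans_le hμL
  have hrzero : ∀ j m, j ≤ m → (s j).r = 0 → (s m).r = 0 := by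
    intro j m hjm hj
    induction m, hjm using Nat.le_induction with
    | base => exact hj
    | succ m _ ih =>
      have := hrec.r_succ m
      rw [this, hrec.a_eq, ih]; simp
  have hgoal : v - cg A b v₀ N = e N := rfl
  have hnn : 0 ≤ 4 * (L / μ) * deltaK L μ N * ‖v - v₀‖ ^ 2 := by
    have : 0 ≤ deltaK L μ N := by rw [deltaK]; exact (even_two_mul N).pow_nonneg _
    positivity
  rw [hgoal]
  -- After early termination the orthogonality relations are not available, but the error is then
  -- zero by coercivity.
  by_cases hrN : (s N).r = 0
  · have h1 := hμ (e N)
    rw [hAe, hrN, inner_zero_left] at h1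
    have h2 : ‖e N‖ ^ 2 ≤ 0 := by
      by_contra! h
      nlinarith
    exact h2.trans hnn
  · obtain ⟨o1, -, o3⟩ := hrec.orthogonal hsym hpos N fun j hj h => hrN (hrzero j N hj h)
    obtain ⟨P, P1, P2, P3⟩ := exists_small_polynomial hμ0 hμL N
    have hmem := hrec.aeval_sub_mem (m := N) (fun j hj => o3 j hj.le) e hesucc (hAe 0) P P1 P2
    set w := aeval (A : Vec q →ₗ[ℝ] Vec q) P (e 0) with hw
    -- Optimality in the energy norm: `A (e N)` is the residual, which is orthogonal to the search
    -- space containing `w - e N`, so the energy of `w` splits into two nonnegative parts.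
    have hen : inner ℝ (A (e N)) (e N) ≤ inner ℝ (A w) w := by
      have hk := inner_eq_zero_of_mem_searchSpan o1 hmem
      set k := w - e N with hk'
      have : w = e N + k := by rw [hk']; abel
      rw [← hAe] at hk
      rw [this, map_add, inner_add_left, inner_add_right, inner_add_right, hk, hsym k (e N),
        real_inner_comm (A (e N)) k, hk]
      have := hμ k
      have := mul_nonneg hμ0.le (sq_nonneg ‖k‖)
      linarith
    have h1 := inner_aeval_le hsym hμ0 hμ hL P P3 (e 0)
    have h2 := (hμ (e N)).trans (hen.trans h1)
    have h3 : (2 * ((√(L / μ) - 1) / (√(L / μ) + 1)) ^ N) ^ 2 = 4 * deltaK L μ N := by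
      rw [deltaK, mul_pow, ← pow_mul, mul_comm N 2]; norm_num
    rw [h3] at h2
    have h4 : e 0 = v - v₀ := rfl
    rw [h4] at h2
    rw [show 4 * (L / μ) * deltaK L μ N * ‖v - v₀‖ ^ 2 =
      L * (4 * deltaK L μ N) * ‖v - v₀‖ ^ 2 / μ by ring, le_div_iff₀ hμ0]
    linarith

end CG

end DBOGT

namespace DBOGT

/-! ### Partial derivatives of the upper and lower level functions -/

section Partial

variable {p q : ℕ}

/-- The point `(x, y)` of `ℝ^p × ℝ^q`. -/
abbrev pt (x : Vec p) (y : Vec q) : WithLp 2 (Vec p × Vec q) := WithLp.toLp 2 (x, y)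

/-- The inclusion `x ↦ (x, 0)`. -/
noncomputable def inlL (p q : ℕ) : Vec p →L[ℝ] WithLp 2 (Vec p × Vec q) :=
  ((WithLp.prodContinuousLinearEquiv 2 ℝ (Vec p) (Vec q)).symm :
    Vec p × Vec q →L[ℝ] WithLp 2 (Vec p × Vec q)).comp (ContinuousLinearMap.inl ℝ _ _)

/-- The inclusion `y ↦ (0, y)`. -/
noncomputable def inrL (p q : ℕ) : Vec q →L[ℝ] WithLp 2 (Vec p × Vec q) :=
  ((WithLp.prodContinuousLinearEquiv 2 ℝ (Vec p) (Vec q)).symm :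
    Vec p × Vec q →L[ℝ] WithLp 2 (Vec p × Vec q)).comp (ContinuousLinearMap.inr ℝ _ _)

lemma inlL_apply (x : Vec p) : inlL p q x = pt x 0 := rfl

lemma inrL_apply (y : Vec q) : inrL p q y = pt 0 y := rfl

lemma norm_pt_sub_sq (x x' : Vec p) (y y' : Vec q) :
    ‖pt x y - pt x' y'‖ ^ 2 = ‖x - x'‖ ^ 2 + ‖y - y'‖ ^ 2 := by
  rw [WithLp.prod_norm_sq_eq_of_L2]; rfl

lemma norm_fst_le (z : WithLp 2 (Vec p × Vec q)) : ‖z.fst‖ ≤ ‖z‖ := by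
  refine le_of_sq_le_sq ?_ (norm_nonneg _)
  rw [WithLp.prod_norm_sq_eq_of_L2 z]
  exact le_add_of_nonneg_right (sq_nonneg _)

lemma norm_snd_le (z : WithLp 2 (Vec p × Vec q)) : ‖z.snd‖ ≤ ‖z‖ := by
  refine le_of_sq_le_sq ?_ (norm_nonneg _)
  rw [WithLp.prod_norm_sq_eq_of_L2 z]
  exact le_add_of_nonneg_left (sq_nonneg _)

lemma norm_pt_sub_left (x x' : Vec p) (y : Vec q) : ‖pt x y - pt x' y‖ = ‖x - x'‖ := by
  refine (sq_eq_sq₀ (norm_nonneg _) (norm_nonneg _)).1 ?_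
  rw [norm_pt_sub_sq]; simp

lemma norm_pt_sub_right (x : Vec p) (y y' : Vec q) : ‖pt x y - pt x y'‖ = ‖y - y'‖ := by
  refine (sq_eq_sq₀ (norm_nonneg _) (norm_nonneg _)).1 ?_
  rw [norm_pt_sub_sq]; simp

lemma hasFDerivAt_pt_left (x : Vec p) (y : Vec q) :
    HasFDerivAt (fun x' => pt x' y) (inlL p q) x := by
  have h : (fun x' => pt x' y) = fun x' => inlL p q x' + pt 0 y := by
    ext1 x'
    rw [inlL_apply, ← WithLp.toLp_add]; simp
  rw [h]
  exact (inlL p q).hasFDerivAt.add_const _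

lemma hasFDerivAt_pt_right (x : Vec p) (y : Vec q) :
    HasFDerivAt (fun y' => pt x y') (inrL p q) y := by
  have h : (fun y' => pt x y') = fun y' => inrL p q y' + pt x 0 := by
    ext1 y'
    rw [inrL_apply, ← WithLp.toLp_add]; simp
  rw [h]
  exact (inrL p q).hasFDerivAt.add_const _

variable {h : Vec p → Vec q → ℝ}

lemma hasGradientAt_left (hd : Differentiable ℝ (joint h)) (x : Vec p) (y : Vec q) :
    HasGradientAt (fun x' => h x' y) (gradient (joint h) (pt x y)).fst x := by
  rw [hasGradientAt_iff_hasFDerivAt]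
  have h1 := (hd (pt x y)).hasGradientAt.hasFDerivAt.comp x (hasFDerivAt_pt_left x y)
  have e : InnerProductSpace.toDual ℝ (Vec p) (gradient (joint h) (pt x y)).fst =
      (InnerProductSpace.toDual ℝ _ (gradient (joint h) (pt x y))).comp (inlL p q) := by
    ext1 v
    rw [ContinuousLinearMap.comp_apply, InnerProductSpace.toDual_apply_apply,
      InnerProductSpace.toDual_apply_apply, inlL_apply, WithLp.prod_inner_apply]
    simp
  rw [e]
  exact h1

lemma hasGradientAt_right (hd : Differentiable ℝ (joint h)) (x : Vec p) (y : Vec q) :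
    HasGradientAt (fun y' => h x y') (gradient (joint h) (pt x y)).snd y := by
  rw [hasGradientAt_iff_hasFDerivAt]
  have h1 := (hd (pt x y)).hasGradientAt.hasFDerivAt.comp y (hasFDerivAt_pt_right x y)
  have e : InnerProductSpace.toDual ℝ (Vec q) (gradient (joint h) (pt x y)).snd =
      (InnerProductSpace.toDual ℝ _ (gradient (joint h) (pt x y))).comp (inrL p q) := by
    ext1 v
    rw [ContinuousLinearMap.comp_apply, InnerProductSpace.toDual_apply_apply,
      InnerProductSpace.toDual_apply_apply, inrL_apply, WithLp.prod_inner_apply]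
    simp
  rw [e]
  exact h1

lemma gradX_eq (hd : Differentiable ℝ (joint h)) (x : Vec p) (y : Vec q) :
    gradX h x y = (gradient (joint h) (pt x y)).fst := (hasGradientAt_left hd x y).gradient

lemma gradY_eq (hd : Differentiable ℝ (joint h)) (x : Vec p) (y : Vec q) :
    gradY h x y = (gradient (joint h) (pt x y)).snd := (hasGradientAt_right hd x y).gradient

lemma norm_gradX_sub_le {L : ℝ} (hd : Differentiable ℝ (joint h))
    (hL : Lip L (gradient (joint h))) (x x' : Vec p) (y y' : Vec q) :
    ‖gradX h x y - gradX h x' y'‖ ≤ L * ‖pt x y - pt x' y'‖ := by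
  rw [gradX_eq hd, gradX_eq hd, ← WithLp.sub_fst]
  exact (norm_fst_le _).trans (hL _ _)

lemma norm_gradY_sub_le {L : ℝ} (hd : Differentiable ℝ (joint h))
    (hL : Lip L (gradient (joint h))) (x x' : Vec p) (y y' : Vec q) :
    ‖gradY h x y - gradY h x' y'‖ ≤ L * ‖pt x y - pt x' y'‖ := by
  rw [gradY_eq hd, gradY_eq hd, ← WithLp.sub_snd]
  exact (norm_snd_le _).trans (hL _ _)

/-- The assumptions on one upper level function. -/
structure UpperReg (L Lf0 : ℝ) (f : Vec p → Vec q → ℝ) : Prop where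
  diff : Differentiable ℝ (joint f)
  lip : Lip Lf0 (joint f)
  grad_lip : Lip L (gradient (joint f))

/-- The assumptions on one lower level function. -/
structure LowerReg (L Lg2 μ : ℝ) (g : Vec p → Vec q → ℝ) : Prop where
  contDiff : ContDiff ℝ 2 (joint g)
  grad_lip : Lip L (gradient (joint g))
  hess_lip : Lip Lg2 (fderiv ℝ (gradient (joint g)))
  strong : ∀ x, StrongConvexOn Set.univ μ (g x)

lemma Regular.upper {n : ℕ} {L Lf0 Lg2 μ : ℝ} {f g : Fin n → Vec p → Vec q → ℝ}
    (hR : Regular L Lf0 Lg2 μ f g) (i : Fin n) : UpperReg L Lf0 (f i) :=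
  ⟨hR.f_diff i, hR.f_lip i, hR.f_grad_lip i⟩

lemma Regular.lower {n : ℕ} {L Lf0 Lg2 μ : ℝ} {f g : Fin n → Vec p → Vec q → ℝ}
    (hR : Regular L Lf0 Lg2 μ f g) (i : Fin n) : LowerReg L Lg2 μ (g i) :=
  ⟨hR.g_diff i, hR.g_grad_lip i, hR.g_hess_lip i, hR.g_strong i⟩

lemma UpperReg.norm_gradX_le {L Lf0 : ℝ} {f : Vec p → Vec q → ℝ} (hf : UpperReg L Lf0 f)
    (h0 : 0 ≤ Lf0) (x : Vec p) (y : Vec q) : ‖gradX f x y‖ ≤ Lf0 := by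
  rw [gradX_eq hf.diff]
  exact (norm_fst_le _).trans (norm_gradient_le_of_lip h0 hf.lip _)

lemma UpperReg.norm_gradY_le {L Lf0 : ℝ} {f : Vec p → Vec q → ℝ} (hf : UpperReg L Lf0 f)
    (h0 : 0 ≤ Lf0) (x : Vec p) (y : Vec q) : ‖gradY f x y‖ ≤ Lf0 := by
  rw [gradY_eq hf.diff]
  exact (norm_snd_le _).trans (norm_gradient_le_of_lip h0 hf.lip _)

/-- The gradient is the inverse Riesz map applied to `fderiv`, so its derivative represents the
second derivative, which is symmetric. -/
lemma fderiv_gradient_inner {E : Type*} [NormedAddCommGroup E] [InnerProductSpace ℝ E]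
    [CompleteSpace E] {φ : E → ℝ} (hφ : ContDiff ℝ 2 φ) :
    Differentiable ℝ (gradient φ) ∧ ∀ z u v : E,
      inner ℝ (fderiv ℝ (gradient φ) z u) v = inner ℝ u (fderiv ℝ (gradient φ) z v) := by
  have h1 : Differentiable ℝ (fderiv ℝ φ) :=
    (hφ.fderiv_right (m := 1) (by norm_num)).differentiable (by norm_num)
  -- The inverse Riesz map is typed as conjugate-linear; over `ℝ` it is repackaged as a linear map
  -- so that the chain rule applies.
  let T : StrongDual ℝ E →L[ℝ] E := LinearMap.mkContinuous
    { toFun := fun l => (InnerProductSpace.toDual ℝ E).symm l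
      map_add' := fun l m => map_add _ l m
      map_smul' := fun c l => by simp } 1 fun l => by simp
  have hT : gradient φ = fun z => T (fderiv ℝ φ z) := rfl
  have hd : ∀ z, HasFDerivAt (gradient φ) (T.comp (fderiv ℝ (fderiv ℝ φ) z)) z := fun z => by
    rw [hT]
    exact T.hasFDerivAt.comp z (h1 z).hasFDerivAt
  refine ⟨fun z => (hd z).differentiableAt, fun z u v => ?_⟩
  have hs : IsSymmSndFDerivAt ℝ φ z := hφ.contDiffAt.isSymmSndFDerivAt (by simp)
  have hi : ∀ u v, inner ℝ (fderiv ℝ (gradient φ) z u) v = fderiv ℝ (fderiv ℝ φ) z u v := by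
    intro u v
    rw [(hd z).fderiv]
    exact InnerProductSpace.toDual_symm_apply
  rw [real_inner_comm _ u, hi, hi, hs.eq]

/-- Limit of the monotonicity inequality for difference quotients in direction `v`. -/
lemma StronglyMonotone.le_inner_fderiv {E : Type*} [NormedAddCommGroup E] [InnerProductSpace ℝ E]
    {G : E → E} {μ : ℝ} (hμ : StronglyMonotone μ G) {B : E →L[ℝ] E} {y : E}
    (hB : HasFDerivAt G B y) (v : E) : μ * ‖v‖ ^ 2 ≤ inner ℝ (B v) v := by
  have h0 : HasDerivAt (fun t : ℝ => y + t • v) v 0 := by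
    simpa using ((hasDerivAt_id (0 : ℝ)).smul_const v).const_add y
  have h1 : HasDerivAt (fun t : ℝ => G (y + t • v)) (B v) 0 :=
    HasFDerivAt.comp_hasDerivAt (0 : ℝ) (by simpa using hB) h0
  have h2 := (h1.tendsto_slope_zero_right).inner (𝕜 := ℝ) (tendsto_const_nhds (x := v))
  refine ge_of_tendsto h2 ?_
  filter_upwards [self_mem_nhdsWithin] with t ht
  have ht : 0 < t := ht
  have h3 := hμ (y + t • v) y
  rw [add_sub_cancel_left, norm_smul, Real.norm_of_nonneg ht.le, inner_smul_right] at h3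
  simp only [zero_add, zero_smul, add_zero]
  rw [real_inner_smul_left, ← div_eq_inv_mul, le_div_iff₀ ht]
  have h4 : t * (μ * ‖v‖ ^ 2 * t) ≤ t * inner ℝ (G (y + t • v) - G y) v := by nlinarith
  exact le_of_mul_le_mul_left h4 ht

namespace LowerReg

variable {L Lg2 μ : ℝ} {g : Vec p → Vec q → ℝ}

lemma diff (hg : LowerReg L Lg2 μ g) : Differentiable ℝ (joint g) :=
  hg.contDiff.differentiable (by norm_num)

lemma differentiable_right (hg : LowerReg L Lg2 μ g) (x : Vec p) : Differentiable ℝ (g x) :=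
  fun y => (hasGradientAt_right hg.diff x y).differentiableAt

lemma lip_gradY (hg : LowerReg L Lg2 μ g) (x : Vec p) : Lip L (gradY g x) := fun y y' => by
  rw [← norm_pt_sub_right x y y']
  exact norm_gradY_sub_le hg.diff hg.grad_lip x x y y'

lemma monotone_gradY (hg : LowerReg L Lg2 μ g) (x : Vec p) : StronglyMonotone μ (gradY g x) :=
  strong_monotone_gradient (hg.differentiable_right x) (hg.strong x)

lemma hasFDerivAt_gradY (hg : LowerReg L Lg2 μ g) (z : WithLp 2 (Vec p × Vec q)) :
    HasFDerivAt (fun z : WithLp 2 (Vec p × Vec q) => gradY g z.fst z.snd)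
      ((WithLp.sndL 2 ℝ (Vec p) (Vec q)).comp (fderiv ℝ (gradient (joint g)) z)) z := by
  have h : (fun z : WithLp 2 (Vec p × Vec q) => gradY g z.fst z.snd) =
      fun z => WithLp.sndL 2 ℝ (Vec p) (Vec q) (gradient (joint g) z) := by
    ext1 z; exact gradY_eq hg.diff z.fst z.snd
  rw [h]
  exact (WithLp.sndL 2 ℝ (Vec p) (Vec q)).hasFDerivAt.comp z
    ((fderiv_gradient_inner hg.contDiff).1 z).hasFDerivAt

lemma hasFDerivAt_gradX (hg : LowerReg L Lg2 μ g) (z : WithLp 2 (Vec p × Vec q)) :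
    HasFDerivAt (fun z : WithLp 2 (Vec p × Vec q) => gradX g z.fst z.snd)
      ((WithLp.fstL 2 ℝ (Vec p) (Vec q)).comp (fderiv ℝ (gradient (joint g)) z)) z := by
  have h : (fun z : WithLp 2 (Vec p × Vec q) => gradX g z.fst z.snd) =
      fun z => WithLp.fstL 2 ℝ (Vec p) (Vec q) (gradient (joint g) z) := by
    ext1 z; exact gradX_eq hg.diff z.fst z.snd
  rw [h]
  exact (WithLp.fstL 2 ℝ (Vec p) (Vec q)).hasFDerivAt.comp z
    ((fderiv_gradient_inner hg.contDiff).1 z).hasFDerivAt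

lemma hasFDerivAt_hessY (hg : LowerReg L Lg2 μ g) (x : Vec p) (y : Vec q) :
    HasFDerivAt (gradY g x) (((WithLp.sndL 2 ℝ (Vec p) (Vec q)).comp
      (fderiv ℝ (gradient (joint g)) (pt x y))).comp (inrL p q)) y :=
  (hg.hasFDerivAt_gradY (pt x y)).comp y (hasFDerivAt_pt_right x y)

lemma hessY_apply (hg : LowerReg L Lg2 μ g) (x : Vec p) (y v : Vec q) :
    hessY g x y v = (fderiv ℝ (gradient (joint g)) (pt x y) (pt 0 v)).snd := by
  rw [hessY, (hg.hasFDerivAt_hessY x y).fderiv]; rfl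

lemma jacXY_apply (hg : LowerReg L Lg2 μ g) (x : Vec p) (y v : Vec q) :
    jacXY g x y v = (fderiv ℝ (gradient (joint g)) (pt x y) (pt 0 v)).fst := by
  have h : HasFDerivAt (gradX g x) _ y :=
    (hg.hasFDerivAt_gradX (pt x y)).comp y (hasFDerivAt_pt_right x y)
  rw [jacXY, h.fderiv]; rfl

lemma hessY_symm (hg : LowerReg L Lg2 μ g) (x : Vec p) (y u v : Vec q) :
    inner ℝ (hessY g x y u) v = inner ℝ u (hessY g x y v) := by
  have h := (fderiv_gradient_inner hg.contDiff).2 (pt x y) (pt 0 u) (pt 0 v)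
  rw [hg.hessY_apply, hg.hessY_apply]
  simpa [WithLp.prod_inner_apply] using h

/-- The derivative of `∇_y g`. -/
lemma snd_fderiv_gradient (hg : LowerReg L Lg2 μ g) (x : Vec p) (y : Vec q)
    (w : WithLp 2 (Vec p × Vec q)) :
    (fderiv ℝ (gradient (joint g)) (pt x y) w).snd =
      ContinuousLinearMap.adjoint (jacXY g x y) w.fst + hessY g x y w.snd := by
  have hw : w = pt w.fst 0 + pt 0 w.snd := by rw [← WithLp.toLp_add]; simp; rfl
  conv_lhs => rw [hw]
  rw [map_add, WithLp.add_snd, hg.hessY_apply]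
  congr 1
  -- The block mapping `x`-increments to `y`-gradients is the adjoint of `jacXY` by symmetry of the
  -- full second derivative.
  refine ext_inner_right ℝ fun v => ?_
  rw [ContinuousLinearMap.adjoint_inner_left, hg.jacXY_apply]
  have h := (fderiv_gradient_inner hg.contDiff).2 (pt x y) (pt w.fst 0) (pt 0 v)
  simpa [WithLp.prod_inner_apply] using h

lemma le_inner_hessY (hg : LowerReg L Lg2 μ g) (x : Vec p) (y v : Vec q) :
    μ * ‖v‖ ^ 2 ≤ inner ℝ (hessY g x y v) v :=
  (hg.monotone_gradY x).le_inner_fderiv (hg.hasFDerivAt_hessY x y).differentiableAt.hasFDerivAt v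

lemma norm_fderiv_gradient_le (hg : LowerReg L Lg2 μ g) (hL : 0 ≤ L)
    (z : WithLp 2 (Vec p × Vec q)) : ‖fderiv ℝ (gradient (joint g)) z‖ ≤ L := by
  have : LipschitzWith ⟨L, hL⟩ (gradient (joint g)) := LipschitzWith.of_dist_le_mul fun x y => by
    rw [dist_eq_norm, dist_eq_norm]; exact hg.grad_lip x y
  exact norm_fderiv_le_of_lipschitz ℝ this

lemma norm_hessY_le (hg : LowerReg L Lg2 μ g) (hL : 0 ≤ L) (x : Vec p) (y : Vec q) :
    ‖hessY g x y‖ ≤ L := by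
  refine ContinuousLinearMap.opNorm_le_bound _ hL fun v => ?_
  rw [hg.hessY_apply, ← WithLp.norm_toLp_snd 2 (Vec p) (Vec q) v]
  exact (norm_snd_le _).trans (ContinuousLinearMap.le_of_opNorm_le _
    (hg.norm_fderiv_gradient_le hL _) _)

lemma norm_jacXY_le (hg : LowerReg L Lg2 μ g) (hL : 0 ≤ L) (x : Vec p) (y : Vec q) :
    ‖jacXY g x y‖ ≤ L := by
  refine ContinuousLinearMap.opNorm_le_bound _ hL fun v => ?_
  rw [hg.jacXY_apply, ← WithLp.norm_toLp_snd 2 (Vec p) (Vec q) v]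
  exact (norm_fst_le _).trans (ContinuousLinearMap.le_of_opNorm_le _
    (hg.norm_fderiv_gradient_le hL _) _)

lemma norm_hessY_sub_le (hg : LowerReg L Lg2 μ g) (h0 : 0 ≤ Lg2) (x x' : Vec p) (y y' : Vec q) :
    ‖hessY g x y - hessY g x' y'‖ ≤ Lg2 * ‖pt x y - pt x' y'‖ := by
  refine ContinuousLinearMap.opNorm_le_bound _ (by positivity) fun v => ?_
  rw [sub_apply, hg.hessY_apply, hg.hessY_apply,
    ← WithLp.norm_toLp_snd 2 (Vec p) (Vec q) v, ← WithLp.sub_snd, ← sub_apply]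
  exact (norm_snd_le _).trans (ContinuousLinearMap.le_of_opNorm_le _
    (hg.hess_lip _ _) _)

lemma norm_jacXY_sub_le (hg : LowerReg L Lg2 μ g) (h0 : 0 ≤ Lg2) (x x' : Vec p) (y y' : Vec q) :
    ‖jacXY g x y - jacXY g x' y'‖ ≤ Lg2 * ‖pt x y - pt x' y'‖ := by
  refine ContinuousLinearMap.opNorm_le_bound _ (by positivity) fun v => ?_
  rw [sub_apply, hg.jacXY_apply, hg.jacXY_apply,
    ← WithLp.norm_toLp_snd 2 (Vec p) (Vec q) v, ← WithLp.sub_fst, ← sub_apply]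
  exact (norm_fst_le _).trans (ContinuousLinearMap.le_of_opNorm_le _
    (hg.hess_lip _ _) _)

end LowerReg

/-! ### Coercive operators and the hypergradient -/

section Coercive

variable {μ : ℝ} {H H' : Vec q →L[ℝ] Vec q}

lemma isInvertible_of_coercive (hμ0 : 0 < μ) (hμ : ∀ v, μ * ‖v‖ ^ 2 ≤ inner ℝ (H v) v) :
    H.IsInvertible := by
  have hinj : Function.Injective (H : Vec q →ₗ[ℝ] Vec q) := by
    refine (injective_iff_map_eq_zero _).2 fun v hv => ?_
    have hv : H v = 0 := hv
    have h := hμ v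
    rw [hv, inner_zero_left] at h
    have : ‖v‖ ^ 2 = 0 := le_antisymm (by nlinarith) (sq_nonneg _)
    simpa using this
  refine ⟨(LinearEquiv.ofInjectiveEndo _ hinj).toContinuousLinearEquiv, ?_⟩
  ext1 v; rfl

lemma norm_inverse_apply_le (hμ0 : 0 < μ) (hμ : ∀ v, μ * ‖v‖ ^ 2 ≤ inner ℝ (H v) v) (b : Vec q) :
    ‖H.inverse b‖ ≤ ‖b‖ / μ := by
  have h1 := (isInvertible_of_coercive hμ0 hμ).self_apply_inverse b
  have h2 := hμ (H.inverse b)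
  rw [h1] at h2
  have h3 := real_inner_le_norm b (H.inverse b)
  rw [le_div_iff₀ hμ0]
  rcases (norm_nonneg (H.inverse b)).eq_or_lt with h | h
  · rw [← h, zero_mul]; exact norm_nonneg b
  · nlinarith

/-- Resolvent identity: the difference is `H⁻¹` applied to `(b - b') - (H - H') H'⁻¹ b'`, where
coercivity bounds `H⁻¹` by `1 / μ` and `H'⁻¹ b'` by `c / μ`. -/
lemma norm_inverse_apply_sub_le {c : ℝ} (hμ0 : 0 < μ) (hμ : ∀ v, μ * ‖v‖ ^ 2 ≤ inner ℝ (H v) v)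
    (hμ' : ∀ v, μ * ‖v‖ ^ 2 ≤ inner ℝ (H' v) v) (b b' : Vec q) (hb : ‖b'‖ ≤ c) :
    ‖H.inverse b - H'.inverse b'‖ ≤ (‖b - b'‖ + c / μ * ‖H - H'‖) / μ := by
  set w' := H'.inverse b' with hw
  have i1 := isInvertible_of_coercive hμ0 hμ
  have i2 := (isInvertible_of_coercive hμ0 hμ').self_apply_inverse b'
  have e : H.inverse b - w' = H.inverse ((b - b') - (H - H') w') := by
    have : b - b' - (H - H') w' = b - H w' := by
      rw [sub_apply, hw, i2]; abel
    rw [this, map_sub, i1.inverse_apply_self]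
  rw [e]
  refine (norm_inverse_apply_le hμ0 hμ _).trans ?_
  gcongr
  refine (norm_sub_le _ _).trans (add_le_add le_rfl ?_)
  have h3 : ‖w'‖ ≤ c / μ := (norm_inverse_apply_le hμ0 hμ' b').trans (by gcongr)
  rw [mul_comm]
  exact (H - H').le_opNorm_of_le h3

/-- The Lipschitz estimate behind the hypergradient `a - J H⁻¹ b`. -/
lemma norm_hyper_sub_le {L c : ℝ} (hμ0 : 0 < μ) (hμ : ∀ v, μ * ‖v‖ ^ 2 ≤ inner ℝ (H v) v)
    (hμ' : ∀ v, μ * ‖v‖ ^ 2 ≤ inner ℝ (H' v) v) {J J' : Vec q →L[ℝ] Vec p} (hJ : ‖J‖ ≤ L)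
    (a a' : Vec p) (b b' : Vec q) (hb : ‖b'‖ ≤ c) :
    ‖(a - J (H.inverse b)) - (a' - J' (H'.inverse b'))‖ ≤
      ‖a - a'‖ + L * ((‖b - b'‖ + c / μ * ‖H - H'‖) / μ) + c / μ * ‖J - J'‖ := by
  have e : (a - J (H.inverse b)) - (a' - J' (H'.inverse b')) =
      (a - a') - J (H.inverse b - H'.inverse b') - (J - J') (H'.inverse b') := by
    rw [map_sub, sub_apply]; abel
  rw [e]
  refine (norm_sub_le _ _).trans (add_le_add ((norm_sub_le _ _).trans (add_le_add le_rfl ?_)) ?_)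
  · exact (J.le_opNorm_of_le (norm_inverse_apply_sub_le hμ0 hμ hμ' b b' hb)).trans
      (mul_le_mul_of_nonneg_right hJ ((norm_nonneg _).trans
        (norm_inverse_apply_sub_le hμ0 hμ hμ' b b' hb)))
  · rw [mul_comm]
    exact (J - J').le_opNorm_of_le ((norm_inverse_apply_le hμ0 hμ' b').trans (by gcongr))

end Coercive

end Partial

end DBOGT

namespace DBOGT

/-! ### Averages -/

section Averages

variable {n : ℕ} {E F : Type*} [NormedAddCommGroup E] [NormedSpace ℝ E] [NormedAddCommGroup F]
  [NormedSpace ℝ F]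

lemma norm_avg_le (hn : 0 < n) {z : Fin n → E} {c : ℝ} (h : ∀ i, ‖z i‖ ≤ c) : ‖avg z‖ ≤ c := by
  have hn' : (0 : ℝ) < n := by exact_mod_cast hn
  rw [avg, norm_smul, Real.norm_of_nonneg (by positivity), one_div, inv_mul_le_iff₀ hn']
  refine (norm_sum_le _ _).trans ((Finset.sum_le_sum fun i _ => h i).trans ?_)
  simp

lemma avg_apply (T : Fin n → E →L[ℝ] F) (v : E) : avg T v = avg fun i => T i v := by
  simp [avg]

lemma avg_sub_avg (z w : Fin n → E) : avg z - avg w = avg (z - w) := by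
  simp [avg, Finset.sum_sub_distrib, smul_sub]

lemma avg_eq_self (hn : 0 < n) (c : E) : avg (fun _ : Fin n => c) = c := by
  have : (n : ℝ) ≠ 0 := by positivity
  simp [avg, ← Nat.cast_smul_eq_nsmul ℝ, smul_smul, this]

lemma sum_le_sqrt_mul_sqrt (r : Fin n → ℝ) : ∑ i, r i ≤ √n * √(∑ i, r i ^ 2) := by
  rw [← Real.sqrt_mul (by positivity)]
  refine Real.le_sqrt_of_sq_le ?_
  simpa using sq_sum_le_card_mul_sum_sq (s := Finset.univ) (f := r)

/-- Cauchy-Schwarz over the agents. The factor `√n` on the left keeps the constants below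
independent of the number of agents. -/
lemma sqrt_mul_norm_avg_le_of_forall_le (hn : 0 < n) {z : Fin n → E} {c : ℝ} (hc : 0 ≤ c)
    {r : Fin n → ℝ} (h : ∀ i, ‖z i‖ ≤ c * r i) : √n * ‖avg z‖ ≤ c * √(∑ i, r i ^ 2) := by
  have hn' : (0 : ℝ) < n := by exact_mod_cast hn
  have hs : 0 < √(n : ℝ) := Real.sqrt_pos.2 hn'
  have h1 : (n : ℝ) * ‖avg z‖ ≤ c * (√n * √(∑ i, r i ^ 2)) := by
    rw [avg, norm_smul, Real.norm_of_nonneg (by positivity), ← mul_assoc, mul_one_div_cancel hn'.ne',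
      one_mul]
    refine (norm_sum_le _ _).trans ((Finset.sum_le_sum fun i _ => h i).trans ?_)
    rw [← Finset.mul_sum]
    exact mul_le_mul_of_nonneg_left (sum_le_sqrt_mul_sqrt r) hc
  refine le_of_mul_le_mul_left ?_ hs
  rw [← mul_assoc, Real.mul_self_sqrt hn'.le]
  linarith

lemma avg_inner {E : Type*} [NormedAddCommGroup E] [InnerProductSpace ℝ E] (z : Fin n → E) (w : E) :
    inner ℝ (avg z) w = avg fun i => inner ℝ (z i) w := by
  simp [avg, real_inner_smul_left, sum_inner]

lemma le_avg (hn : 0 < n) {z : Fin n → ℝ} {c : ℝ} (h : ∀ i, c ≤ z i) : c ≤ avg z := by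
  have hn' : (0 : ℝ) < n := by exact_mod_cast hn
  rw [avg, smul_eq_mul, one_div, le_inv_mul_iff₀ hn']
  refine le_trans ?_ (Finset.sum_le_sum fun i _ => h i)
  simp

lemma stronglyMonotone_avg {E : Type*} [NormedAddCommGroup E] [InnerProductSpace ℝ E] (hn : 0 < n)
    {μ : ℝ} {G : Fin n → E → E} (h : ∀ i, StronglyMonotone μ (G i)) :
    StronglyMonotone μ fun y => avg fun i => G i y := fun x y => by
  rw [avg_sub_avg, avg_inner]
  exact le_avg hn fun i => h i x y

lemma lip_avg {E : Type*} [NormedAddCommGroup E] (hn : 0 < n) {L : ℝ} {G : Fin n → E → F} (h : ∀ i, Lip L (G i)) :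
    Lip L fun y => avg fun i => G i y := fun x y => by
  rw [avg_sub_avg]
  exact norm_avg_le hn fun i => h i x y

end Averages

/-! ### The lower level solution -/

section LowerLevel

variable {n p q : ℕ} {L Lf0 Lg2 μ : ℝ} {f g : Fin n → Vec p → Vec q → ℝ}

/-- The minimizer of `y ↦ (1/n) ∑ j, g_j (x_j, y)`. -/
noncomputable def lowerSol (g : Fin n → Vec p → Vec q → ℝ) (x : Fin n → Vec p) : Vec q :=
  argmin fun y => (1 / (n : ℝ)) * ∑ j, g j (x j) y

lemma hasGradientAt_avg_lower (hg : ∀ i, LowerReg L Lg2 μ (g i)) (x : Fin n → Vec p) (y : Vec q) :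
    HasGradientAt (fun y => (1 / (n : ℝ)) * ∑ j, g j (x j) y)
      (avg fun j => gradY (g j) (x j) y) y := by
  rw [hasGradientAt_iff_hasFDerivAt]
  have h := (HasFDerivAt.fun_sum (u := Finset.univ) fun j _ =>
    ((hg j).differentiable_right (x j) y).hasGradientAt.hasFDerivAt).const_mul (1 / (n : ℝ))
  have e : InnerProductSpace.toDual ℝ (Vec q) (avg fun j => gradY (g j) (x j) y) =
      (1 / (n : ℝ)) • ∑ j, InnerProductSpace.toDual ℝ (Vec q) (gradient (g j (x j)) y) := by
    ext1 v
    rw [InnerProductSpace.toDual_apply_apply, avg_inner, avg, smul_apply, sum_apply]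
    rfl
  rw [e]
  exact h

/-- The average inherits strong monotonicity, the Lipschitz bound and convexity from the summands.
The agents may sit at different points `x j`, as they do in the inner loop. -/
lemma avg_gradY_lowerSol (hn : 0 < n) (hμ0 : 0 < μ) (hμL : μ ≤ L)
    (hg : ∀ i, LowerReg L Lg2 μ (g i)) (x : Fin n → Vec p) :
    avg (fun j => gradY (g j) (x j) (lowerSol g x)) = 0 := by
  set φ : Vec q → ℝ := fun y => (1 / (n : ℝ)) * ∑ j, g j (x j) y with hφ
  have hgrad : gradient φ = fun y => avg fun j => gradY (g j) (x j) y :=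
    funext fun y => (hasGradientAt_avg_lower hg x y).gradient
  have h0 := gradient_argmin (φ := φ) hμ0 hμL
    (fun y y' => ?_) (by rw [hgrad]; exact stronglyMonotone_avg hn fun i => (hg i).monotone_gradY _)
    (by rw [hgrad]; exact lip_avg hn fun i => (hg i).lip_gradY _)
  · rw [hgrad] at h0; exact h0
  · rw [hgrad]
    rw [avg_inner]
    simp only [avg, smul_eq_mul, hφ]
    rw [← mul_add, ← Finset.sum_add_distrib]
    refine mul_le_mul_of_nonneg_left (Finset.sum_le_sum fun j _ => ?_) (by positivity)
    have h := add_inner_gradient_add_le ((hg j).differentiable_right (x j)) ((hg j).strong (x j)) y y'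
    have := mul_nonneg hμ0.le (sq_nonneg ‖y' - y‖)
    rw [gradY]
    linarith

/-- Strong monotonicity at `x'` between the two solutions: replacing one vanishing averaged gradient
by the other leaves only the change of the gradients with `x` at the fixed point `y`. -/
lemma norm_lowerSol_sub_le (hn : 0 < n) (hμ0 : 0 < μ) (hμL : μ ≤ L)
    (hg : ∀ i, LowerReg L Lg2 μ (g i)) (x x' : Fin n → Vec p) :
    √n * ‖lowerSol g x - lowerSol g x'‖ ≤ L / μ * l2 (x - x') := by
  have hL : 0 < L := hμ0.trans_le hμL
  set y := lowerSol g x with hy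
  set y' := lowerSol g x' with hy'
  have h1 := stronglyMonotone_avg hn (fun i => (hg i).monotone_gradY (x' i)) y y'
  have e1 : avg (fun j => gradY (g j) (x j) y) = 0 := avg_gradY_lowerSol hn hμ0 hμL hg x
  have e2 : avg (fun j => gradY (g j) (x' j) y') = 0 := avg_gradY_lowerSol hn hμ0 hμL hg x'
  simp only at h1
  rw [e2, ← e1, avg_sub_avg] at h1
  set z : Fin n → Vec q := (fun i => gradY (g i) (x' i) y) - fun j => gradY (g j) (x j) y with hz
  have h2 : √n * ‖avg z‖ ≤ L * l2 (x - x') := by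
    refine (sqrt_mul_norm_avg_le hn z).trans ?_
    refine l2_le_of_forall_le hL.le fun i => ?_
    rw [Pi.sub_apply, norm_sub_rev (x i), ← norm_pt_sub_left _ _ y]
    exact norm_gradY_sub_le (hg i).diff (hg i).grad_lip _ _ _ _
  have h3 := h1.trans (real_inner_le_norm _ _)
  have h4 : μ * ‖y - y'‖ ≤ ‖avg z‖ := by
    rcases (norm_nonneg (y - y')).eq_or_lt with h | h
    · rw [← h, mul_zero]; exact norm_nonneg _
    · refine le_of_mul_le_mul_right ?_ h
      linarith
  rw [div_mul_eq_mul_div, le_div_iff₀ hμ0]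
  nlinarith [mul_le_mul_of_nonneg_left h4 (Real.sqrt_nonneg (n : ℝ))]

/-! ### The hypergradient -/

/-- The local hypergradient surrogates at the points `(x_i, y_i)`, with the averaged Jacobian and
Hessian. -/
noncomputable def hyper (f g : Fin n → Vec p → Vec q → ℝ) (x : Fin n → Vec p) (y : Fin n → Vec q) :
    Fin n → Vec p := fun i =>
  gradX (f i) (x i) (y i) - (avg fun j => jacXY (g j) (x j) (y j))
    ((avg fun j => hessY (g j) (x j) (y j)).inverse (gradY (f i) (x i) (y i)))

lemma le_inner_avg_hessY (hn : 0 < n) (hg : ∀ i, LowerReg L Lg2 μ (g i)) (x : Fin n → Vec p)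
    (y : Fin n → Vec q) (v : Vec q) :
    μ * ‖v‖ ^ 2 ≤ inner ℝ ((avg fun j => hessY (g j) (x j) (y j)) v) v := by
  rw [avg_apply, avg_inner]
  exact le_avg hn fun i => (hg i).le_inner_hessY _ _ _

lemma avg_hessY_symm (hg : ∀ i, LowerReg L Lg2 μ (g i)) (x : Fin n → Vec p)
    (y : Fin n → Vec q) (u v : Vec q) :
    inner ℝ ((avg fun j => hessY (g j) (x j) (y j)) u) v =
      inner ℝ u ((avg fun j => hessY (g j) (x j) (y j)) v) := by
  rw [avg_apply, avg_inner, avg_apply, real_inner_comm, avg_inner]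
  congr 1
  ext1 i
  rw [(hg i).hessY_symm, real_inner_comm]

lemma norm_hyper_le (hn : 0 < n) (hμ0 : 0 < μ) (hμL : μ ≤ L) (h0 : 0 ≤ Lf0)
    (hf : ∀ i, UpperReg L Lf0 (f i)) (hg : ∀ i, LowerReg L Lg2 μ (g i)) (x : Fin n → Vec p)
    (y : Fin n → Vec q) (i : Fin n) : ‖hyper f g x y i‖ ≤ (1 + L / μ) * Lf0 := by
  have hL : 0 ≤ L := hμ0.le.trans hμL
  refine (norm_sub_le _ _).trans ?_
  have h1 := (hf i).norm_gradX_le h0 (x i) (y i)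
  have h2 := norm_inverse_apply_le hμ0 (le_inner_avg_hessY hn hg x y) (gradY (f i) (x i) (y i))
  have h3 : ‖avg fun j => jacXY (g j) (x j) (y j)‖ ≤ L :=
    norm_avg_le hn fun j => (hg j).norm_jacXY_le hL _ _
  have h4 := ContinuousLinearMap.le_of_opNorm_le_of_le _ h3
    (h2.trans (div_le_div_of_nonneg_right ((hf i).norm_gradY_le h0 (x i) (y i)) hμ0.le))
  calc _ ≤ Lf0 + L * (Lf0 / μ) := add_le_add h1 h4
    _ = _ := by ring

/-- The change at agent `i` has a local part `a * r i` and a part shared by all agents, coming from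
the averaged Jacobian and Hessian, of size `b * R / √n`. In the sum of squares the cross term is
handled by `∑ r i ≤ √n R`, which completes the square `((a + b) R)²`; `a + b` is `Lf`. -/
lemma l2_hyper_sub_le (hn : 0 < n) (hμ0 : 0 < μ) (hμL : μ ≤ L) (h0 : 0 ≤ Lf0) (h2 : 0 ≤ Lg2)
    (hf : ∀ i, UpperReg L Lf0 (f i)) (hg : ∀ i, LowerReg L Lg2 μ (g i))
    (x x' : Fin n → Vec p) (y y' : Fin n → Vec q) :
    l2 (hyper f g x y - hyper f g x' y') ≤
      Lf L Lf0 Lg2 μ * √(l2 (x - x') ^ 2 + l2 (y - y') ^ 2) := by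
  have hL : 0 < L := hμ0.trans_le hμL
  have hn' : (0 : ℝ) < n := by exact_mod_cast hn
  have hs : 0 < √(n : ℝ) := Real.sqrt_pos.2 hn'
  set r : Fin n → ℝ := fun i => ‖pt (x i) (y i) - pt (x' i) (y' i)‖ with hr
  have hR : l2 (x - x') ^ 2 + l2 (y - y') ^ 2 = ∑ i, r i ^ 2 := by
    rw [l2_sq, l2_sq, ← Finset.sum_add_distrib]
    exact Finset.sum_congr rfl fun i _ => (norm_pt_sub_sq _ _ _ _).symm
  rw [hR]
  set R := √(∑ i, r i ^ 2) with hRdef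
  have hR0 : 0 ≤ R := Real.sqrt_nonneg _
  have hR2 : ∑ i, r i ^ 2 = R ^ 2 := (Real.sq_sqrt (Finset.sum_nonneg fun i _ => sq_nonneg _)).symm
  have hH : ‖(avg fun j => hessY (g j) (x j) (y j)) - avg fun j => hessY (g j) (x' j) (y' j)‖ ≤
      Lg2 * R / √n := by
    rw [avg_sub_avg, le_div_iff₀' hs]
    exact sqrt_mul_norm_avg_le_of_forall_le hn h2 fun j => (hg j).norm_hessY_sub_le h2 _ _ _ _
  have hJ : ‖(avg fun j => jacXY (g j) (x j) (y j)) - avg fun j => jacXY (g j) (x' j) (y' j)‖ ≤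
      Lg2 * R / √n := by
    rw [avg_sub_avg, le_div_iff₀' hs]
    exact sqrt_mul_norm_avg_le_of_forall_le hn h2 fun j => (hg j).norm_jacXY_sub_le h2 _ _ _ _
  set a := L + L ^ 2 / μ with ha
  set b := Lf0 * (Lg2 / μ + Lg2 * L / μ ^ 2) with hb
  have ha0 : 0 ≤ a := by positivity
  have hb0 : 0 ≤ b := by positivity
  have hpt : ∀ i, ‖(hyper f g x y - hyper f g x' y') i‖ ≤ a * r i + b * (R / √n) := fun i => by
    refine (norm_hyper_sub_le hμ0 (le_inner_avg_hessY hn hg x y) (le_inner_avg_hessY hn hg x' y')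
      (norm_avg_le hn fun j => (hg j).norm_jacXY_le hL.le _ _) _ _ _ _
      ((hf i).norm_gradY_le h0 (x' i) (y' i))).trans ?_
    have k1 := norm_gradX_sub_le (hf i).diff (hf i).grad_lip (x i) (x' i) (y i) (y' i)
    have k2 := norm_gradY_sub_le (hf i).diff (hf i).grad_lip (x i) (x' i) (y i) (y' i)
    calc _ ≤ L * r i + L * ((L * r i + Lf0 / μ * (Lg2 * R / √n)) / μ) +
          Lf0 / μ * (Lg2 * R / √n) := by gcongr
      _ = _ := by rw [ha, hb]; ring
  have hLf : Lf L Lf0 Lg2 μ = a + b := rfl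
  rw [hLf]
  refine le_of_sq_le_sq ?_ (by positivity)
  rw [l2_sq]
  calc _ ≤ ∑ i, (a * r i + b * (R / √n)) ^ 2 :=
        Finset.sum_le_sum fun i _ => pow_le_pow_left₀ (norm_nonneg _) (hpt i) 2
    _ = a ^ 2 * ∑ i, r i ^ 2 + 2 * a * b * (R / √n) * ∑ i, r i + b ^ 2 * R ^ 2 := by
        simp_rw [add_sq, Finset.sum_add_distrib, mul_pow, div_pow, Real.sq_sqrt hn'.le,
          Finset.mul_sum]
        congr 1
        · congr 1
          exact Finset.sum_congr rfl fun i _ => by ring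
        · simp; field_simp
    _ ≤ a ^ 2 * R ^ 2 + 2 * a * b * (R / √n) * (√n * R) + b ^ 2 * R ^ 2 := by
        rw [hR2]
        gcongr
        exact sum_le_sqrt_mul_sqrt r
    _ = ((a + b) * R) ^ 2 := by field_simp; ring

/-- The local surrogates at the lower level solution. -/
noncomputable def exactHyper (f g : Fin n → Vec p → Vec q → ℝ) (x : Fin n → Vec p) :
    Fin n → Vec p := hyper f g x fun _ => lowerSol g x

lemma Lf_pos (hμ0 : 0 < μ) (hμL : μ ≤ L) (h0 : 0 ≤ Lf0) (h2 : 0 ≤ Lg2) : 0 < Lf L Lf0 Lg2 μ := by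
  have hL : 0 < L := hμ0.trans_le hμL
  rw [Lf]; positivity

/-- The lower level solution moves by at most `κ` times the movement of `x`, so the pair moves by
the factor `√(1 + κ²)`. -/
lemma l2_exactHyper_sub_le (hn : 0 < n) (hμ0 : 0 < μ) (hμL : μ ≤ L) (h0 : 0 ≤ Lf0) (h2 : 0 ≤ Lg2)
    (hf : ∀ i, UpperReg L Lf0 (f i)) (hg : ∀ i, LowerReg L Lg2 μ (g i)) (x x' : Fin n → Vec p) :
    l2 (exactHyper f g x - exactHyper f g x') ≤
      √(1 + (L / μ) ^ 2) * Lf L Lf0 Lg2 μ * l2 (x - x') := by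
  refine (l2_hyper_sub_le hn hμ0 hμL h0 h2 hf hg x x' _ _).trans ?_
  have h3 := norm_lowerSol_sub_le hn hμ0 hμL hg x x'
  rw [← l2_const] at h3
  have h4 := pow_le_pow_left₀ (l2_nonneg _) h3 2
  rw [mul_comm (√(1 + (L / μ) ^ 2)), mul_assoc]
  refine mul_le_mul_of_nonneg_left ?_ (Lf_pos hμ0 hμL h0 h2).le
  rw [← Real.sqrt_sq (l2_nonneg (x - x')), ← Real.sqrt_mul (by positivity)]
  refine Real.sqrt_le_sqrt ?_
  rw [Real.sqrt_sq (l2_nonneg (x - x'))]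
  have e : ((fun _ => lowerSol g x) - fun _ => lowerSol g x' : Fin n → Vec q) =
    fun _ => lowerSol g x - lowerSol g x' := rfl
  rw [e]
  linarith

/-! ### The gradient of `Φ` -/

lemma norm_yStar_sub_le (hn : 0 < n) (hμ0 : 0 < μ) (hμL : μ ≤ L)
    (hg : ∀ i, LowerReg L Lg2 μ (g i)) (x x' : Vec p) :
    ‖yStar g x - yStar g x'‖ ≤ L / μ * ‖x - x'‖ := by
  have hn' : (0 : ℝ) < n := by exact_mod_cast hn
  have hs : 0 < √(n : ℝ) := Real.sqrt_pos.2 hn'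
  have h := norm_lowerSol_sub_le hn hμ0 hμL hg (fun _ => x) (fun _ => x')
  have e : ((fun _ => x) - fun _ => x' : Fin n → Vec p) = fun _ => x - x' := rfl
  rw [e, l2_const] at h
  refine le_of_mul_le_mul_left ?_ hs
  calc _ ≤ _ := h
    _ = _ := by ring

/-- The implicit function argument, shortened by the Lipschitz bound for `yStar` that is already
known: the averaged `∇_y g` vanishes along the curve `z`, so its linearization at `z x` applied to
`z x' - z x` is `o(‖x' - x‖)`, and applying the inverse Hessian isolates the increment of `yStar`.
-/
lemma hasFDerivAt_yStar (hn : 0 < n) (hμ0 : 0 < μ) (hμL : μ ≤ L)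
    (hg : ∀ i, LowerReg L Lg2 μ (g i)) (x : Vec p) :
    HasFDerivAt (yStar g) (-((avg fun j => hessY (g j) x (yStar g x)).inverse.comp
      (ContinuousLinearMap.adjoint (avg fun j => jacXY (g j) x (yStar g x))))) x := by
  set H := avg fun j => hessY (g j) x (yStar g x) with hH
  set J := avg fun j => jacXY (g j) x (yStar g x) with hJ
  have hL : 0 < L := hμ0.trans_le hμL
  have hinv := isInvertible_of_coercive hμ0 (le_inner_avg_hessY hn hg (fun _ => x) fun _ => yStar g x)
  set z : Vec p → WithLp 2 (Vec p × Vec q) := fun x' => pt x' (yStar g x') with hz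
  have hzl : ∀ x', ‖z x' - z x‖ ≤ (1 + L / μ) * ‖x' - x‖ := fun x' => by
    refine le_of_sq_le_sq ?_ (by positivity)
    rw [hz, norm_pt_sub_sq]
    have h1 := pow_le_pow_left₀ (norm_nonneg _) (norm_yStar_sub_le hn hμ0 hμL hg x' x) 2
    have h3 : 0 ≤ L / μ * ‖x' - x‖ ^ 2 := by positivity
    nlinarith
  set B : WithLp 2 (Vec p × Vec q) →L[ℝ] Vec q := avg fun j =>
    (WithLp.sndL 2 ℝ (Vec p) (Vec q)).comp (fderiv ℝ (gradient (joint (g j))) (z x)) with hB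
  have hBapp : ∀ w, B w = ContinuousLinearMap.adjoint J w.fst + H w.snd := fun w => by
    have h1 : ∀ j, (WithLp.sndL 2 ℝ (Vec p) (Vec q)).comp
        (fderiv ℝ (gradient (joint (g j))) (z x)) w =
        ContinuousLinearMap.adjoint (jacXY (g j) x (yStar g x)) w.fst +
          hessY (g j) x (yStar g x) w.snd := fun j =>
      (hg j).snd_fderiv_gradient x (yStar g x) w
    rw [hB, avg_apply]
    simp_rw [h1]
    rw [show (fun i => ContinuousLinearMap.adjoint (jacXY (g i) x (yStar g x)) w.fst +
      hessY (g i) x (yStar g x) w.snd) =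
      (fun i => ContinuousLinearMap.adjoint (jacXY (g i) x (yStar g x)) w.fst) +
      fun i => hessY (g i) x (yStar g x) w.snd from rfl, avg_add, hH, avg_apply]
    congr 1
    simp [hJ, avg, map_sum]
  have hΓ : HasFDerivAt (fun z : WithLp 2 (Vec p × Vec q) => avg fun j => gradY (g j) z.fst z.snd)
      B (z x) := by
    have h := (HasFDerivAt.fun_sum (u := Finset.univ) fun j _ =>
      (hg j).hasFDerivAt_gradY (z x)).const_smul (1 / (n : ℝ))
    exact h
  have hcont : Filter.Tendsto z (nhds x) (nhds (z x)) := by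
    rw [tendsto_iff_norm_sub_tendsto_zero]
    refine squeeze_zero (fun _ => norm_nonneg _) hzl ?_
    have h1 : Filter.Tendsto (fun x' => (1 + L / μ) * ‖x' - x‖) (nhds x)
        (nhds ((1 + L / μ) * ‖x - x‖)) := Continuous.tendsto (by fun_prop) x
    simpa using h1
  have h0 : ∀ x', (avg fun j => gradY (g j) (z x').fst (z x').snd) = 0 := fun x' =>
    avg_gradY_lowerSol hn hμ0 hμL hg fun _ => x'
  have ho := (hasFDerivAt_iff_isLittleO.1 hΓ).comp_tendsto hcont
  simp only [Function.comp_def, h0, sub_zero, zero_sub] at ho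
  have hO : (fun x' => z x' - z x) =O[nhds x] fun x' => x' - x :=
    Asymptotics.IsBigO.of_bound _ (Filter.Eventually.of_forall hzl)
  have ho2 := (ho.trans_isBigO hO).neg_left
  simp only [neg_neg] at ho2
  rw [hasFDerivAt_iff_isLittleO]
  refine ((H.inverse.isBigO_comp _ _).trans_isLittleO ho2).congr_left fun x' => ?_
  rw [hBapp, map_add, hinv.inverse_apply_self]
  simp only [hz, WithLp.sub_fst, WithLp.sub_snd, WithLp.toLp_fst, WithLp.toLp_snd,
    ContinuousLinearMap.comp_apply, neg_apply, sub_neg_eq_add]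
  abel

/-- Chain rule along `x ↦ (x, yStar x)`. Self-adjointness of the averaged Hessian, hence of its
inverse, moves the derivative of `yStar` to the other side of the inner product, where it becomes `J
H⁻¹ ∇_y f`. -/
theorem hasGradientAt_Phi (hn : 0 < n) (hμ0 : 0 < μ) (hμL : μ ≤ L)
    (hf : ∀ i, UpperReg L Lf0 (f i)) (hg : ∀ i, LowerReg L Lg2 μ (g i)) (x : Vec p) :
    HasGradientAt (Phi f g) (avg (exactHyper f g fun _ => x)) x := by
  set H := avg fun j => hessY (g j) x (yStar g x) with hH
  set J := avg fun j => jacXY (g j) x (yStar g x) with hJ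
  have hinv := isInvertible_of_coercive hμ0 (le_inner_avg_hessY hn hg (fun _ => x) fun _ => yStar g x)
  have hsym : ∀ u v, inner ℝ (H u) v = inner ℝ u (H v) :=
    avg_hessY_symm hg (fun _ => x) fun _ => yStar g x
  have hisym : ∀ u v, inner ℝ u (H.inverse v) = inner ℝ (H.inverse u) v := fun u v => by
    conv_lhs => rw [← hinv.self_apply_inverse u]
    change inner ℝ (H (H.inverse u)) (H.inverse v) = _
    rw [hsym]
    congr 1
    exact hinv.self_apply_inverse v
  have hz : HasFDerivAt (fun x' => pt x' (yStar g x')) (inlL p q + (inrL p q).comp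
      (-(H.inverse.comp (ContinuousLinearMap.adjoint J)))) x := by
    have h1 : (fun x' => pt x' (yStar g x')) = fun x' => inlL p q x' + inrL p q (yStar g x') := by
      ext1 x'
      rw [inlL_apply, inrL_apply, ← WithLp.toLp_add]; simp
    rw [h1]
    exact (inlL p q).hasFDerivAt.add
      ((inrL p q).hasFDerivAt.comp x (hasFDerivAt_yStar hn hμ0 hμL hg x))
  rw [hasGradientAt_iff_hasFDerivAt]
  have h := (HasFDerivAt.fun_sum (u := Finset.univ) fun j _ =>
    ((hf j).diff (pt x (yStar g x))).hasGradientAt.hasFDerivAt.comp x hz).const_mul (1 / (n : ℝ))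
  have e : InnerProductSpace.toDual ℝ (Vec p) (avg (exactHyper f g fun _ => x)) =
      (1 / (n : ℝ)) • ∑ j, (InnerProductSpace.toDual ℝ _
        (gradient (joint (f j)) (pt x (yStar g x)))).comp (inlL p q + (inrL p q).comp
      (-(H.inverse.comp (ContinuousLinearMap.adjoint J)))) := by
    ext1 v
    rw [InnerProductSpace.toDual_apply_apply, avg_inner, avg, smul_apply, sum_apply]
    congr 1
    refine Finset.sum_congr rfl fun j _ => ?_
    rw [ContinuousLinearMap.comp_apply, InnerProductSpace.toDual_apply_apply,
      add_apply, inner_add_right, ContinuousLinearMap.comp_apply, inlL_apply,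
      inrL_apply, WithLp.prod_inner_apply, WithLp.prod_inner_apply]
    have e1 : exactHyper f g (fun _ => x) j = gradX (f j) x (yStar g x) -
      J (H.inverse (gradY (f j) x (yStar g x))) := rfl
    rw [e1, gradX_eq (hf j).diff, gradY_eq (hf j).diff, inner_sub_left]
    simp only [inner_zero_right, zero_add, add_zero, neg_apply, inner_neg_right,
      ContinuousLinearMap.comp_apply]
    rw [sub_eq_add_neg]
    congr 2
    change _ = inner ℝ (gradient (joint (f j)) (pt x (yStar g x))).snd
      (H.inverse (ContinuousLinearMap.adjoint J v))
    rw [hisym, ContinuousLinearMap.adjoint_inner_right]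
  rw [e]
  exact h

end LowerLevel

end DBOGT

namespace DBOGT

/-! ### The outer loop -/

section Outer

open Finset

/-- Young's inequality with weights `ρ` and `1 - ρ`, multiplied by `1 - ρ` to avoid division; the
defect is an explicit square. -/
lemma sq_add_le {ρ : ℝ} (h0 : 0 ≤ ρ) (a b : ℝ) :
    (1 - ρ) * (ρ * a + b) ^ 2 ≤ (1 - ρ) * ρ * a ^ 2 + b ^ 2 := by
  have h : (1 - ρ) * ρ * a ^ 2 + b ^ 2 - (1 - ρ) * (ρ * a + b) ^ 2 =
      ρ * ((1 - ρ) * a - b) ^ 2 := by ring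
  have := mul_nonneg h0 (sq_nonneg ((1 - ρ) * a - b))
  linarith

/-- Summing up a perturbed linear contraction. -/
lemma sum_sq_le_of_contraction {ρ : ℝ} (h0 : 0 ≤ ρ) (h1 : ρ < 1) {a b : ℕ → ℝ} (ha : ∀ k, 0 ≤ a k)
    (h : ∀ k, a (k + 1) ≤ ρ * a k + b k) (K : ℕ) :
    (1 - ρ) ^ 2 * ∑ k ∈ range (K + 1), a k ^ 2 ≤
      (1 - ρ) * a 0 ^ 2 + ∑ k ∈ range K, b k ^ 2 := by
  have h2 : ∀ k, (1 - ρ) * a (k + 1) ^ 2 ≤ (1 - ρ) * ρ * a k ^ 2 + b k ^ 2 := fun k =>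
    (mul_le_mul_of_nonneg_left (pow_le_pow_left₀ (ha _) (h k) 2) (by linarith)).trans
      (sq_add_le h0 _ _)
  have h3 := Finset.sum_le_sum fun k (_ : k ∈ range K) => h2 k
  rw [Finset.sum_add_distrib, ← Finset.mul_sum, ← Finset.mul_sum] at h3
  have h4 : ∑ k ∈ range K, a k ^ 2 ≤ ∑ k ∈ range (K + 1), a k ^ 2 :=
    Finset.sum_le_sum_of_subset_of_nonneg (range_mono (by omega)) fun _ _ _ => sq_nonneg _
  have h5 := Finset.sum_range_succ' (fun k => a k ^ 2) K
  have h6 := mul_le_mul_of_nonneg_left h4 (mul_nonneg (sub_nonneg.2 h1.le) h0)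
  rw [h5] at h6 ⊢
  nlinarith

/-- The coupled recursion of consensus error `s`, tracking error `t`, displacement `D` and
variation `G` of the tracked quantity, driven by the inexactness `ε` and the mean step `m`. -/
lemma coupled_sum_le {n : ℕ} (hn : 0 < n) {ρ η Λ : ℝ} (h0 : 0 ≤ ρ) (h1 : ρ < 1)
    (hθ : 32 * n * (η * Λ) ^ 2 ≤ (1 - ρ) ^ 4) {s t D G ε m : ℕ → ℝ} (hs : ∀ k, 0 ≤ s k)
    (ht : ∀ k, 0 ≤ t k) (hs0 : s 0 = 0) (hs1 : ∀ k, s (k + 1) ≤ ρ * s k + η * t k)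
    (ht1 : ∀ k, t (k + 1) ≤ ρ * t k + G k)
    (hD : ∀ k, D k ^ 2 ≤ 8 * s k ^ 2 + 2 * η ^ 2 * t k ^ 2 + n * η ^ 2 * m k ^ 2)
    (hG : ∀ k, G k ^ 2 ≤ 2 * Λ ^ 2 * D k ^ 2 + 4 * ε k ^ 2 + 4 * ε (k + 1) ^ 2) (K : ℕ) :
    n * (Λ ^ 2 * ∑ k ∈ range (K + 1), s k ^ 2) ≤ t 0 ^ 2 / 12 +
        2 / 3 * ∑ k ∈ range (K + 1), ε k ^ 2 + (∑ k ∈ range (K + 1), m k ^ 2) / 192 ∧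
      n * (Λ ^ 2 * ∑ k ∈ range K, D k ^ 2) ≤ t 0 ^ 2 + 7 * ∑ k ∈ range (K + 1), ε k ^ 2 +
        n * (∑ k ∈ range (K + 1), m k ^ 2) / 12 := by
  have hn1 : (1 : ℝ) ≤ n := by exact_mod_cast hn
  have hq0 : 0 < 1 - ρ := by linarith
  have hq2 : (1 - ρ) ^ 2 ≤ 1 := pow_le_one₀ hq0.le (by linarith)
  have hmono : ∀ a : ℕ → ℝ, ∑ k ∈ range K, a k ^ 2 ≤ ∑ k ∈ range (K + 1), a k ^ 2 := fun a =>
    Finset.sum_le_sum_of_subset_of_nonneg (range_mono (by omega)) fun _ _ _ => sq_nonneg _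
  have hnn : ∀ (a : ℕ → ℝ) (J : ℕ), 0 ≤ ∑ k ∈ range J, a k ^ 2 := fun a J =>
    Finset.sum_nonneg fun _ _ => sq_nonneg _
  have S1 := sum_sq_le_of_contraction h0 h1 hs hs1 K
  have T1 := sum_sq_le_of_contraction h0 h1 ht ht1 K
  simp_rw [mul_pow, ← Finset.mul_sum] at S1
  rw [hs0] at S1
  have D1 := Finset.sum_le_sum fun k (_ : k ∈ range K) => hD k
  rw [Finset.sum_add_distrib, Finset.sum_add_distrib, ← Finset.mul_sum, ← Finset.mul_sum,
    ← Finset.mul_sum] at D1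
  have G1 := Finset.sum_le_sum fun k (_ : k ∈ range K) => hG k
  rw [Finset.sum_add_distrib, Finset.sum_add_distrib, ← Finset.mul_sum, ← Finset.mul_sum,
    ← Finset.mul_sum] at G1
  have E1 : ∑ k ∈ range K, ε (k + 1) ^ 2 ≤ ∑ k ∈ range (K + 1), ε k ^ 2 := by
    rw [Finset.sum_range_succ' (fun k => ε k ^ 2) K]
    linarith [sq_nonneg (ε 0)]
  have hm := hmono m
  have hε := hmono ε
  have ht' := hmono t
  have hs' := hmono s
  have pD := hnn D K
  have pG := hnn G K
  have pm := hnn m (K + 1)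
  have pm' := hnn m K
  have ps := hnn s (K + 1)
  have pt := hnn t (K + 1)
  have pε := hnn ε (K + 1)
  set ST := ∑ k ∈ range (K + 1), t k ^ 2
  set SS := ∑ k ∈ range (K + 1), s k ^ 2
  set SD := ∑ k ∈ range K, D k ^ 2
  set SG := ∑ k ∈ range K, G k ^ 2
  set SM := ∑ k ∈ range (K + 1), m k ^ 2
  set SE := ∑ k ∈ range (K + 1), ε k ^ 2
  set q := 1 - ρ
  have hT0 := sq_nonneg (t 0)
  -- tracking error
  have B1 : q ^ 2 * ST ≤ t 0 ^ 2 + SG := by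
    have hq1 : q ≤ 1 := by simp only [q]; linarith
    nlinarith
  -- The fourth power in the step size condition is spent in two halves: one `q²` here against the
  -- loss in the tracking error, the other in `A1` against the loss in the consensus error.
  have B2 : 32 * n * (η * Λ) ^ 2 * ST ≤ q ^ 2 * (t 0 ^ 2 + SG) := by
    calc _ ≤ q ^ 4 * ST := mul_le_mul_of_nonneg_right hθ pt
      _ = q ^ 2 * (q ^ 2 * ST) := by ring
      _ ≤ _ := mul_le_mul_of_nonneg_left B1 (sq_nonneg q)
  have B3 : 32 * n * (η * Λ) ^ 2 * ST ≤ t 0 ^ 2 + SG := B2.trans (by nlinarith)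
  have A0 : q ^ 2 * SS ≤ η ^ 2 * ST := by
    have := mul_le_mul_of_nonneg_left ht' (sq_nonneg η)
    linarith
  have A1 : 32 * n * Λ ^ 2 * SS ≤ t 0 ^ 2 + SG := by
    have h := mul_le_mul_of_nonneg_left A0 (show 0 ≤ 32 * n * Λ ^ 2 by positivity)
    have h' : q ^ 2 * (32 * n * Λ ^ 2 * SS) ≤ q ^ 2 * (t 0 ^ 2 + SG) := by
      calc _ = 32 * n * Λ ^ 2 * (q ^ 2 * SS) := by ring
        _ ≤ _ := h
        _ = 32 * n * (η * Λ) ^ 2 * ST := by ring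
        _ ≤ _ := B2
    exact le_of_mul_le_mul_left h' (by positivity)
  have hθ1 : 32 * (n * (η * Λ) ^ 2) ≤ 1 := by
    have : q ^ 4 ≤ 1 := by
      calc q ^ 4 = (q ^ 2) ^ 2 := by ring
        _ ≤ 1 := pow_le_one₀ (sq_nonneg q) hq2
    linarith
  have X1 : Λ ^ 2 * SD ≤ 8 * (Λ ^ 2 * SS) + 2 * ((η * Λ) ^ 2 * ST) + SM / 32 := by
    have h := mul_le_mul_of_nonneg_left D1 (sq_nonneg Λ)
    have h2 := mul_le_mul_of_nonneg_left hs' (sq_nonneg Λ)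
    have h3 := mul_le_mul_of_nonneg_left ht' (sq_nonneg (η * Λ))
    have h4 := mul_le_mul_of_nonneg_right hθ1 pm'
    nlinarith
  have hSS : Λ ^ 2 * SS ≤ n * (Λ ^ 2 * SS) := le_mul_of_one_le_left (by positivity) hn1
  have hST : (η * Λ) ^ 2 * ST ≤ n * ((η * Λ) ^ 2 * ST) := le_mul_of_one_le_left (by positivity) hn1
  have hSD : Λ ^ 2 * SD ≤ n * (Λ ^ 2 * SD) := le_mul_of_one_le_left (by positivity) hn1
  -- This closes the loop. The bounds above give `n Λ² SD` at most `5/16` of `t 0 ^ 2 + SG` plus the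
  -- `m` terms, and `SG` returns at most `2 Λ² SD` plus errors, so the total gain is `5/8` and the
  -- feedback can be absorbed.
  have G2 : SG ≤ 2 * (Λ ^ 2 * SD) + 8 * SE := by linarith
  constructor
  · linarith
  · have X2 := mul_le_mul_of_nonneg_left X1 (show (0 : ℝ) ≤ n by positivity)
    nlinarith

variable {n p : ℕ} {W : Matrix (Fin n) (Fin n) ℝ} {η : ℝ} {x u h : ℕ → Fin n → Vec p}

/-- Gradient tracking with outer iterates `x`, trackers `u` of the quantities `h`. -/
structure TrackingRun (W : Matrix (Fin n) (Fin n) ℝ) (η : ℝ) (x u h : ℕ → Fin n → Vec p) :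
    Prop where
  x_zero : x 0 = 0
  u_zero : u 0 = h 0
  x_succ : ∀ k, x (k + 1) = mix W (x k) - η • u k
  u_succ : ∀ k, u (k + 1) = mix W (u k) + h (k + 1) - h k

namespace TrackingRun

/-- The tracking invariant: mixing preserves means, and the increments of `h` telescope from `u 0 =
h 0`. -/
lemma avg_u (hr : TrackingRun W η x u h) (hW : W ∈ doublyStochastic ℝ (Fin n)) (k : ℕ) :
    avg (u k) = avg (h k) := by
  induction k with
  | zero => rw [hr.u_zero]
  | succ k ih => rw [hr.u_succ, avg_sub, avg_add, avg_mix hW, ih]; abel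

lemma avg_x_succ (hr : TrackingRun W η x u h) (hW : W ∈ doublyStochastic ℝ (Fin n)) (k : ℕ) :
    avg (x (k + 1)) = avg (x k) - η • avg (h k) := by
  rw [hr.x_succ, avg_sub, avg_smul, avg_mix hW, hr.avg_u hW]

variable {hW : W.IsHermitian}

lemma dev_x_zero (hr : TrackingRun W η x u h) : l2 (dev (x 0)) = 0 := by
  have : dev (x 0) = 0 := by rw [hr.x_zero]; ext1 i; simp [dev, avg]
  rw [this]; simp [l2]

lemma dev_x_succ_le (hr : TrackingRun W η x u h) (hWd : W ∈ doublyStochastic ℝ (Fin n))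
    (hρ : rho W hW < 1) (hη : 0 ≤ η) (k : ℕ) :
    l2 (dev (x (k + 1))) ≤ rho W hW * l2 (dev (x k)) + η * l2 (dev (u k)) := by
  rw [hr.x_succ, dev_sub, dev_smul]
  refine (l2_sub_le _ _).trans (add_le_add (l2_dev_mix_le hW hWd hρ _) ?_)
  rw [l2_smul, abs_of_nonneg hη]

lemma dev_u_succ_le (hr : TrackingRun W η x u h) (hn : 0 < n)
    (hWd : W ∈ doublyStochastic ℝ (Fin n)) (hρ : rho W hW < 1) (k : ℕ) :
    l2 (dev (u (k + 1))) ≤ rho W hW * l2 (dev (u k)) + l2 (h (k + 1) - h k) := by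
  rw [hr.u_succ, add_sub_assoc, dev_add]
  exact (l2_add_le _ _).trans (add_le_add (l2_dev_mix_le hW hWd hρ _) (l2_dev_le hn _))

/-- Mean and deviation of the displacement are orthogonal: the mean moves by exactly `-η avg h`,
while the deviation moves through mixing and the trackers' deviation only. -/
lemma displacement_sq_le (hr : TrackingRun W η x u h) (hn : 0 < n)
    (hWd : W ∈ doublyStochastic ℝ (Fin n)) (hρ : rho W hW < 1) (hη : 0 ≤ η) (k : ℕ) :
    l2 (x (k + 1) - x k) ^ 2 ≤ 8 * l2 (dev (x k)) ^ 2 + 2 * η ^ 2 * l2 (dev (u k)) ^ 2 +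
      n * η ^ 2 * ‖avg (h k)‖ ^ 2 := by
  rw [l2_sq_eq_dev_add hn]
  have e1 : avg (x (k + 1) - x k) = -(η • avg (h k)) := by
    rw [avg_sub, hr.avg_x_succ hWd]; abel
  have e2 : dev (x (k + 1) - x k) = (mix W (x k) - x k) - η • dev (u k) := by
    ext1 i
    change (x (k + 1) - x k) i - avg (x (k + 1) - x k) = _
    rw [e1, hr.x_succ]
    simp only [dev, Pi.sub_apply, Pi.smul_apply, hr.avg_u hWd, smul_sub]
    abel
  have h1 : l2 (dev (x (k + 1) - x k)) ≤ 2 * l2 (dev (x k)) + η * l2 (dev (u k)) := by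
    rw [e2]
    refine (l2_sub_le _ _).trans (add_le_add (l2_mix_sub_le hW hWd hρ _) ?_)
    rw [l2_smul, abs_of_nonneg hη]
  have h2 := pow_le_pow_left₀ (l2_nonneg _) h1 2
  rw [e1, norm_neg, norm_smul, Real.norm_of_nonneg hη, mul_pow]
  nlinarith [sq_nonneg (2 * l2 (dev (x k)) - η * l2 (dev (u k)))]

/-- Convergence of gradient tracking with inexact gradients `h`; `F` is the exact counterpart. -/
theorem sum_norm_gradient_le (hr : TrackingRun W η x u h) (hn : 0 < n)
    (hWd : W ∈ doublyStochastic ℝ (Fin n)) (hρ : rho W hW < 1) (hη : 0 < η) {Λ : ℝ}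
    (hθ : 32 * n * (η * Λ) ^ 2 ≤ (1 - rho W hW) ^ 4) {Φ : Vec p → ℝ}
    {F : (Fin n → Vec p) → Fin n → Vec p} (hF : ∀ z z', l2 (F z - F z') ≤ Λ * l2 (z - z'))
    (hΦ : ∀ z, HasGradientAt Φ (avg (F fun _ => z)) z) (hb : BddBelow (Set.range Φ)) (K : ℕ) :
    ∑ k ∈ range (K + 1), ‖gradient Φ (avg (x k))‖ ^ 2 +
        (∑ k ∈ range (K + 1), ‖avg (h k)‖ ^ 2) / 2 ≤
      2 / η * (Φ (avg (x 0)) - ⨅ z, Φ z) +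
        (4 * ∑ k ∈ range (K + 1), l2 (h k - F (x k)) ^ 2 + l2 (dev (h 0)) ^ 2 / 6) / n ∧
    n * (Λ ^ 2 * ∑ k ∈ range K, l2 (x (k + 1) - x k) ^ 2) ≤ l2 (dev (h 0)) ^ 2 +
      7 * ∑ k ∈ range (K + 1), l2 (h k - F (x k)) ^ 2 +
      n * (∑ k ∈ range (K + 1), ‖avg (h k)‖ ^ 2) / 12 := by
  have hn1 : (1 : ℝ) ≤ n := by exact_mod_cast hn
  have hn0 : (0 : ℝ) < n := by linarith
  have hs : 0 < √(n : ℝ) := Real.sqrt_pos.2 hn0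
  set ε : ℕ → ℝ := fun k => l2 (h k - F (x k)) with hε
  have hG : ∀ k, l2 (h (k + 1) - h k) ^ 2 ≤
      2 * Λ ^ 2 * l2 (x (k + 1) - x k) ^ 2 + 4 * ε k ^ 2 + 4 * ε (k + 1) ^ 2 := fun k => by
    have e : h (k + 1) - h k = (F (x (k + 1)) - F (x k)) +
      ((h (k + 1) - F (x (k + 1))) - (h k - F (x k))) := by abel
    have h1 : l2 (h (k + 1) - h k) ≤ Λ * l2 (x (k + 1) - x k) + (ε (k + 1) + ε k) := by
      rw [e]
      exact (l2_add_le _ _).trans (add_le_add (hF _ _) (l2_sub_le _ _))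
    have h2 := pow_le_pow_left₀ (l2_nonneg _) h1 2
    nlinarith [sq_nonneg (Λ * l2 (x (k + 1) - x k) - (ε (k + 1) + ε k)),
      sq_nonneg (ε (k + 1) - ε k)]
  obtain ⟨c1, c2⟩ := coupled_sum_le hn (rho_nonneg W hW) hρ hθ (s := fun k => l2 (dev (x k)))
    (t := fun k => l2 (dev (u k))) (D := fun k => l2 (x (k + 1) - x k))
    (G := fun k => l2 (h (k + 1) - h k)) (ε := ε) (m := fun k => ‖avg (h k)‖)
    (fun k => l2_nonneg _) (fun k => l2_nonneg _) hr.dev_x_zero (hr.dev_x_succ_le hWd hρ hη.le)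
    (hr.dev_u_succ_le hn hWd hρ) (hr.displacement_sq_le (hW := hW) hn hWd hρ hη.le) hG K
  simp only [hr.u_zero] at c1 c2
  refine ⟨?_, c2⟩
  have hgrad : gradient Φ = fun z => avg (F fun _ => z) := funext fun z => (hΦ z).gradient
  have hdiff : Differentiable ℝ Φ := fun z => (hΦ z).differentiableAt
  have hconst : ∀ z z' : Vec p, ((fun _ => z) - fun _ => z' : Fin n → Vec p) = fun _ => z - z' :=
    fun _ _ => rfl
  -- On constant stacks the factors `√n` on both sides cancel, so `∇Φ` inherits the constant of `F`.
  have hlip : Lip Λ (gradient Φ) := fun z z' => by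
    rw [hgrad]
    refine le_of_mul_le_mul_left ?_ hs
    rw [← avg_sub]
    refine (sqrt_mul_norm_avg_le hn _).trans ((hF _ _).trans ?_)
    rw [hconst, l2_const]
    exact le_of_eq (by ring)
  have hθ1 : η * Λ ≤ 1 / 4 := by
    have hq : (1 - rho W hW) ^ 4 ≤ 1 :=
      pow_le_one₀ (by linarith) (by linarith [rho_nonneg W hW])
    have h2 : (η * Λ) ^ 2 ≤ n * (η * Λ) ^ 2 := le_mul_of_one_le_left (sq_nonneg _) hn1
    nlinarith
  have herr : ∀ k, n * ‖gradient Φ (avg (x k)) - avg (h k)‖ ^ 2 ≤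
      2 * ε k ^ 2 + 2 * (Λ ^ 2 * l2 (dev (x k)) ^ 2) := fun k => by
    have h1 : √n * ‖gradient Φ (avg (x k)) - avg (h k)‖ ≤ ε k + Λ * l2 (dev (x k)) := by
      rw [hgrad, norm_sub_rev, ← avg_sub]
      refine (sqrt_mul_norm_avg_le hn _).trans ?_
      refine (l2_sub_le_add _ (F (x k)) _).trans (add_le_add le_rfl ?_)
      exact hF _ _
    have h2 := pow_le_pow_left₀ (by positivity) h1 2
    rw [mul_pow, Real.sq_sqrt hn0.le] at h2
    nlinarith [sq_nonneg (ε k - Λ * l2 (dev (x k)))]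
  -- Descent lemma with `2⟨∇Φ, h⟩ = ‖∇Φ‖² + ‖h‖² - ‖∇Φ - h‖²`; the quadratic term costs a quarter of
  -- `‖h‖²` because `ηΛ ≤ 1/4`.
  have hdesc : ∀ k, η * (‖gradient Φ (avg (x k))‖ ^ 2 + 3 / 4 * ‖avg (h k)‖ ^ 2 -
      ‖gradient Φ (avg (x k)) - avg (h k)‖ ^ 2) ≤
      2 * (Φ (avg (x k)) - Φ (avg (x (k + 1)))) := fun k => by
    have h1 := le_add_inner_gradient_add hdiff hlip (avg (x k)) (avg (x (k + 1)))
    have e : avg (x (k + 1)) - avg (x k) = -(η • avg (h k)) := by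
      rw [hr.avg_x_succ hWd]; abel
    rw [e, norm_neg, inner_neg_right, inner_smul_right, norm_smul, Real.norm_of_nonneg hη.le,
      mul_pow] at h1
    rw [norm_sub_sq_real]
    nlinarith [mul_le_mul_of_nonneg_right hθ1 (mul_nonneg hη.le (sq_nonneg ‖avg (h k)‖))]
  have s1 := Finset.sum_le_sum fun k (_ : k ∈ range (K + 1)) => hdesc k
  have s2 := Finset.sum_le_sum fun k (_ : k ∈ range (K + 1)) => herr k
  rw [← Finset.mul_sum, ← Finset.mul_sum, Finset.sum_range_sub', Finset.sum_sub_distrib,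
    Finset.sum_add_distrib, ← Finset.mul_sum] at s1
  rw [← Finset.mul_sum, Finset.sum_add_distrib, ← Finset.mul_sum, ← Finset.mul_sum,
    ← Finset.mul_sum] at s2
  have hinf : ⨅ z, Φ z ≤ Φ (avg (x (K + 1))) := ciInf_le hb _
  have pm : 0 ≤ ∑ k ∈ range (K + 1), ‖avg (h k)‖ ^ 2 := Finset.sum_nonneg fun _ _ => sq_nonneg _
  have ps : 0 ≤ ∑ k ∈ range (K + 1), l2 (dev (x k)) ^ 2 := Finset.sum_nonneg fun _ _ => sq_nonneg _
  have hA : Λ ^ 2 * ∑ k ∈ range (K + 1), l2 (dev (x k)) ^ 2 ≤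
      n * (Λ ^ 2 * ∑ k ∈ range (K + 1), l2 (dev (x k)) ^ 2) :=
    le_mul_of_one_le_left (by positivity) hn1
  have hε2 : ∀ k, l2 (h k - F (x k)) = ε k := fun _ => rfl
  simp only [hε2]
  set SE := ∑ k ∈ range (K + 1), ε k ^ 2
  set SM := ∑ k ∈ range (K + 1), ‖avg (h k)‖ ^ 2
  set SN := ∑ k ∈ range (K + 1), ‖gradient Φ (avg (x k))‖ ^ 2
  set SR := ∑ k ∈ range (K + 1), ‖gradient Φ (avg (x k)) - avg (h k)‖ ^ 2
  have k1 : SN + 3 / 4 * SM - SR ≤ 2 / η * (Φ (avg (x 0)) - ⨅ z, Φ z) := by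
    rw [div_mul_eq_mul_div 2 η, le_div_iff₀ hη]
    linarith
  -- The mean-step part of the consensus bound costs at most another quarter of `SM`; together with
  -- `3/4` in `k1`, one half of `SM` remains on the left.
  have k2 : SR ≤ (4 * SE + l2 (dev (h 0)) ^ 2 / 6) / n + SM / 4 := by
    rw [← sub_le_iff_le_add, le_div_iff₀ hn0]
    have pE : 0 ≤ SE := Finset.sum_nonneg fun _ _ => sq_nonneg _
    have : SM ≤ SM * n := le_mul_of_one_le_right pm hn1
    linarith
  linarith

end TrackingRun

end Outer

end DBOGT

namespace DBOGT

/-! ### Coinciding lower level functions -/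

section Hom

open Finset

variable {n p q : ℕ} {L Lf0 Lg2 μ : ℝ}

/-- The solution `[∇_y² g]⁻¹ ∇_y f` of the linear system. -/
noncomputable def linSol (f g : Vec p → Vec q → ℝ) (x : Vec p) (y : Vec q) : Vec q :=
  (hessY g x y).inverse (gradY f x y)

/-- The local hypergradient surrogate. -/
noncomputable def locHyper (f g : Vec p → Vec q → ℝ) (x : Vec p) (y : Vec q) : Vec p :=
  gradX f x y - jacXY g x y (linSol f g x y)

section Local

variable {f g : Vec p → Vec q → ℝ}

lemma yStar_single (g : Vec p → Vec q → ℝ) (x : Vec p) :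
    yStar (fun _ : Fin 1 => g) x = argmin (g x) := by
  simp [yStar]

lemma norm_argmin_sub_le (hμ0 : 0 < μ) (hμL : μ ≤ L) (hg : LowerReg L Lg2 μ g) (x x' : Vec p) :
    ‖argmin (g x) - argmin (g x')‖ ≤ L / μ * ‖x - x'‖ := by
  rw [← yStar_single, ← yStar_single]
  exact norm_yStar_sub_le one_pos hμ0 hμL (fun _ => hg) x x'

lemma gradY_argmin (hμ0 : 0 < μ) (hμL : μ ≤ L) (hg : LowerReg L Lg2 μ g) (x : Vec p) :
    gradY g x (argmin (g x)) = 0 := by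
  rw [← yStar_single]
  have h := avg_gradY_lowerSol one_pos hμ0 hμL (fun _ : Fin 1 => hg) fun _ => x
  rwa [avg_const one_pos] at h

/-- The factor `L` is the bound for `jacXY`, through which errors of the linear system enter the
hypergradient. With it, the same constant `Lf` serves as for the surrogate itself. -/
lemma norm_linSol_sub_le (hμ0 : 0 < μ) (hμL : μ ≤ L) (h0 : 0 ≤ Lf0) (h2 : 0 ≤ Lg2)
    (hf : UpperReg L Lf0 f) (hg : LowerReg L Lg2 μ g) (x x' : Vec p) (y y' : Vec q) :
    L * ‖linSol f g x y - linSol f g x' y'‖ ≤ Lf L Lf0 Lg2 μ * ‖pt x y - pt x' y'‖ := by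
  have hL : 0 < L := hμ0.trans_le hμL
  set r := ‖pt x y - pt x' y'‖
  have hr : 0 ≤ r := norm_nonneg _
  have h := norm_inverse_apply_sub_le hμ0 (hg.le_inner_hessY x y) (hg.le_inner_hessY x' y')
    (gradY f x y) (gradY f x' y') (hf.norm_gradY_le h0 x' y')
  calc _ ≤ L * ((L * r + Lf0 / μ * (Lg2 * r)) / μ) := by
        refine mul_le_mul_of_nonneg_left (h.trans ?_) hL.le
        gcongr
        · exact norm_gradY_sub_le hf.diff hf.grad_lip _ _ _ _
        · exact hg.norm_hessY_sub_le h2 _ _ _ _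
    _ = (L ^ 2 / μ + Lf0 * (Lg2 * L / μ ^ 2)) * r := by ring
    _ ≤ _ := by
        refine mul_le_mul_of_nonneg_right ?_ hr
        rw [Lf, mul_add Lf0]
        have : 0 ≤ Lf0 * (Lg2 / μ) := by positivity
        linarith

lemma norm_locHyper_sub_le (hμ0 : 0 < μ) (hμL : μ ≤ L) (h0 : 0 ≤ Lf0) (h2 : 0 ≤ Lg2)
    (hf : UpperReg L Lf0 f) (hg : LowerReg L Lg2 μ g) (x x' : Vec p) (y y' : Vec q) :
    ‖locHyper f g x y - locHyper f g x' y'‖ ≤ Lf L Lf0 Lg2 μ * ‖pt x y - pt x' y'‖ := by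
  have hL : 0 < L := hμ0.trans_le hμL
  set r := ‖pt x y - pt x' y'‖
  refine (norm_hyper_sub_le hμ0 (hg.le_inner_hessY x y) (hg.le_inner_hessY x' y')
    (hg.norm_jacXY_le hL.le x y) _ _ _ _ (hf.norm_gradY_le h0 x' y')).trans ?_
  calc _ ≤ L * r + L * ((L * r + Lf0 / μ * (Lg2 * r)) / μ) + Lf0 / μ * (Lg2 * r) := by
        gcongr
        · exact norm_gradX_sub_le hf.diff hf.grad_lip _ _ _ _
        · exact norm_gradY_sub_le hf.diff hf.grad_lip _ _ _ _
        · exact hg.norm_hessY_sub_le h2 _ _ _ _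
        · exact hg.norm_jacXY_sub_le h2 _ _ _ _
    _ = _ := by rw [Lf]; ring

end Local

/-- For `κ ≥ 1` one has `√(1 + κ²) ≤ κ + 1/2`, and `LPhi - (κ + 1/2) Lf` is a sum of nonnegative
terms. So `LPhi` dominates the Lipschitz constant obtained from the pair `(x, y*(x))`. -/
lemma sqrt_mul_Lf_le_LPhi (hμ0 : 0 < μ) (hμL : μ ≤ L) (h0 : 0 ≤ Lf0) (h2 : 0 ≤ Lg2) :
    √(1 + (L / μ) ^ 2) * Lf L Lf0 Lg2 μ ≤ LPhi L Lf0 Lg2 μ := by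
  have hL : 0 < L := hμ0.trans_le hμL
  have hκ : 1 ≤ L / μ := (one_le_div hμ0).2 hμL
  have h1 : √(1 + (L / μ) ^ 2) ≤ L / μ + 1 / 2 := by
    rw [Real.sqrt_le_left (by positivity)]
    nlinarith
  refine (mul_le_mul_of_nonneg_right h1 (Lf_pos hμ0 hμL h0 h2).le).trans ?_
  have e : LPhi L Lf0 Lg2 μ = (L / μ + 1 / 2) * Lf L Lf0 Lg2 μ +
      ((L + L ^ 2 / μ) / 2 + Lg2 * Lf0 ^ 2 / μ + Lf0 * (Lg2 / μ) * (L / μ - 1) / 2) := by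
    rw [LPhi, Lf]; ring
  rw [e]
  have : 0 ≤ Lf0 * (Lg2 / μ) * (L / μ - 1) := mul_nonneg (by positivity) (by linarith)
  have : 0 ≤ (L + L ^ 2 / μ) / 2 + Lg2 * Lf0 ^ 2 / μ := by positivity
  linarith

lemma kappa_mul_Lf_le_LPhi (hμ0 : 0 < μ) (hμL : μ ≤ L) (h0 : 0 ≤ Lf0) (h2 : 0 ≤ Lg2) :
    L / μ * Lf L Lf0 Lg2 μ ≤ LPhi L Lf0 Lg2 μ := by
  have hL : 0 < L := hμ0.trans_le hμL
  refine le_trans (mul_le_mul_of_nonneg_right ?_ (Lf_pos hμ0 hμL h0 h2).le)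
    (sqrt_mul_Lf_le_LPhi hμ0 hμL h0 h2)
  exact Real.le_sqrt_of_sq_le (by linarith)

/-- Isolates the dependence on `κ`: `Lf` is of order `κ²`, so the factor `Lf²` in the initial error
is cancelled by a `deltaY` of order `κ⁻⁴`, leaving constants that depend on `L`, `Lf0`, `Lg2` only.
-/
lemma Lf_le (hμ0 : 0 < μ) (hμL : μ ≤ L) (h0 : 0 ≤ Lf0) (h2 : 0 ≤ Lg2) :
    Lf L Lf0 Lg2 μ ≤ 2 * (L + Lf0 * Lg2 / L) * (L / μ) ^ 2 := by
  have hL : 0 < L := hμ0.trans_le hμL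
  have hκ : 1 ≤ L / μ := (one_le_div hμ0).2 hμL
  set κ := L / μ with hκd
  have e : Lf L Lf0 Lg2 μ = L * (1 + κ) + Lf0 * Lg2 / L * (κ + κ ^ 2) := by
    rw [Lf, hκd]; field_simp
  rw [e]
  have a : 0 ≤ Lf0 * Lg2 / L := by positivity
  have h3 : κ ≤ κ ^ 2 := by nlinarith
  have h4 := mul_le_mul_of_nonneg_left (show 1 + κ ≤ 2 * κ ^ 2 by nlinarith) hL.le
  have h5 := mul_le_mul_of_nonneg_left (show κ + κ ^ 2 ≤ 2 * κ ^ 2 by linarith) a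
  nlinarith

/-! ### The inner solvers -/

lemma deltaY_nonneg_le_one {ηy : ℝ} (hμ0 : 0 < μ) (hμL : μ ≤ L) (hη : 0 < ηy)
    (hη' : ηy ≤ 2 / (μ + L)) : 0 ≤ 1 - 2 * ηy * μ * L / (μ + L) ∧
      1 - 2 * ηy * μ * L / (μ + L) ≤ 1 := by
  have hL : 0 < L := hμ0.trans_le hμL
  have hs : 0 < μ + L := by linarith
  rw [le_div_iff₀ hs] at hη'
  constructor
  · rw [sub_nonneg, div_le_one hs]
    have h1 : 4 * (μ * L) ≤ (μ + L) ^ 2 := by nlinarith [sq_nonneg (μ - L)]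
    refine le_of_mul_le_mul_right ?_ hs
    nlinarith [mul_le_mul_of_nonneg_right hη' (mul_pos hμ0 hL).le]
  · have : 0 ≤ 2 * ηy * μ * L / (μ + L) := by positivity
    linarith

variable {f g : Fin n → Vec p → Vec q → ℝ}

lemma l2_homInner_sq_le {ηy : ℝ} (hμ0 : 0 < μ) (hμL : μ ≤ L)
    (hg : ∀ i, LowerReg L Lg2 μ (g i)) (hη : 0 < ηy) (hη' : ηy ≤ 2 / (μ + L)) (T : ℕ)
    (x : Fin n → Vec p) (y : Fin n → Vec q) :
    l2 (fun i => homInner g ηy T x y i - argmin (g i (x i))) ^ 2 ≤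
      deltaY L μ ηy T * l2 (fun i => y i - argmin (g i (x i))) ^ 2 := by
  rw [l2_sq, l2_sq, Finset.mul_sum]
  refine Finset.sum_le_sum fun i _ => ?_
  rw [homInner, deltaY]
  induction T with
  | zero => simp
  | succ T ih =>
    rw [Function.iterate_succ_apply', pow_succ' (1 - 2 * ηy * μ * L / (μ + L)) T,
      mul_assoc (1 - 2 * ηy * μ * L / (μ + L))]
    refine (norm_gradient_step_sq_le hμ0 hμL ((hg i).differentiable_right (x i))
      ((hg i).strong (x i)) ((hg i).lip_gradY (x i)) hη hη'
      (gradY_argmin hμ0 hμL (hg i) (x i)) _).trans ?_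
    exact mul_le_mul_of_nonneg_left ih (deltaY_nonneg_le_one hμ0 hμL hη hη').1

lemma l2_homCG_sq_le (hμ0 : 0 < μ) (hμL : μ ≤ L)
    (hg : ∀ i, LowerReg L Lg2 μ (g i)) (N : ℕ) (x : Fin n → Vec p) (y v : Fin n → Vec q) :
    l2 (fun i => linSol (f i) (g i) (x i) (y i) - homCG f g N x y v i) ^ 2 ≤
      4 * (L / μ) * deltaK L μ N * l2 (fun i => linSol (f i) (g i) (x i) (y i) - v i) ^ 2 := by
  rw [l2_sq, l2_sq, Finset.mul_sum]
  refine Finset.sum_le_sum fun i _ => ?_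
  exact norm_sub_cg_sq_le _ hμ0 hμL ((hg i).hessY_symm _ _) ((hg i).le_inner_hessY _ _)
    ((hg i).norm_hessY_le (hμ0.le.trans hμL) _ _) _ _ _
    ((isInvertible_of_coercive hμ0 ((hg i).le_inner_hessY (x i) (y i))).self_apply_inverse _) N

/-- The error of the inner solvers. -/
noncomputable def homErr (L Lf0 Lg2 μ : ℝ) (f g : Fin n → Vec p → Vec q → ℝ) (x : Fin n → Vec p)
    (y v : Fin n → Vec q) : ℝ :=
  Lf L Lf0 Lg2 μ ^ 2 * l2 (fun i => y i - argmin (g i (x i))) ^ 2 +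
    L ^ 2 * l2 (fun i => linSol (f i) (g i) (x i) (y i) - v i) ^ 2

lemma homErr_nonneg (x : Fin n → Vec p) (y v : Fin n → Vec q) :
    0 ≤ homErr L Lf0 Lg2 μ f g x y v := by
  rw [homErr]; positivity

lemma l2_linSol_sub_sq_le (hμ0 : 0 < μ) (hμL : μ ≤ L) (h0 : 0 ≤ Lf0) (h2 : 0 ≤ Lg2)
    (hf : ∀ i, UpperReg L Lf0 (f i)) (hg : ∀ i, LowerReg L Lg2 μ (g i))
    (x x' : Fin n → Vec p) (y y' : Fin n → Vec q) :
    L ^ 2 * l2 (fun i => linSol (f i) (g i) (x i) (y i) - linSol (f i) (g i) (x' i) (y' i)) ^ 2 ≤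
      Lf L Lf0 Lg2 μ ^ 2 * (l2 (x - x') ^ 2 + l2 (y - y') ^ 2) := by
  have hL : 0 < L := hμ0.trans_le hμL
  rw [l2_sq, l2_sq, l2_sq, ← Finset.sum_add_distrib, Finset.mul_sum, Finset.mul_sum]
  refine Finset.sum_le_sum fun i _ => ?_
  rw [Pi.sub_apply, Pi.sub_apply, ← norm_pt_sub_sq, ← mul_pow, ← mul_pow]
  exact pow_le_pow_left₀ (by positivity) (norm_linSol_sub_le hμ0 hμL h0 h2 (hf i) (hg i) _ _ _ _) 2

lemma l2_argmin_sub_le (hμ0 : 0 < μ) (hμL : μ ≤ L) (hg : ∀ i, LowerReg L Lg2 μ (g i))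
    (x x' : Fin n → Vec p) :
    l2 (fun i => argmin (g i (x i)) - argmin (g i (x' i))) ≤ L / μ * l2 (x - x') :=
  l2_le_of_forall_le (div_nonneg (hμ0.le.trans hμL) hμ0.le) fun i =>
    norm_argmin_sub_le hμ0 hμL (hg i) _ _

/-- The local surrogates at the local lower level solutions. -/
noncomputable def homExact (f g : Fin n → Vec p → Vec q → ℝ) (x : Fin n → Vec p) : Fin n → Vec p :=
  fun i => locHyper (f i) (g i) (x i) (argmin (g i (x i)))

lemma l2_homExact_sub_le (hμ0 : 0 < μ) (hμL : μ ≤ L) (h0 : 0 ≤ Lf0) (h2 : 0 ≤ Lg2)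
    (hf : ∀ i, UpperReg L Lf0 (f i)) (hg : ∀ i, LowerReg L Lg2 μ (g i)) (x x' : Fin n → Vec p) :
    l2 (homExact f g x - homExact f g x') ≤ LPhi L Lf0 Lg2 μ * l2 (x - x') := by
  have hΛ := sqrt_mul_Lf_le_LPhi hμ0 hμL h0 h2
  have hLf := Lf_pos hμ0 hμL h0 h2
  refine l2_le_of_forall_le (le_trans (by positivity) hΛ) fun i => ?_
  refine (norm_locHyper_sub_le hμ0 hμL h0 h2 (hf i) (hg i) _ _ _ _).trans ?_
  refine le_trans ?_ (mul_le_mul_of_nonneg_right hΛ (norm_nonneg _))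
  rw [mul_comm (√(1 + (L / μ) ^ 2)), mul_assoc]
  refine mul_le_mul_of_nonneg_left ?_ hLf.le
  refine le_of_sq_le_sq ?_ (by positivity)
  rw [norm_pt_sub_sq, mul_pow, Real.sq_sqrt (by positivity), Pi.sub_apply]
  have h3 := pow_le_pow_left₀ (norm_nonneg _) (norm_argmin_sub_le hμ0 hμL (hg i) (x i) (x' i)) 2
  linarith

/-- With a common lower level function all averages collapse. The two exact maps agree only on
constant stacks in general, which is all that the link with `∇Φ` requires. -/
lemma homExact_const (hn : 0 < n) (hgg : ∀ i j, g i = g j) (z : Vec p) :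
    homExact f g (fun _ => z) = exactHyper f g fun _ => z := by
  have hn' : (n : ℝ) ≠ 0 := by positivity
  ext1 i
  have e : ∀ j, g j = g i := fun j => hgg j i
  have hy : lowerSol g (fun _ => z) = argmin (g i z) := by
    simp [lowerSol, e, hn']
  rw [exactHyper, hy, hyper, homExact, locHyper, linSol]
  simp only [e, avg_eq_self hn]

/-- The error of `y` acts through the Lipschitz surrogate, that of `v` through `jacXY`; this
explains the weights `Lf²` and `L²` in `homErr`. -/
lemma l2_homHyper_sub_sq_le (hμ0 : 0 < μ) (hμL : μ ≤ L) (h0 : 0 ≤ Lf0) (h2 : 0 ≤ Lg2)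
    (hf : ∀ i, UpperReg L Lf0 (f i)) (hg : ∀ i, LowerReg L Lg2 μ (g i)) (x : Fin n → Vec p)
    (y v : Fin n → Vec q) :
    l2 (homHyper f g x y v - homExact f g x) ^ 2 ≤ 2 * homErr L Lf0 Lg2 μ f g x y v := by
  have hL : 0 < L := hμ0.trans_le hμL
  rw [homErr, l2_sq, l2_sq, l2_sq, Finset.mul_sum, Finset.mul_sum, ← Finset.sum_add_distrib,
    Finset.mul_sum]
  refine Finset.sum_le_sum fun i _ => ?_
  have e : (homHyper f g x y v - homExact f g x) i =
      (locHyper (f i) (g i) (x i) (y i) - locHyper (f i) (g i) (x i) (argmin (g i (x i)))) +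
        jacXY (g i) (x i) (y i) (linSol (f i) (g i) (x i) (y i) - v i) := by
    simp only [Pi.sub_apply, homHyper, homExact, locHyper, map_sub]; abel
  have h3 := norm_locHyper_sub_le hμ0 hμL h0 h2 (hf i) (hg i) (x i) (x i) (y i)
    (argmin (g i (x i)))
  rw [norm_pt_sub_right] at h3
  have h4 := ContinuousLinearMap.le_of_opNorm_le _ ((hg i).norm_jacXY_le hL.le (x i) (y i))
    (linSol (f i) (g i) (x i) (y i) - v i)
  have h5 := pow_le_pow_left₀ (norm_nonneg _) ((norm_add_le _ _).trans (add_le_add h3 h4)) 2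
  rw [e]
  nlinarith [sq_nonneg (Lf L Lf0 Lg2 μ * ‖y i - argmin (g i (x i))‖ -
    L * ‖linSol (f i) (g i) (x i) (y i) - v i‖)]

lemma add_sq_le_two (a b : ℝ) : (a + b) ^ 2 ≤ 2 * a ^ 2 + 2 * b ^ 2 := by
  nlinarith [sq_nonneg (a - b)]

lemma add_sq_le_three (a b c : ℝ) : (a + b + c) ^ 2 ≤ 3 * a ^ 2 + 3 * b ^ 2 + 3 * c ^ 2 := by
  nlinarith [sq_nonneg (a - b), sq_nonneg (b - c), sq_nonneg (a - c)]

lemma l2_sq_add_le {d : ℕ} (z w : Fin n → Vec d) : l2 (z + w) ^ 2 ≤ 2 * l2 z ^ 2 + 2 * l2 w ^ 2 :=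
  (pow_le_pow_left₀ (l2_nonneg _) (l2_add_le z w) 2).trans (add_sq_le_two _ _)

lemma deltaK_nonneg (L μ : ℝ) (N : ℕ) : 0 ≤ deltaK L μ N := (even_two_mul N).pow_nonneg _

/-- The error of the inner solvers contracts, up to the displacement of the outer iterates. -/
lemma homErr_succ_le {ηy : ℝ} (hμ0 : 0 < μ) (hμL : μ ≤ L) (h0 : 0 ≤ Lf0) (h2 : 0 ≤ Lg2)
    (hf : ∀ i, UpperReg L Lf0 (f i)) (hg : ∀ i, LowerReg L Lg2 μ (g i)) (hη : 0 < ηy)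
    (hη' : ηy ≤ 2 / (μ + L)) (T N : ℕ) (x x' : Fin n → Vec p) (y v : Fin n → Vec q) :
    homErr L Lf0 Lg2 μ f g x' (homInner g ηy T x' y) (homCG f g N x' (homInner g ηy T x' y) v) ≤
      (2 * deltaY L μ ηy T + 80 * (L / μ * deltaK L μ N)) *
        (homErr L Lf0 Lg2 μ f g x y v + LPhi L Lf0 Lg2 μ ^ 2 * l2 (x' - x) ^ 2) := by
  have hL : 0 < L := hμ0.trans_le hμL
  have hκ : 1 ≤ L / μ := (one_le_div hμ0).2 hμL
  have hδ := deltaY_nonneg_le_one hμ0 hμL hη hη'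
  have hδ0 : 0 ≤ deltaY L μ ηy T := pow_nonneg hδ.1 T
  have hδ1 : deltaY L μ ηy T ≤ 1 := pow_le_one₀ hδ.1 hδ.2
  have hK : 0 ≤ L / μ * deltaK L μ N := mul_nonneg (by linarith) (deltaK_nonneg L μ N)
  have hLf := Lf_pos hμ0 hμL h0 h2
  have hΛ2 := pow_le_pow_left₀ (by positivity) (kappa_mul_Lf_le_LPhi hμ0 hμL h0 h2) 2
  set Λ := LPhi L Lf0 Lg2 μ
  set ℓ := Lf L Lf0 Lg2 μ
  set κ := L / μ
  set y' := homInner g ηy T x' y with hy'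
  set v' := homCG f g N x' y' v with hv'
  have hΛ1 : ℓ ^ 2 ≤ Λ ^ 2 := 
    (pow_le_pow_left₀ hLf.le (le_mul_of_one_le_left hLf.le hκ) 2).trans hΛ2
  have i1 := l2_homInner_sq_le hμ0 hμL hg hη hη' T x' y
  have i2 := l2_homCG_sq_le (f := f) hμ0 hμL hg N x' y' v
  rw [← hy'] at i1
  rw [← hv'] at i2
  have ha := l2_argmin_sub_le hμ0 hμL hg x x'
  have ha' := l2_argmin_sub_le hμ0 hμL hg x' x
  rw [l2_sub_comm] at ha
  set D := l2 (x' - x) with hD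
  set Y := l2 (fun i => y i - argmin (g i (x i))) with hY
  set Y' := l2 (fun i => y' i - argmin (g i (x' i))) with hY'
  set V := l2 (fun i => linSol (f i) (g i) (x i) (y i) - v i) with hV
  set V' := l2 (fun i => linSol (f i) (g i) (x' i) (y' i) - v' i) with hV'
  -- Warm start: the old inner output is close to the old target, and the target has moved by at
  -- most `κ D`.
  have j1 : l2 (fun i => y i - argmin (g i (x' i))) ^ 2 ≤ 2 * Y ^ 2 + 2 * (κ * D) ^ 2 := by
    have e : (fun i => y i - argmin (g i (x' i))) = (fun i => y i - argmin (g i (x i))) +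
        fun i => argmin (g i (x i)) - argmin (g i (x' i)) := by
      ext1 i; simp
    rw [e]
    refine (l2_sq_add_le _ _).trans ?_
    have := pow_le_pow_left₀ (l2_nonneg _) ha 2
    linarith
  -- The linear system is posed at `y'`, so its solution also drifts with the change of the inner
  -- output.
  have j2 : l2 (y' - y) ^ 2 ≤ 3 * Y' ^ 2 + 3 * (κ * D) ^ 2 + 3 * Y ^ 2 := by
    have e : y' - y = (fun i => y' i - argmin (g i (x' i))) +
        (fun i => argmin (g i (x' i)) - argmin (g i (x i))) -
          fun i => y i - argmin (g i (x i)) := by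
      ext1 i; simp
    have h3 : l2 (y' - y) ≤ Y' + κ * D + Y := by
      rw [e]
      refine (l2_sub_le _ _).trans (add_le_add ((l2_add_le _ _).trans (add_le_add le_rfl ha')) le_rfl)
    exact (pow_le_pow_left₀ (l2_nonneg _) h3 2).trans (add_sq_le_three _ _ _)
  have j3 : L ^ 2 * l2 (fun i => linSol (f i) (g i) (x' i) (y' i) - v i) ^ 2 ≤
      2 * (L ^ 2 * V ^ 2) + 2 * (ℓ ^ 2 * (D ^ 2 + l2 (y' - y) ^ 2)) := by
    have e : (fun i => linSol (f i) (g i) (x' i) (y' i) - v i) =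
        (fun i => linSol (f i) (g i) (x i) (y i) - v i) +
        fun i => linSol (f i) (g i) (x' i) (y' i) - linSol (f i) (g i) (x i) (y i) := by
      ext1 i; simp
    have h3 := l2_linSol_sub_sq_le hμ0 hμL h0 h2 hf hg x' x y' y
    have h4 := mul_le_mul_of_nonneg_left (l2_sq_add_le
      (fun i => linSol (f i) (g i) (x i) (y i) - v i)
      (fun i => linSol (f i) (g i) (x' i) (y' i) - linSol (f i) (g i) (x i) (y i))) (sq_nonneg L)
    rw [e]
    linarith
  have hP : homErr L Lf0 Lg2 μ f g x y v = ℓ ^ 2 * Y ^ 2 + L ^ 2 * V ^ 2 := rfl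
  have hP' : homErr L Lf0 Lg2 μ f g x' y' v' = ℓ ^ 2 * Y' ^ 2 + L ^ 2 * V' ^ 2 := rfl
  rw [hP, hP']
  set P := ℓ ^ 2 * Y ^ 2 + L ^ 2 * V ^ 2 with hPd
  have pY : 0 ≤ ℓ ^ 2 * Y ^ 2 := by positivity
  have pV : 0 ≤ L ^ 2 * V ^ 2 := by positivity
  have hκD : ℓ ^ 2 * (κ * D) ^ 2 ≤ Λ ^ 2 * D ^ 2 := by
    rw [show ℓ ^ 2 * (κ * D) ^ 2 = (κ * ℓ) ^ 2 * D ^ 2 by ring]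
    exact mul_le_mul_of_nonneg_right hΛ2 (sq_nonneg D)
  have hℓD : ℓ ^ 2 * D ^ 2 ≤ Λ ^ 2 * D ^ 2 := mul_le_mul_of_nonneg_right hΛ1 (sq_nonneg D)
  set Q := Λ ^ 2 * D ^ 2 with hQ
  have hQ0 : 0 ≤ Q := by positivity
  have k1 : ℓ ^ 2 * Y' ^ 2 ≤ deltaY L μ ηy T * (2 * P + 2 * Q) := by
    have h3 := mul_le_mul_of_nonneg_left (i1.trans (mul_le_mul_of_nonneg_left j1 hδ0)) (sq_nonneg ℓ)
    refine h3.trans ?_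
    rw [mul_left_comm]
    refine mul_le_mul_of_nonneg_left ?_ hδ0
    linarith
  have k1' : ℓ ^ 2 * Y' ^ 2 ≤ 2 * P + 2 * Q :=
    k1.trans (mul_le_of_le_one_left (by linarith) hδ1)
  -- Inserting `j2` and the crude bound `k1'` into `j3` gives at most `18 P + 20 Q`. The 80 in the
  -- statement is 4 from the conjugate gradient rate times this 20.
  have k2 : L ^ 2 * V' ^ 2 ≤ 4 * (κ * deltaK L μ N) * (20 * (P + Q)) := by
    have h3 := mul_le_mul_of_nonneg_left i2 (sq_nonneg L)
    refine h3.trans ?_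
    rw [show L ^ 2 * (4 * κ * deltaK L μ N *
      l2 (fun i => linSol (f i) (g i) (x' i) (y' i) - v i) ^ 2) = 4 * (κ * deltaK L μ N) *
      (L ^ 2 * l2 (fun i => linSol (f i) (g i) (x' i) (y' i) - v i) ^ 2) by ring]
    refine mul_le_mul_of_nonneg_left (j3.trans ?_) (by linarith)
    have h4 := mul_le_mul_of_nonneg_left j2 (sq_nonneg ℓ)
    linarith
  linarith

end Hom

end DBOGT

namespace DBOGT

/-! ### Convergence in the homogeneous branch. -/

section Hom

open Finset

variable {n p q : ℕ} {L Lf0 Lg2 μ : ℝ} {f g : Fin n → Vec p → Vec q → ℝ}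

lemma hom_trackingRun (f g : Fin n → Vec p → Vec q → ℝ) (W : Matrix (Fin n) (Fin n) ℝ)
    (ηx ηy : ℝ) (T N : ℕ) (y₀ v₀ : Fin n → Vec q) :
    TrackingRun W ηx (fun k => (hom f g W ηx ηy T N y₀ v₀ k).x)
      (fun k => (hom f g W ηx ηy T N y₀ v₀ k).u) fun k => (hom f g W ηx ηy T N y₀ v₀ k).h :=
  ⟨rfl, rfl, fun _ => rfl, fun _ => rfl⟩

/-- The step size condition of the outer loop. -/
lemma step_condition {n : ℕ} (hn : 0 < n) {ρ η Λ : ℝ} (hη : 0 < η) (hΛ : 0 < Λ)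
    (h : η < (1 - ρ) ^ 2 / (4 * √(2 * n) * Λ)) : 32 * n * (η * Λ) ^ 2 ≤ (1 - ρ) ^ 4 := by
  have hn0 : (0 : ℝ) < n := by exact_mod_cast hn
  have hs : 0 < √(2 * (n : ℝ)) := Real.sqrt_pos.2 (by positivity)
  rw [lt_div_iff₀ (by positivity)] at h
  have h2 := pow_le_pow_left₀ (by positivity) h.le 2
  have h3 : √(2 * (n : ℝ)) ^ 2 = 2 * n := Real.sq_sqrt (by positivity)
  have e : (η * (4 * √(2 * n) * Λ)) ^ 2 = 16 * √(2 * (n : ℝ)) ^ 2 * (η * Λ) ^ 2 := by ring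
  rw [e, h3] at h2
  linarith

lemma LPhi_pos (hμ0 : 0 < μ) (hμL : μ ≤ L) (h0 : 0 ≤ Lf0) (h2 : 0 ≤ Lg2) :
    0 < LPhi L Lf0 Lg2 μ := by
  have hL : 0 < L := hμ0.trans_le hμL
  rw [LPhi]; positivity

/-- The first run of the solvers already pays for the powers of `κ`: `Lf²` is of order `κ⁴`,
compensated by `deltaY`, and the factor `κ` of the conjugate gradient rate is compensated by
`deltaK`. -/
lemma homErr_zero_le {ηy : ℝ} (hμ0 : 0 < μ) (hμL : μ ≤ L) (h0 : 0 ≤ Lf0) (h2 : 0 ≤ Lg2)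
    (hf : ∀ i, UpperReg L Lf0 (f i)) (hg : ∀ i, LowerReg L Lg2 μ (g i)) (hη : 0 < ηy)
    (hη' : ηy ≤ 2 / (μ + L)) (T N : ℕ) (hT : (L / μ) ^ 5 * deltaY L μ ηy T ≤ 1)
    (hN : L / μ * deltaK L μ N ≤ 1) (y₀ v₀ : Fin n → Vec q) :
    homErr L Lf0 Lg2 μ f g 0 (homInner g ηy T 0 y₀) (homCG f g N 0 (homInner g ηy T 0 y₀) v₀) ≤
      9 * (2 * (L + Lf0 * Lg2 / L)) ^ 2 * homC1 g y₀ + 8 * L ^ 2 * homC2 f g v₀ := by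
  have hL : 0 < L := hμ0.trans_le hμL
  have hκ : 1 ≤ L / μ := (one_le_div hμ0).2 hμL
  have hδ := deltaY_nonneg_le_one hμ0 hμL hη hη'
  have hδ0 : 0 ≤ deltaY L μ ηy T := pow_nonneg hδ.1 T
  have hLf := Lf_pos hμ0 hμL h0 h2
  have hA := pow_le_pow_left₀ hLf.le (Lf_le hμ0 hμL h0 h2) 2
  have hK : 0 ≤ L / μ * deltaK L μ N := mul_nonneg (by linarith) (deltaK_nonneg L μ N)
  set A := 2 * (L + Lf0 * Lg2 / L)
  set κ := L / μ
  set ℓ := Lf L Lf0 Lg2 μ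
  set y := homInner g ηy T 0 y₀ with hy
  set v := homCG f g N 0 y v₀ with hv
  have i1 := l2_homInner_sq_le hμ0 hμL hg hη hη' T 0 y₀
  have i2 := l2_homCG_sq_le (f := f) hμ0 hμL hg N 0 y v₀
  rw [← hy] at i1
  rw [← hv] at i2
  have c1 : l2 (fun i => y₀ i - argmin (g i ((0 : Fin n → Vec p) i))) ^ 2 = homC1 g y₀ := l2_sq _
  have c2 : l2 (fun i => linSol (f i) (g i) 0 (argmin (g i 0)) - v₀ i) ^ 2 = homC2 f g v₀ := l2_sq _
  have hC1 : 0 ≤ homC1 g y₀ := by rw [← c1]; positivity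
  rw [c1] at i1
  set Y := l2 (fun i => y i - argmin (g i ((0 : Fin n → Vec p) i))) with hY
  have k1 : ℓ ^ 2 * Y ^ 2 ≤ A ^ 2 * homC1 g y₀ := by
    have hδκ : κ ^ 4 * deltaY L μ ηy T ≤ 1 := le_trans (mul_le_mul_of_nonneg_right
      (pow_le_pow_right₀ hκ (by norm_num)) hδ0) hT
    calc _ ≤ (A * κ ^ 2) ^ 2 * (deltaY L μ ηy T * homC1 g y₀) :=
          mul_le_mul hA i1 (sq_nonneg _) (sq_nonneg _)
      _ = (κ ^ 4 * deltaY L μ ηy T) * (A ^ 2 * homC1 g y₀) := by ring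
      _ ≤ _ := mul_le_of_le_one_left (by positivity) hδκ
  have j3 : L ^ 2 * l2 (fun i => linSol (f i) (g i) ((0 : Fin n → Vec p) i) (y i) - v₀ i) ^ 2 ≤
      2 * (L ^ 2 * homC2 f g v₀) + 2 * (ℓ ^ 2 * Y ^ 2) := by
    have h3 := l2_linSol_sub_sq_le hμ0 hμL h0 h2 hf hg 0 0 y
      (fun i => argmin (g i ((0 : Fin n → Vec p) i)))
    have e : (fun i => linSol (f i) (g i) ((0 : Fin n → Vec p) i) (y i) - v₀ i) =
        (fun i => linSol (f i) (g i) 0 (argmin (g i 0)) - v₀ i) +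
        fun i => linSol (f i) (g i) ((0 : Fin n → Vec p) i) (y i) -
          linSol (f i) (g i) ((0 : Fin n → Vec p) i) (argmin (g i ((0 : Fin n → Vec p) i))) := by
      ext1 i; simp
    have h4 := mul_le_mul_of_nonneg_left (l2_sq_add_le
      (fun i => linSol (f i) (g i) 0 (argmin (g i 0)) - v₀ i)
      (fun i => linSol (f i) (g i) ((0 : Fin n → Vec p) i) (y i) -
        linSol (f i) (g i) ((0 : Fin n → Vec p) i) (argmin (g i ((0 : Fin n → Vec p) i)))))
      (sq_nonneg L)
    have z0 : l2 ((0 : Fin n → Vec p) - 0) = 0 := by simp [l2]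
    have eY : l2 (y - fun i => argmin (g i ((0 : Fin n → Vec p) i))) = Y := rfl
    rw [z0, eY] at h3
    rw [c2] at h4
    rw [e]
    linarith
  have hJ : 0 ≤ L ^ 2 * l2 (fun i => linSol (f i) (g i) ((0 : Fin n → Vec p) i) (y i) - v₀ i) ^ 2 := by
    positivity
  have k2 : L ^ 2 * l2 (fun i => linSol (f i) (g i) ((0 : Fin n → Vec p) i) (y i) - v i) ^ 2 ≤
      4 * (2 * (L ^ 2 * homC2 f g v₀) + 2 * (ℓ ^ 2 * Y ^ 2)) := by
    have h3 := mul_le_mul_of_nonneg_left i2 (sq_nonneg L)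
    refine h3.trans (le_trans (b := 4 * (κ * deltaK L μ N *
      (L ^ 2 * l2 (fun i => linSol (f i) (g i) ((0 : Fin n → Vec p) i) (y i) - v₀ i) ^ 2))) ?_ ?_)
    · exact le_of_eq (by ring)
    · refine mul_le_mul_of_nonneg_left ?_ (by norm_num)
      exact (mul_le_of_le_one_left hJ hN).trans j3
  have hP : homErr L Lf0 Lg2 μ f g 0 y v = ℓ ^ 2 * Y ^ 2 +
    L ^ 2 * l2 (fun i => linSol (f i) (g i) ((0 : Fin n → Vec p) i) (y i) - v i) ^ 2 := rfl
  rw [hP]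
  linarith

/-- Convergence when the lower level functions coincide. -/
theorem hom_convergence (hL : 0 < L) (h0 : 0 ≤ Lf0) (h2 : 0 ≤ Lg2) {ηx ηy : ℝ} {T N : ℕ}
    {W : Matrix (Fin n) (Fin n) ℝ} {hW : W.IsHermitian} (y₀ v₀ : Fin n → Vec q) (hn : 0 < n)
    (hμ0 : 0 < μ) (hμL : μ ≤ L) (hR : Regular L Lf0 Lg2 μ f g)
    (hWd : W ∈ doublyStochastic ℝ (Fin n)) (hρ : rho W hW < 1) (hgg : ∀ i j, g i = g j)
    (hb : BddBelow (Set.range (Phi f g))) (hηx : 0 < ηx)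
    (hηx' : ηx < (1 - rho W hW) ^ 2 / (4 * √(2 * n) * LPhi L Lf0 Lg2 μ))
    (hηy : 0 < ηy) (hηy' : ηy ≤ 2 / (μ + L)) (hT : 5248 * (L / μ) ^ 5 * deltaY L μ ηy T ≤ 1)
    (hN : 5248 * (L / μ) ^ 4 * deltaK L μ N ≤ 1) (K : ℕ) :
    1 / ((K : ℝ) + 1) * ∑ k ∈ range (K + 1),
        ‖gradient (Phi f g) (avg (hom f g W ηx ηy T N y₀ v₀ k).x)‖ ^ 2
      ≤ 4 / (ηx * (K + 1)) *
          (Phi f g (avg (hom f g W ηx ηy T N y₀ v₀ 0).x) - ⨅ x, Phi f g x)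
        + (99 * (2 * (L + Lf0 * Lg2 / L)) ^ 2 + 88 * L ^ 2 + 1) * (homC1 g y₀ + homC2 f g v₀
            + specNorm (hom f g W ηx ηy T N y₀ v₀ 0).h ^ 2) / (K + 1) := by
  have hf := fun i => hR.upper i
  have hg := fun i => hR.lower i
  have hκ : 1 ≤ L / μ := (one_le_div hμ0).2 hμL
  have hδ := deltaY_nonneg_le_one hμ0 hμL hηy hηy'
  have hδ0 : 0 ≤ deltaY L μ ηy T := pow_nonneg hδ.1 T
  have hK0 := deltaK_nonneg L μ N
  have hn1 : (1 : ℝ) ≤ n := by exact_mod_cast hn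
  have hn0 : (0 : ℝ) < n := by linarith
  have hΛ := LPhi_pos hμ0 hμL h0 h2
  have hδ5 : (L / μ) ^ 5 * deltaY L μ ηy T ≤ 1 / 5248 := by linarith
  have hδ1 : deltaY L μ ηy T ≤ 1 / 5248 :=
    (le_mul_of_one_le_left hδ0 (one_le_pow₀ hκ)).trans hδ5
  have hK1 : L / μ * deltaK L μ N ≤ 1 / 5248 := by
    have h3 : L / μ * deltaK L μ N ≤ (L / μ) ^ 4 * deltaK L μ N :=
      mul_le_mul_of_nonneg_right (le_self_pow₀ hκ (by norm_num)) hK0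
    linarith
  set S := hom f g W ηx ηy T N y₀ v₀ with hS
  have hrun : TrackingRun W ηx (fun k => (S k).x) (fun k => (S k).u) fun k => (S k).h :=
    hom_trackingRun f g W ηx ηy T N y₀ v₀
  obtain ⟨m1, m2⟩ := hrun.sum_norm_gradient_le (hW := hW) hn hWd hρ hηx
    (step_condition hn hηx hΛ hηx') (Φ := Phi f g) (F := homExact f g)
    (l2_homExact_sub_le hμ0 hμL h0 h2 hf hg)
    (fun z => by rw [homExact_const hn hgg]; exact hasGradientAt_Phi hn hμ0 hμL hf hg z) hb K
  set P : ℕ → ℝ := fun k => homErr L Lf0 Lg2 μ f g (S k).x (S k).y (S k).v with hP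
  have hP0 : ∀ k, 0 ≤ P k := fun k => homErr_nonneg _ _ _
  have hE : ∀ k, l2 ((S k).h - homExact f g (S k).x) ^ 2 ≤ 2 * P k := fun k => by
    have hh : (S k).h = homHyper f g (S k).x (S k).y (S k).v := by
      cases k <;> rfl
    rw [hh]
    exact l2_homHyper_sub_sq_le hμ0 hμL h0 h2 hf hg _ _ _
  -- The constant `5248 = 64 * 82` makes the contraction factor `(2 + 80) / 5248 = 1 / 64`.
  have hPs : ∀ k, P (k + 1) ≤ 1 / 64 * (P k + LPhi L Lf0 Lg2 μ ^ 2 *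
      l2 ((S (k + 1)).x - (S k).x) ^ 2) := fun k => by
    refine (homErr_succ_le hμ0 hμL h0 h2 hf hg hηy hηy' T N (S k).x (S (k + 1)).x (S k).y
      (S k).v).trans ?_
    refine mul_le_mul_of_nonneg_right (by linarith) (add_nonneg (hP0 k) (by positivity))
  have hPz : P 0 ≤ 9 * (2 * (L + Lf0 * Lg2 / L)) ^ 2 * homC1 g y₀ + 8 * L ^ 2 * homC2 f g v₀ :=
    homErr_zero_le hμ0 hμL h0 h2 hf hg hηy hηy' T N (by linarith) (by linarith) y₀ v₀
  have s1 := Finset.sum_le_sum fun k (_ : k ∈ range (K + 1)) => hE k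
  have s2 := Finset.sum_le_sum fun k (_ : k ∈ range K) => hPs k
  rw [← Finset.mul_sum] at s1
  rw [← Finset.mul_sum, Finset.sum_add_distrib, ← Finset.mul_sum] at s2
  have s3 : ∑ k ∈ range K, P k ≤ ∑ k ∈ range (K + 1), P k :=
    Finset.sum_le_sum_of_subset_of_nonneg (range_mono (by omega)) fun k _ _ => hP0 k
  have s4 := Finset.sum_range_succ' P K
  have hT0 : l2 (dev (S 0).h) ^ 2 ≤ n * specNorm (S 0).h ^ 2 :=
    (pow_le_pow_left₀ (l2_nonneg _) (l2_dev_le hn _) 2).trans (l2_sq_le_specNorm _)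
  have pX : 0 ≤ LPhi L Lf0 Lg2 μ ^ 2 * ∑ k ∈ range K, l2 ((S (k + 1)).x - (S k).x) ^ 2 :=
    mul_nonneg (sq_nonneg _) (Finset.sum_nonneg fun _ _ => sq_nonneg _)
  have pM : 0 ≤ ∑ k ∈ range (K + 1), ‖avg (S k).h‖ ^ 2 := Finset.sum_nonneg fun _ _ => sq_nonneg _
  have hXn := le_mul_of_one_le_left pX hn1
  have hgap : 0 ≤ Phi f g (avg (S 0).x) - ⨅ x, Phi f g x := sub_nonneg.2 (ciInf_le hb _)
  have c1 : 0 ≤ homC1 g y₀ := Finset.sum_nonneg fun _ _ => sq_nonneg _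
  have c2 : 0 ≤ homC2 f g v₀ := Finset.sum_nonneg fun _ _ => sq_nonneg _
  have hpz := hP0 0
  set X := LPhi L Lf0 Lg2 μ ^ 2 * ∑ k ∈ range K, l2 ((S (k + 1)).x - (S k).x) ^ 2
  set M := ∑ k ∈ range (K + 1), ‖avg (S k).h‖ ^ 2
  set SE := ∑ k ∈ range (K + 1), l2 ((S k).h - homExact f g (S k).x) ^ 2
  set SN := ∑ k ∈ range (K + 1), ‖gradient (Phi f g) (avg (S k).x)‖ ^ 2
  set SP := ∑ k ∈ range (K + 1), P k
  set gap := Phi f g (avg (S 0).x) - ⨅ x, Phi f g x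
  set T0 := l2 (dev (S 0).h) ^ 2
  set sp := specNorm (S 0).h ^ 2 with hsp
  have psp : 0 ≤ sp := sq_nonneg _
  set A2 := (2 * (L + Lf0 * Lg2 / L)) ^ 2 with hA2
  have pA2 : 0 ≤ A2 := sq_nonneg _
  have hPn : P 0 ≤ P 0 * n := le_mul_of_one_le_right hpz hn1
  -- Two bounds feed each other: `SE ≤ 2 SP`, where `SP` is at most `P 0 + (SP + X) / 64`, and `X`
  -- is at most `T0 + 7 SE + n M / 12`. The factor `1 / 64` lets `SP` be absorbed, and the remaining
  -- multiple of `M` is cancelled by the half kept on the left.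
  have key : (4 * SE + T0 / 6) / n ≤ 11 * P 0 + sp + M / 2 := by
    rw [div_le_iff₀ hn0]
    have pMn : 0 ≤ n * M := by positivity
    have pspn : 0 ≤ n * sp := by positivity
    linarith
  -- `99 = 11 * 9` and `88 = 11 * 8`, with `9` and `8` from the bound on `P 0`.
  have hSN : SN ≤ 2 / ηx * gap + (99 * A2 + 88 * L ^ 2 + 1) * (homC1 g y₀ + homC2 f g v₀ + sp) := by
    have e1 : 0 ≤ A2 * homC2 f g v₀ := by positivity
    have e2 : 0 ≤ A2 * sp := by positivity
    have e3 : 0 ≤ L ^ 2 * homC1 g y₀ := by positivity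
    have e4 : 0 ≤ L ^ 2 * sp := by positivity
    linarith
  have hKp : (0 : ℝ) < (K : ℝ) + 1 := by positivity
  have e5 : 2 / ηx * gap ≤ 4 / ηx * gap := by gcongr; norm_num
  calc 1 / ((K : ℝ) + 1) * SN ≤ 1 / ((K : ℝ) + 1) * (4 / ηx * gap +
        (99 * A2 + 88 * L ^ 2 + 1) * (homC1 g y₀ + homC2 f g v₀ + sp)) :=
        mul_le_mul_of_nonneg_left (hSN.trans (by linarith)) (by positivity)
    _ = _ := by field_simp

end Hom

end DBOGT

namespace DBOGT

/-! ### Gradient tracking for strongly monotone operators -/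

section InnerTracking

/-- Weight of the consensus error in `trackErr`. -/
noncomputable def devWeight (L μ ρ : ℝ) : ℝ := 2 * μ / (L * (1 - ρ))

/-- Weight of the tracking error in `trackErr`. -/
noncomputable def trackWeight (L μ : ℝ) : ℝ := μ / (4 * L ^ 2)

/-- The largest step size for which gradient tracking is shown to contract. -/
noncomputable def trackStep (L μ ρ : ℝ) : ℝ := μ * (1 - ρ) ^ 2 / (18 * L ^ 2)

/-- The contraction factor of gradient tracking with step size `γ`. -/
noncomputable def trackRate (μ ρ γ : ℝ) : ℝ := max (1 - γ * μ / 4) ((1 + ρ) / 2)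

/-- Lyapunov function of gradient tracking: weighted sum of the errors of mean, consensus and
trackers. -/
noncomputable def trackErr {n d : ℕ} (L μ ρ : ℝ) (w : Vec d)
    (zs : (Fin n → Vec d) × (Fin n → Vec d)) : ℝ :=
  √n * ‖avg zs.1 - w‖ + devWeight L μ ρ * l2 (dev zs.1) + trackWeight L μ * l2 (dev zs.2)

variable {n d : ℕ} {L μ γ : ℝ} {W : Matrix (Fin n) (Fin n) ℝ} {hW : W.IsHermitian}
  {G : Fin n → Vec d → Vec d} {w : Vec d} {zs : (Fin n → Vec d) × (Fin n → Vec d)}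

lemma devWeight_pos {ρ : ℝ} (hμ0 : 0 < μ) (hμL : μ ≤ L) (hρ : ρ < 1) : 0 < devWeight L μ ρ := by
  have hL : 0 < L := hμ0.trans_le hμL
  have : 0 < 1 - ρ := by linarith
  rw [devWeight]; positivity

lemma trackWeight_pos (hμ0 : 0 < μ) (hμL : μ ≤ L) : 0 < trackWeight L μ := by
  have hL : 0 < L := hμ0.trans_le hμL
  rw [trackWeight]; positivity

lemma trackStep_pos {ρ : ℝ} (hμ0 : 0 < μ) (hμL : μ ≤ L) (hρ : ρ < 1) : 0 < trackStep L μ ρ := by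
  have hL : 0 < L := hμ0.trans_le hμL
  have : 0 < 1 - ρ := by linarith
  rw [trackStep]; positivity

lemma trackRate_pos {ρ : ℝ} (h0 : 0 ≤ ρ) : 0 < trackRate μ ρ γ :=
  lt_max_of_lt_right (by linarith)

lemma trackRate_lt_one {ρ : ℝ} (hμ0 : 0 < μ) (hγ : 0 < γ) (hρ : ρ < 1) : trackRate μ ρ γ < 1 :=
  max_lt (by linarith [mul_pos hγ hμ0]) (by linarith)

lemma trackErr_nonneg (hμ0 : 0 < μ) (hμL : μ ≤ L) {ρ : ℝ} (hρ : ρ < 1) :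
    0 ≤ trackErr L μ ρ w zs := by
  have h1 := devWeight_pos hμ0 hμL hρ
  have h2 := trackWeight_pos hμ0 hμL
  have h3 := l2_nonneg (dev zs.1)
  have h4 := l2_nonneg (dev zs.2)
  rw [trackErr]; positivity

lemma l2_sub_le_trackErr (hμ0 : 0 < μ) (hμL : μ ≤ L) {ρ : ℝ} (hρ : ρ < 1) :
    l2 (fun i => zs.1 i - w) ≤ (1 + 1 / devWeight L μ ρ) * trackErr L μ ρ w zs := by
  have h1 := devWeight_pos hμ0 hμL hρ
  have h2 := trackWeight_pos hμ0 hμL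
  have h3 := l2_nonneg (dev zs.1)
  have h4 := l2_nonneg (dev zs.2)
  have h5 : 0 ≤ √n * ‖avg zs.1 - w‖ := by positivity
  refine (l2_sub_const_le _ _).trans ?_
  rw [trackErr]
  set β := devWeight L μ ρ
  have e : (1 + 1 / β) * (√n * ‖avg zs.1 - w‖ + β * l2 (dev zs.1) +
      trackWeight L μ * l2 (dev zs.2)) = l2 (dev zs.1) + √n * ‖avg zs.1 - w‖ +
      (1 / β * (√n * ‖avg zs.1 - w‖) + β * l2 (dev zs.1) +
        (1 + 1 / β) * (trackWeight L μ * l2 (dev zs.2))) := by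
    field_simp; ring
  rw [e]
  exact le_add_of_nonneg_right (by positivity)

/-- The same invariant as in the outer loop. It survives for whatever tracker start has the correct
mean, so both ways of starting the inner trackers are covered. -/
lemma avg_gtStep_snd (hWd : W ∈ doublyStochastic ℝ (Fin n))
    (h : avg zs.2 = avg fun i => G i (zs.1 i)) :
    avg (gtStep W γ G zs).2 = avg fun i => G i ((gtStep W γ G zs).1 i) := by
  have e : (gtStep W γ G zs).2 =
      mix W zs.2 + (fun i => G i ((gtStep W γ G zs).1 i)) - fun i => G i (zs.1 i) := rfl
  rw [e, avg_sub, avg_add, avg_mix hWd, h]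
  abel

/-- The scalar part of the contraction estimate. -/
lemma track_weights_le {ρ a b c a' b' c' : ℝ} (hμ0 : 0 < μ) (hμL : μ ≤ L) (h0 : 0 ≤ ρ) (hρ : ρ < 1)
    (hγ : 0 < γ) (hγ' : γ ≤ trackStep L μ ρ) (ha : 0 ≤ a) (hb : 0 ≤ b) (hc : 0 ≤ c)
    (h1 : a' ≤ (1 - γ * μ / 2) * a + γ * (L * b)) (h2 : b' ≤ ρ * b + γ * c)
    (h3 : c' ≤ ρ * c + L * (2 * b + γ * (c + L * (b + a)))) :
    a' + devWeight L μ ρ * b' + trackWeight L μ * c' ≤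
      trackRate μ ρ γ * (a + devWeight L μ ρ * b + trackWeight L μ * c) := by
  have hL : 0 < L := hμ0.trans_le hμL
  have hq : 0 < 1 - ρ := by linarith
  have hβ := devWeight_pos hμ0 hμL hρ
  have hτ := trackWeight_pos hμ0 hμL
  -- The weights balance the cross terms: the mean error enters the trackers with `τL²γ = γμ/4`,
  -- half of its own slack, and the consensus error enters them with `2τL = β(1 - ρ)/4`, a quarter
  -- of its slack.
  have eτ : trackWeight L μ * L ^ 2 = μ / 4 := by rw [trackWeight]; field_simp
  have eβ : devWeight L μ ρ * (1 - ρ) = 8 * (L * trackWeight L μ) := by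
    rw [trackWeight, devWeight]; field_simp; ring
  have eβ' : devWeight L μ ρ * (1 - ρ) * L = 2 * μ := by
    rw [devWeight]; field_simp
  have g1 : γ * L ^ 2 * 18 ≤ μ * (1 - ρ) ^ 2 := by
    have := (le_div_iff₀ (by positivity)).1 hγ'
    linarith
  have hq2 : (1 - ρ) ^ 2 ≤ 1 := pow_le_one₀ hq.le (by linarith)
  set β := devWeight L μ ρ
  set τ := trackWeight L μ
  have ra : 1 - γ * μ / 4 ≤ trackRate μ ρ γ := le_max_left _ _
  have rb : (1 + ρ) / 2 ≤ trackRate μ ρ γ := le_max_right _ _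
  -- `s1` and `s2` are where the step size bound acts: the remaining cross terms carry a factor `γ`
  -- and fit into what is left of the slack of the consensus and tracking errors.
  have s1 : γ * (L + τ * L ^ 2) ≤ β * (1 - ρ) / 4 := by
    rw [eτ]
    refine le_of_mul_le_mul_right ?_ hL
    have : γ * μ * L ≤ γ * L * L := by gcongr
    nlinarith
  have s2 : γ * (β + τ * L) ≤ τ * ((1 - ρ) / 2) := by
    refine le_of_mul_le_mul_right ?_ hq
    have e : γ * (β + τ * L) * (1 - ρ) = τ * (γ * L * (8 + (1 - ρ))) := by linear_combination γ * eβ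
    rw [e, mul_assoc τ]
    refine mul_le_mul_of_nonneg_left ?_ hτ.le
    have s3 : γ * L * 18 ≤ (1 - ρ) ^ 2 := by
      refine le_of_mul_le_mul_right ?_ hL
      have : μ * (1 - ρ) ^ 2 ≤ L * (1 - ρ) ^ 2 := by gcongr
      linarith
    have : 0 ≤ γ * L := by positivity
    nlinarith
  have k2 := mul_le_mul_of_nonneg_left h2 hβ.le
  have k3 := mul_le_mul_of_nonneg_left h3 hτ.le
  have m1 := mul_le_mul_of_nonneg_right ra ha
  have m2 := mul_le_mul_of_nonneg_right rb (mul_nonneg hβ.le hb)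
  have m3 := mul_le_mul_of_nonneg_right rb (mul_nonneg hτ.le hc)
  have n1 := mul_le_mul_of_nonneg_right s1 hb
  have n2 := mul_le_mul_of_nonneg_right s2 hc
  have e1 : τ * L ^ 2 * γ * a = μ / 4 * γ * a := by rw [eτ]
  have e2 : β * (1 - ρ) * b = 8 * (L * τ) * b := by rw [eβ]
  linarith

/-- Three coupled recursions. The mean makes a gradient step for the averaged operator, perturbed by
the consensus error. The consensus error contracts by `ρ` and is driven by the trackers' deviation.
That deviation contracts by `ρ` and is driven by the movement of the iterates. -/
lemma trackErr_gtStep_le (hn : 0 < n) (hμ0 : 0 < μ) (hμL : μ ≤ L)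
    (hWd : W ∈ doublyStochastic ℝ (Fin n)) (hρ : rho W hW < 1) (hγ : 0 < γ)
    (hγ' : γ ≤ trackStep L μ (rho W hW)) (hL : ∀ i, Lip L (G i))
    (hμ : ∀ i, StronglyMonotone μ (G i)) (hw : avg (fun i => G i w) = 0)
    (h : avg zs.2 = avg fun i => G i (zs.1 i)) :
    trackErr L μ (rho W hW) w (gtStep W γ G zs) ≤
      trackRate μ (rho W hW) γ * trackErr L μ (rho W hW) w zs := by
  have hL0 : 0 < L := hμ0.trans_le hμL
  have hn' : (0 : ℝ) < n := by exact_mod_cast hn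
  have h0 := rho_nonneg W hW
  have hq2 : (1 - rho W hW) ^ 2 ≤ 1 := pow_le_one₀ (by linarith) (by linarith)
  have g1 : γ * L ^ 2 * 18 ≤ μ := by
    have h1 := (le_div_iff₀ (by positivity)).1 hγ'
    have h2 : μ * (1 - rho W hW) ^ 2 ≤ μ := mul_le_of_le_one_right hμ0.le hq2
    linarith
  have g2 : γ * L ^ 2 ≤ μ := by nlinarith [sq_nonneg L]
  have g3 : γ * μ ≤ 2 := by
    refine le_of_mul_le_mul_right ?_ hL0
    have : γ * μ * L ≤ γ * L * L := by gcongr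
    nlinarith
  obtain ⟨z, s⟩ := zs
  simp only at h
  set z' := (gtStep W γ G (z, s)).1 with hz'
  have ez' : z' = mix W z - γ • s := rfl
  have es' : (gtStep W γ G (z, s)).2 = mix W s + ((fun i => G i (z' i)) - fun i => G i (z i)) := by
    ext1 i
    simp only [Pi.add_apply, Pi.sub_apply]
    rw [← add_sub_assoc]
    rfl
  have hGw : ∀ v : Vec d, avg (fun i => G i (z i)) - avg (fun i => G i v) =
      avg fun i => G i (z i) - G i v := fun v => by rw [avg_sub_avg]; rfl
  have hl : ∀ v : Vec d, √n * ‖avg fun i => G i (z i) - G i v‖ ≤ L * l2 (fun i => z i - v) :=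
    fun v => (sqrt_mul_norm_avg_le hn _).trans
      (l2_le_of_forall_le hL0.le fun i => hL i _ _)
  refine track_weights_le hμ0 hμL h0 hρ hγ hγ' (by positivity) (l2_nonneg _) (l2_nonneg _) ?_ ?_ ?_
  · have e : avg z' - w = ((avg z - γ • avg (fun i => G i (avg z))) -
        (w - γ • avg fun i => G i w)) - γ • avg fun i => G i (z i) - G i (avg z) := by
      rw [ez', avg_sub, avg_smul, avg_mix hWd, h, ← hGw, hw, smul_sub, smul_zero]
      abel
    have h1 := norm_step_sub_step_le (stronglyMonotone_avg hn hμ) (lip_avg hn hL) hγ.le g2 g3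
      (avg z) w
    have h2 := hl (avg z)
    change √n * ‖avg z' - w‖ ≤ _
    rw [e]
    calc _ ≤ √n * ((1 - γ * μ / 2) * ‖avg z - w‖ +
          γ * ‖avg fun i => G i (z i) - G i (avg z)‖) := by
          refine mul_le_mul_of_nonneg_left ((norm_sub_le _ _).trans (add_le_add h1 ?_))
            (Real.sqrt_nonneg _)
          rw [norm_smul, Real.norm_of_nonneg hγ.le]
      _ = (1 - γ * μ / 2) * (√n * ‖avg z - w‖) +
          γ * (√n * ‖avg fun i => G i (z i) - G i (avg z)‖) := by ring
      _ ≤ _ := add_le_add le_rfl (mul_le_mul_of_nonneg_left h2 hγ.le)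
  · change l2 (dev z') ≤ _
    rw [ez', dev_sub, dev_smul]
    refine (l2_sub_le _ _).trans (add_le_add (l2_dev_mix_le hW hWd hρ _) ?_)
    rw [l2_smul, abs_of_nonneg hγ.le]
  · rw [es', dev_add]
    refine (l2_add_le _ _).trans (add_le_add (l2_dev_mix_le hW hWd hρ _)
      ((l2_dev_le hn _).trans ((l2_le_of_forall_le hL0.le fun i => hL i _ _).trans
        (mul_le_mul_of_nonneg_left (b := l2 (z' - z)) ?_ hL0.le))))
    have e : z' - z = (mix W z - z) - γ • s := by rw [ez']; abel
    rw [e]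
    refine (l2_sub_le _ _).trans (add_le_add (l2_mix_sub_le hW hWd hρ _) ?_)
    rw [l2_smul, abs_of_nonneg hγ.le]
    refine mul_le_mul_of_nonneg_left ?_ hγ.le
    -- The full tracker is its deviation plus its mean; the mean is the averaged operator at the
    -- iterates, which is small near `w` since the averaged operator vanishes at `w`.
    have h1 := l2_sub_const_le s 0
    simp only [sub_zero] at h1
    refine h1.trans (add_le_add le_rfl ?_)
    have h2 := hl w
    rw [← hGw, hw, sub_zero, ← h] at h2
    exact h2.trans (mul_le_mul_of_nonneg_left (l2_sub_const_le z w) hL0.le)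

/-- Linear convergence of gradient tracking. -/
theorem trackErr_iterate_le (hn : 0 < n) (hμ0 : 0 < μ) (hμL : μ ≤ L)
    (hWd : W ∈ doublyStochastic ℝ (Fin n)) (hρ : rho W hW < 1) (hγ : 0 < γ)
    (hγ' : γ ≤ trackStep L μ (rho W hW)) (hL : ∀ i, Lip L (G i))
    (hμ : ∀ i, StronglyMonotone μ (G i)) (hw : avg (fun i => G i w) = 0)
    (h : avg zs.2 = avg fun i => G i (zs.1 i)) (t : ℕ) :
    trackErr L μ (rho W hW) w ((gtStep W γ G)^[t] zs) ≤
        trackRate μ (rho W hW) γ ^ t * trackErr L μ (rho W hW) w zs ∧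
      avg ((gtStep W γ G)^[t] zs).2 = avg fun i => G i (((gtStep W γ G)^[t] zs).1 i) := by
  induction t with
  | zero => simpa using h
  | succ t ih =>
    rw [Function.iterate_succ_apply']
    refine ⟨(trackErr_gtStep_le hn hμ0 hμL hWd hρ hγ hγ' hL hμ hw ih.2).trans ?_,
      avg_gtStep_snd hWd ih.2⟩
    rw [pow_succ', mul_assoc]
    exact mul_le_mul_of_nonneg_left ih.1 (trackRate_pos (rho_nonneg W hW)).le

lemma trackErr_le (hn : 0 < n) (hμ0 : 0 < μ) (hμL : μ ≤ L) {ρ : ℝ} (hρ : ρ < 1) {a c : ℝ}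
    (ha : l2 (fun i => zs.1 i - w) ≤ a) (hc : l2 zs.2 ≤ c) :
    trackErr L μ ρ w zs ≤ (1 + devWeight L μ ρ) * a + trackWeight L μ * c := by
  have h1 := devWeight_pos hμ0 hμL hρ
  have h2 := trackWeight_pos hμ0 hμL
  have h3 := mul_le_mul_of_nonneg_left ((l2_dev_le_sub hn _ _).trans ha) h1.le
  have h4 := mul_le_mul_of_nonneg_left ((l2_dev_le hn _).trans hc) h2.le
  have h5 := (sqrt_mul_norm_avg_sub_le hn zs.1 w).trans ha
  rw [trackErr]
  linarith

end InnerTracking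

end DBOGT

namespace DBOGT

/-! ### The Jacobian-Hessian-inverse oracle. -/

section JacobianInverse

open ContinuousLinearMap (adjoint)

variable {n p q : ℕ} {L μ γ R : ℝ} {W : Matrix (Fin n) (Fin n) ℝ} {hW : W.IsHermitian}

lemma l2_le_sqrt_mul {d : ℕ} {z : Fin n → Vec d} {c : ℝ} (hc : 0 ≤ c) (h : ∀ i, ‖z i‖ ≤ c) :
    l2 z ≤ √n * c := by
  refine le_of_sq_le_sq ?_ (by positivity)
  rw [l2_sq, mul_pow, Real.sq_sqrt (by positivity)]
  refine (Finset.sum_le_sum fun i _ => pow_le_pow_left₀ (norm_nonneg _) (h i) 2).trans ?_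
  simp

lemma adjoint_avg (J : Fin n → Vec q →L[ℝ] Vec p) :
    adjoint (avg J) = avg fun i => adjoint (J i) := by
  simp [avg, map_sum]

/-- Evaluation at `v` intertwines the operator-valued scheme with a vector-valued one. The Lyapunov
argument uses inner products, which the operator norm lacks, so the oracle is analysed one vector at
a time. -/
lemma jhip_apply (W : Matrix (Fin n) (Fin n) ℝ) (γ : ℝ) (H : Fin n → Vec q →L[ℝ] Vec q)
    (J : Fin n → Vec q →L[ℝ] Vec p) (Z₀ : Fin n → Vec p →L[ℝ] Vec q) (N : ℕ) (v : Vec p) :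
    (fun i => jhip W γ H J Z₀ N i v) = ((gtStep W γ fun i z => H i z - adjoint (J i) v)^[N]
      (fun i => Z₀ i v, fun i => H i (Z₀ i v) - adjoint (J i) v)).1 := by
  have h : Function.Semiconj (fun zs : (Fin n → Vec p →L[ℝ] Vec q) × (Fin n → Vec p →L[ℝ] Vec q) =>
      ((fun i => zs.1 i v, fun i => zs.2 i v) : (Fin n → Vec q) × (Fin n → Vec q)))
      (gtStep W γ fun i Z => (H i).comp Z - adjoint (J i))
      (gtStep W γ fun i z => H i z - adjoint (J i) v) := fun zs => by
    ext1 <;> ext1 i <;> simp [gtStep, mix]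
  exact congrArg Prod.fst ((h.iterate_right N).eq
    (Z₀, fun i => (H i).comp (Z₀ i) - adjoint (J i)))

/-- The constant in the error bound of the oracle `jhip`. -/
noncomputable def jhipConst (L μ ρ : ℝ) (n : ℕ) : ℝ :=
  (1 + 1 / devWeight L μ ρ) * ((1 + devWeight L μ ρ) * (1 + √n * (L / μ)) +
    trackWeight L μ * (L * (1 + √n)))

lemma jhipConst_nonneg {ρ : ℝ} (hμ0 : 0 < μ) (hμL : μ ≤ L) (hρ : ρ < 1) :
    0 ≤ jhipConst L μ ρ n := by
  have hL : 0 < L := hμ0.trans_le hμL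
  have h1 := devWeight_pos hμ0 hμL hρ
  have h2 := trackWeight_pos hμ0 hμL
  rw [jhipConst]; positivity

/-- For fixed `v` the oracle tracks affine operators `z ↦ H i z - J iᵀ v`, whose average vanishes
exactly at the target. The normalization `R ≥ 1` lets all initial data be bounded by multiples of `R
‖v‖`. -/
lemma norm_jhip_apply_sub_le (hn : 0 < n) (hμ0 : 0 < μ) (hμL : μ ≤ L)
    (hWd : W ∈ doublyStochastic ℝ (Fin n)) (hρ : rho W hW < 1) (hγ : 0 < γ)
    (hγ' : γ ≤ trackStep L μ (rho W hW)) {H : Fin n → Vec q →L[ℝ] Vec q}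
    {J : Fin n → Vec q →L[ℝ] Vec p} (hH : ∀ i, ‖H i‖ ≤ L)
    (hc : ∀ i v, μ * ‖v‖ ^ 2 ≤ inner ℝ (H i v) v) (hJ : ∀ i, ‖J i‖ ≤ L)
    {Z₀ : Fin n → Vec p →L[ℝ] Vec q} (hR : 1 ≤ R) (hZ : ∑ i, ‖Z₀ i‖ ^ 2 ≤ R ^ 2) (N : ℕ)
    (v : Vec p) (i : Fin n) :
    ‖jhip W γ H J Z₀ N i v - (avg H).inverse (adjoint (avg J) v)‖ ≤
      jhipConst L μ (rho W hW) n * trackRate μ (rho W hW) γ ^ N * R * ‖v‖ := by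
  have hL : 0 < L := hμ0.trans_le hμL
  have hβ := devWeight_pos hμ0 hμL hρ
  have hτ := trackWeight_pos hμ0 hμL
  have hR0 : 0 ≤ R := by linarith
  have hcavg : ∀ u, μ * ‖u‖ ^ 2 ≤ inner ℝ (avg H u) u := fun u => by
    rw [avg_apply, avg_inner]
    exact le_avg hn fun i => hc i u
  have hJv : ∀ i, ‖adjoint (J i) v‖ ≤ L * ‖v‖ := fun i =>
    ((adjoint (J i)).le_opNorm v).trans (mul_le_mul_of_nonneg_right
      (by rw [LinearIsometryEquiv.norm_map]; exact hJ i) (norm_nonneg _))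
  set w := (avg H).inverse (adjoint (avg J) v) with hw
  have hw1 : ‖w‖ ≤ L / μ * ‖v‖ := by
    refine (norm_inverse_apply_le hμ0 hcavg _).trans ?_
    rw [div_mul_eq_mul_div]
    refine div_le_div_of_nonneg_right ?_ hμ0.le
    rw [adjoint_avg, avg_apply]
    exact norm_avg_le hn hJv
  have hw0 : (avg fun i => H i w - adjoint (J i) v) = 0 := by
    have e1 : (avg fun i => H i w - adjoint (J i) v) =
        (avg fun i => H i w) - avg fun i => adjoint (J i) v := by rw [avg_sub_avg]; rfl
    rw [e1, ← avg_apply, ← avg_apply, ← adjoint_avg, hw,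
      (isInvertible_of_coercive hμ0 hcavg).self_apply_inverse, sub_self]
  have hlip : ∀ i, Lip L fun z => H i z - adjoint (J i) v := fun i z z' => by
    rw [sub_sub_sub_cancel_right, ← map_sub]
    exact (H i).le_of_opNorm_le (hH i) _
  have hmono : ∀ i, StronglyMonotone μ fun z => H i z - adjoint (J i) v := fun i z z' => by
    rw [sub_sub_sub_cancel_right, ← map_sub]
    exact hc i _
  have hZv : l2 (fun i => Z₀ i v) ≤ R * ‖v‖ := by
    refine le_of_sq_le_sq ?_ (by positivity)
    rw [l2_sq, mul_pow]
    refine le_trans ?_ (mul_le_mul_of_nonneg_right hZ (sq_nonneg _))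
    rw [Finset.sum_mul]
    refine Finset.sum_le_sum fun i _ => ?_
    rw [← mul_pow]
    exact pow_le_pow_left₀ (norm_nonneg _) ((Z₀ i).le_opNorm v) 2
  have ha : l2 (fun i => Z₀ i v - w) ≤ (1 + √n * (L / μ)) * (R * ‖v‖) := by
    refine (l2_sub_le (fun i => Z₀ i v) fun _ => w).trans ?_
    rw [l2_const]
    have h1 : √n * ‖w‖ ≤ √n * (L / μ * (R * ‖v‖)) := by
      refine mul_le_mul_of_nonneg_left (hw1.trans ?_) (Real.sqrt_nonneg _)
      exact mul_le_mul_of_nonneg_left (le_mul_of_one_le_left (norm_nonneg _) hR) (by positivity)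
    linarith
  have hs : l2 (fun i => H i (Z₀ i v) - adjoint (J i) v) ≤ L * (1 + √n) * (R * ‖v‖) := by
    refine (l2_sub_le (fun i => H i (Z₀ i v)) fun i => adjoint (J i) v).trans ?_
    have h1 : l2 (fun i => H i (Z₀ i v)) ≤ L * l2 (fun i => Z₀ i v) :=
      l2_le_of_forall_le hL.le fun i => (H i).le_of_opNorm_le (hH i) _
    have h2 := l2_le_sqrt_mul (by positivity) hJv
    have h3 : √n * (L * ‖v‖) ≤ √n * (L * (R * ‖v‖)) :=
      mul_le_mul_of_nonneg_left (mul_le_mul_of_nonneg_left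
        (le_mul_of_one_le_left (norm_nonneg _) hR) hL.le) (Real.sqrt_nonneg _)
    have h4 := mul_le_mul_of_nonneg_left hZv hL.le
    linarith
  have key := (trackErr_iterate_le (zs := (fun i => Z₀ i v, fun i => H i (Z₀ i v) - adjoint (J i) v))
    hn hμ0 hμL hWd hρ hγ hγ' hlip hmono hw0 rfl N).1
  have h5 := trackErr_le (w := w)
    (zs := (fun i => Z₀ i v, fun i => H i (Z₀ i v) - adjoint (J i) v)) hn hμ0 hμL hρ ha hs
  have h6 := l2_sub_le_trackErr (w := w) (zs := ((gtStep W γ fun i z => H i z - adjoint (J i) v)^[N]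
      (fun i => Z₀ i v, fun i => H i (Z₀ i v) - adjoint (J i) v))) hμ0 hμL hρ
  rw [← jhip_apply] at h6
  refine ((norm_le_l2 (fun i => jhip W γ H J Z₀ N i v - w) i).trans h6).trans ?_
  have hα : 0 ≤ trackRate μ (rho W hW) γ ^ N := pow_nonneg (trackRate_pos (rho_nonneg W hW)).le N
  refine (mul_le_mul_of_nonneg_left (key.trans (mul_le_mul_of_nonneg_left h5 hα))
    (by positivity)).trans (le_of_eq ?_)
  rw [jhipConst]
  ring

variable {Lf0 Lg2 : ℝ} {f g : Fin n → Vec p → Vec q → ℝ}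

/-- Duality: pairing the difference `D` with itself moves the adjoint of the oracle's output onto
`D`, leaving `∇_y f`, bounded by `Lf0`, against the oracle error at the single vector `D`. -/
lemma l2_hetHyper_sub_le (hn : 0 < n) (hμ0 : 0 < μ) (hμL : μ ≤ L) (h0 : 0 ≤ Lf0)
    (hf : ∀ i, UpperReg L Lf0 (f i)) (hg : ∀ i, LowerReg L Lg2 μ (g i))
    (hWd : W ∈ doublyStochastic ℝ (Fin n)) (hρ : rho W hW < 1) (hγ : 0 < γ)
    (hγ' : γ ≤ trackStep L μ (rho W hW)) {Z₀ : Fin n → Vec p →L[ℝ] Vec q} (hR : 1 ≤ R)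
    (hZ : ∑ i, ‖Z₀ i‖ ^ 2 ≤ R ^ 2) (N : ℕ) (x : Fin n → Vec p) (y : Fin n → Vec q) :
    l2 (hetHyper f g W γ N Z₀ x y - hyper f g x y) ≤
      √n * (Lf0 * jhipConst L μ (rho W hW) n) * trackRate μ (rho W hW) γ ^ N * R := by
  have hL : 0 ≤ L := hμ0.le.trans hμL
  have hC := jhipConst_nonneg (n := n) hμ0 hμL hρ
  have hα : 0 ≤ trackRate μ (rho W hW) γ ^ N := pow_nonneg (trackRate_pos (rho_nonneg W hW)).le N
  have hR0 : 0 ≤ R := by linarith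
  set C := jhipConst L μ (rho W hW) n * trackRate μ (rho W hW) γ ^ N * R with hCdef
  have hC0 : 0 ≤ C := by positivity
  have e : √n * (Lf0 * jhipConst L μ (rho W hW) n) * trackRate μ (rho W hW) γ ^ N * R =
      √n * (Lf0 * C) := by rw [hCdef]; ring
  rw [e]
  refine l2_le_sqrt_mul (by positivity) fun i => ?_
  set H := fun i => hessY (g i) (x i) (y i) with hH
  set J := fun i => jacXY (g i) (x i) (y i) with hJ
  set b := gradY (f i) (x i) (y i) with hb
  have hsym : ∀ u v, inner ℝ (avg H u) v = inner ℝ u (avg H v) := avg_hessY_symm hg x y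
  have hinv := isInvertible_of_coercive hμ0 (le_inner_avg_hessY hn hg x y)
  have hisym : ∀ u v, inner ℝ ((avg H).inverse u) v = inner ℝ u ((avg H).inverse v) := fun u v => by
    conv_lhs => rw [← hinv.self_apply_inverse v]
    conv_rhs => rw [← hinv.self_apply_inverse u]
    exact (hsym _ _).symm
  have hbound := norm_jhip_apply_sub_le (R := R) hn hμ0 hμL hWd hρ hγ hγ' (H := H) (J := J)
    (fun i => (hg i).norm_hessY_le hL _ _) (fun i => (hg i).le_inner_hessY _ _)
    (fun i => (hg i).norm_jacXY_le hL _ _) hR hZ N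
  have ed : (hetHyper f g W γ N Z₀ x y - hyper f g x y) i =
      avg J ((avg H).inverse b) - adjoint (jhip W γ H J Z₀ N i) b := by
    simp only [Pi.sub_apply, hetHyper, hyper]
    abel
  rw [ed]
  set D := avg J ((avg H).inverse b) - adjoint (jhip W γ H J Z₀ N i) b with hD
  have h1 : ‖D‖ * ‖D‖ = inner ℝ b ((avg H).inverse (adjoint (avg J) D) - jhip W γ H J Z₀ N i D) := by
    have e1 : inner ℝ b ((avg H).inverse (adjoint (avg J) D)) =
        inner ℝ D (avg J ((avg H).inverse b)) := by
      rw [← hisym, ContinuousLinearMap.adjoint_inner_right, real_inner_comm]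
    have e2 : inner ℝ b (jhip W γ H J Z₀ N i D) = inner ℝ D (adjoint (jhip W γ H J Z₀ N i) b) := by
      rw [ContinuousLinearMap.adjoint_inner_right, real_inner_comm]
    rw [inner_sub_right, e1, e2, ← inner_sub_right, real_inner_self_eq_norm_mul_norm]
  have h2 : ‖D‖ * ‖D‖ ≤ Lf0 * C * ‖D‖ := by
    rw [h1, mul_assoc]
    refine (real_inner_le_norm _ _).trans (mul_le_mul ((hf i).norm_gradY_le h0 _ _) ?_
      (norm_nonneg _) h0)
    rw [norm_sub_rev]
    exact hbound D i
  rcases (norm_nonneg D).eq_or_lt with h3 | h3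
  · rw [← h3]; positivity
  · exact le_of_mul_le_mul_right h2 h3

end JacobianInverse

end DBOGT

namespace DBOGT

/-! ### Inner errors in the heterogeneous branch. -/

section Het

open Finset

/-- With `h` bounded, the tracking and consensus errors are geometric sums, each costing a factor `1
/ (1 - ρ)`. No smallness of `η` is needed, so this a priori bound can be used before any error
estimate. -/
lemma TrackingRun.displacement_le {n p : ℕ} {W : Matrix (Fin n) (Fin n) ℝ} {hW : W.IsHermitian}
    {η B : ℝ} {x u h : ℕ → Fin n → Vec p} (hr : TrackingRun W η x u h) (hn : 0 < n)
    (hWd : W ∈ doublyStochastic ℝ (Fin n)) (hρ : rho W hW < 1) (hη : 0 ≤ η)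
    (hB : ∀ k, l2 (h k) ≤ B) (k : ℕ) :
    l2 (x (k + 1) - x k) ≤
      η * (6 / (1 - rho W hW) ^ 2 + 4 / (1 - rho W hW) + 1) * B := by
  have h0 := rho_nonneg W hW
  have hq : 0 < 1 - rho W hW := by linarith
  have hB0 : 0 ≤ B := (l2_nonneg _).trans (hB 0)
  have ht : ∀ k, l2 (dev (u k)) ≤ 2 * B / (1 - rho W hW) := fun k => by
    induction k with
    | zero =>
      rw [hr.u_zero, le_div_iff₀ hq]
      have h1 := (l2_dev_le hn (h 0)).trans (hB 0)
      have h2 := l2_nonneg (dev (h 0))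
      nlinarith
    | succ k ih =>
      have h1 := hr.dev_u_succ_le (hW := hW) hn hWd hρ k
      have h2 : l2 (h (k + 1) - h k) ≤ B + B := (l2_sub_le _ _).trans (add_le_add (hB _) (hB _))
      have h3 := mul_le_mul_of_nonneg_left ih h0
      have e : rho W hW * (2 * B / (1 - rho W hW)) + (B + B) = 2 * B / (1 - rho W hW) := by
        field_simp; ring
      linarith
  have hs : ∀ k, l2 (dev (x k)) ≤ η * (2 * B / (1 - rho W hW)) / (1 - rho W hW) := fun k => by
    induction k with
    | zero => rw [hr.dev_x_zero]; positivity
    | succ k ih =>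
      have h1 := hr.dev_x_succ_le (hW := hW) hWd hρ hη k
      have h2 := mul_le_mul_of_nonneg_left (ht k) hη
      have h3 := mul_le_mul_of_nonneg_left ih h0
      have e : rho W hW * (η * (2 * B / (1 - rho W hW)) / (1 - rho W hW)) +
          η * (2 * B / (1 - rho W hW)) = η * (2 * B / (1 - rho W hW)) / (1 - rho W hW) := by
        field_simp; ring
      linarith
  have hm : n * ‖avg (h k)‖ ^ 2 ≤ B ^ 2 := by
    have h1 := pow_le_pow_left₀ (by positivity) ((sqrt_mul_norm_avg_le hn (h k)).trans (hB k)) 2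
    rwa [mul_pow, Real.sq_sqrt (by positivity)] at h1
  have e : η * (6 / (1 - rho W hW) ^ 2 + 4 / (1 - rho W hW) + 1) * B =
      3 * (η * (2 * B / (1 - rho W hW)) / (1 - rho W hW)) +
        2 * (η * (2 * B / (1 - rho W hW))) + η * B := by
    field_simp; ring
  rw [e]
  have hd := hr.displacement_sq_le (hW := hW) hn hWd hρ hη k
  have h1 := hs k
  have h2 := mul_le_mul_of_nonneg_left (ht k) hη
  have p1 := l2_nonneg (dev (x k))
  have p2 := mul_nonneg hη (l2_nonneg (dev (u k)))
  have p3 := mul_nonneg hη hB0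
  refine le_trans (b := 3 * l2 (dev (x k)) + 2 * (η * l2 (dev (u k))) + η * B)
    (le_of_sq_le_sq (hd.trans ?_) (by positivity)) (by linarith)
  have h3 := mul_le_mul_of_nonneg_left hm (sq_nonneg η)
  nlinarith [mul_nonneg p1 p2, mul_nonneg p1 p3, mul_nonneg p2 p3, sq_nonneg (l2 (dev (x k))),
    sq_nonneg (η * l2 (dev (u k)))]

variable {n p q : ℕ} {L Lf0 Lg2 μ ηx ηy γ R D : ℝ} {W : Matrix (Fin n) (Fin n) ℝ}
  {hW : W.IsHermitian} {f g : Fin n → Vec p → Vec q → ℝ} {x x' : Fin n → Vec p}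
  {y s : Fin n → Vec q}

/-- The growth constant of the inner error when the outer iterates move. -/
noncomputable def warmConst (L μ ρ : ℝ) : ℝ :=
  1 + trackWeight L μ + (1 + trackWeight L μ * L) * (L / μ) +
    trackWeight L μ * L * (1 + 1 / devWeight L μ ρ)

lemma warmConst_pos {ρ : ℝ} (hμ0 : 0 < μ) (hμL : μ ≤ L) (hρ : ρ < 1) : 0 < warmConst L μ ρ := by
  have hL : 0 < L := hμ0.trans_le hμL
  have h1 := devWeight_pos hμ0 hμL hρ
  have h2 := trackWeight_pos hμ0 hμL
  rw [warmConst]; positivity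

/-- How the Lyapunov function reacts when the target moves. The alternatives in `hs` are the two
tracker starts: carried trackers change by the change of the gradients, restarted ones are the
gradients, compared with those at the new target, whose size is `z`. -/
lemma trackErr_lowerSol_le (hn : 0 < n) (hμ0 : 0 < μ) (hμL : μ ≤ L) {ρ : ℝ} (hρ : ρ < 1)
    (hg : ∀ i, LowerReg L Lg2 μ (g i)) {s' : Fin n → Vec q} {z : ℝ} (hz : 0 ≤ z)
    (hs : l2 (dev s') ≤ l2 (dev s) + L * l2 (x' - x) ∨
      l2 s' ≤ z + L * l2 (fun i => y i - lowerSol g x')) :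
    trackErr L μ ρ (lowerSol g x') (y, s') ≤
      warmConst L μ ρ * (trackErr L μ ρ (lowerSol g x) (y, s) + l2 (x' - x) + z) := by
  have hL : 0 < L := hμ0.trans_le hμL
  have hβ := devWeight_pos hμ0 hμL hρ
  have hτ := trackWeight_pos hμ0 hμL
  have hV := trackErr_nonneg (w := lowerSol g x) (zs := (y, s)) hμ0 hμL hρ
  have hD := l2_nonneg (x' - x)
  have hκ : 1 ≤ L / μ := (one_le_div hμ0).2 hμL
  have h1 : √n * ‖avg y - lowerSol g x'‖ ≤
      √n * ‖avg y - lowerSol g x‖ + L / μ * l2 (x' - x) := by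
    have h2 := norm_lowerSol_sub_le hn hμ0 hμL hg x' x
    have h3 := norm_sub_le_norm_sub_add_norm_sub (avg y) (lowerSol g x) (lowerSol g x')
    rw [norm_sub_rev (lowerSol g x)] at h3
    have h4 := mul_le_mul_of_nonneg_left h3 (Real.sqrt_nonneg (n : ℝ))
    linarith
  have hR := l2_sub_le_trackErr (w := lowerSol g x) (zs := (y, s)) hμ0 hμL hρ
  have h5 : l2 (fun i => y i - lowerSol g x') ≤
      (1 + 1 / devWeight L μ ρ) * trackErr L μ ρ (lowerSol g x) (y, s) + L / μ * l2 (x' - x) := by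
    refine (l2_sub_le_add y (fun _ => lowerSol g x) fun _ => lowerSol g x').trans
      (add_le_add hR ?_)
    have e : ((fun _ => lowerSol g x) - fun _ => lowerSol g x' : Fin n → Vec q) =
      fun _ => lowerSol g x - lowerSol g x' := rfl
    rw [e, l2_const, norm_sub_rev]
    exact norm_lowerSol_sub_le hn hμ0 hμL hg x' x
  have e1 : ∀ w s, trackErr L μ ρ w (y, s) = √n * ‖avg y - w‖ + devWeight L μ ρ * l2 (dev y) +
    trackWeight L μ * l2 (dev s) := fun _ _ => rfl
  have eV := e1 (lowerSol g x) s
  set V := trackErr L μ ρ (lowerSol g x) (y, s)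
  have hdev := l2_nonneg (dev s)
  rw [e1, warmConst]
  set τ := trackWeight L μ
  set κ := L / μ
  set cR := 1 + 1 / devWeight L μ ρ with hcR
  have hcR0 : 0 ≤ cR := by positivity
  set Δ := l2 (x' - x)
  have q1 : 0 ≤ τ * V := by positivity
  have q2 : 0 ≤ (1 + τ * L) * κ * V := by positivity
  have q3 : 0 ≤ τ * L * cR * V := by positivity
  have q4 : 0 ≤ τ * L * cR * Δ := by positivity
  have q5 : 0 ≤ τ * Δ := by positivity
  have q6 : 0 ≤ ((1 + τ * L) * κ + τ * L * cR) * z := by positivity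
  have q7 : 0 ≤ τ * z := by positivity
  have q8 : τ * L * Δ ≤ τ * L * κ * Δ :=
    mul_le_mul_of_nonneg_right (le_mul_of_one_le_right (by positivity) hκ) hD
  have q9 : 0 ≤ τ * l2 (dev s) := by positivity
  rcases hs with hs | hs
  · have h6 := mul_le_mul_of_nonneg_left hs hτ.le
    linarith
  · have h6 := mul_le_mul_of_nonneg_left ((l2_dev_le hn s').trans hs) hτ.le
    have h7 := mul_le_mul_of_nonneg_left h5 (show 0 ≤ τ * L by positivity)
    linarith

lemma het_trackingRun (f g : Fin n → Vec p → Vec q → ℝ) (W : Matrix (Fin n) (Fin n) ℝ)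
    (ηx ηy γ : ℝ) (T N : ℕ) (start : TrackerStart) (y₀ : Fin n → Vec q)
    (Z₀ : Fin n → Vec p →L[ℝ] Vec q) :
    TrackingRun W ηx (fun k => (het f g W ηx ηy γ T N start y₀ Z₀ k).x)
      (fun k => (het f g W ηx ηy γ T N start y₀ Z₀ k).u)
      fun k => (het f g W ηx ηy γ T N start y₀ Z₀ k).h :=
  ⟨rfl, rfl, fun _ => rfl, fun _ => rfl⟩

lemma het_h_eq (f g : Fin n → Vec p → Vec q → ℝ) (W : Matrix (Fin n) (Fin n) ℝ)
    (ηx ηy γ : ℝ) (T N : ℕ) (start : TrackerStart) (y₀ : Fin n → Vec q)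
    (Z₀ : Fin n → Vec p →L[ℝ] Vec q) (k : ℕ) :
    (het f g W ηx ηy γ T N start y₀ Z₀ k).h =
      hetHyper f g W γ N Z₀ (het f g W ηx ηy γ T N start y₀ Z₀ k).x
        (het f g W ηx ηy γ T N start y₀ Z₀ k).y := by
  cases k <;> rfl

/-- The inner error is of order `α ^ T` uniformly in the outer iterations. -/
lemma het_trackErr_le (hn : 0 < n) (hμ0 : 0 < μ) (hμL : μ ≤ L)
    (hg : ∀ i, LowerReg L Lg2 μ (g i)) (hWd : W ∈ doublyStochastic ℝ (Fin n)) (hρ : rho W hW < 1)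
    (hηy : 0 < ηy) (hηy' : ηy ≤ trackStep L μ (rho W hW)) {T N K : ℕ} {start : TrackerStart}
    {y₀ : Fin n → Vec q} {Z₀ : Fin n → Vec p →L[ℝ] Vec q} (hR : 1 ≤ R) (hD : 0 ≤ D)
    (hD0 : hetD0 g y₀ Z₀ ≤ R ^ 2)
    (hζ : start = .restarted →
      ∀ k ≤ K, hetero g (het f g W ηx ηy γ T N start y₀ Z₀ k).x ≤ R ^ 2)
    (hx : ∀ k, l2 ((het f g W ηx ηy γ T N start y₀ Z₀ (k + 1)).x -
      (het f g W ηx ηy γ T N start y₀ Z₀ k).x) ≤ D * R)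
    (hT : trackRate μ (rho W hW) ηy ^ T * warmConst L μ (rho W hW) ≤ 1 / 2) (k : ℕ) (hk : k ≤ K) :
    trackErr L μ (rho W hW) (lowerSol g (het f g W ηx ηy γ T N start y₀ Z₀ k).x)
        ((het f g W ηx ηy γ T N start y₀ Z₀ k).y, (het f g W ηx ηy γ T N start y₀ Z₀ k).s) ≤
      trackRate μ (rho W hW) ηy ^ T * ((1 + devWeight L μ (rho W hW) + trackWeight L μ +
        2 * warmConst L μ (rho W hW) * (D + 1)) * R) ∧
    avg (het f g W ηx ηy γ T N start y₀ Z₀ k).s = avg fun i =>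
      gradY (g i) ((het f g W ηx ηy γ T N start y₀ Z₀ k).x i)
        ((het f g W ηx ηy γ T N start y₀ Z₀ k).y i) := by
  have hL : 0 < L := hμ0.trans_le hμL
  have hβ := devWeight_pos hμ0 hμL hρ
  have hτ := trackWeight_pos hμ0 hμL
  have hc := warmConst_pos hμ0 hμL hρ
  have hR0 : 0 ≤ R := by linarith
  have hα : 0 ≤ trackRate μ (rho W hW) ηy ^ T := pow_nonneg (trackRate_pos (rho_nonneg W hW)).le T
  have inner := fun (x : Fin n → Vec p) (ys : (Fin n → Vec q) × (Fin n → Vec q))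
    (h : avg ys.2 = avg fun i => gradY (g i) (x i) (ys.1 i)) =>
    trackErr_iterate_le hn hμ0 hμL hWd hρ hηy hηy' (fun i => (hg i).lip_gradY (x i))
      (fun i => (hg i).monotone_gradY (x i)) (avg_gradY_lowerSol hn hμ0 hμL hg x) h T
  set S := het f g W ηx ηy γ T N start y₀ Z₀ with hS
  induction k with
  | zero =>
    have h1 := inner (S 0).x (y₀, fun i => gradY (g i) ((S 0).x i) (y₀ i)) rfl
    refine ⟨h1.1.trans (mul_le_mul_of_nonneg_left ?_ hα), h1.2⟩
    have hy : l2 (fun i => y₀ i - lowerSol g (S 0).x) ≤ R := by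
      refine le_of_sq_le_sq (le_trans ?_ hD0) hR0
      rw [l2_sq, hetD0]
      refine Finset.sum_le_sum fun i _ => ?_
      have : lowerSol g (S 0).x = yStar g 0 := rfl
      rw [this]
      nlinarith [sq_nonneg ‖gradY (g i) 0 (y₀ i)‖, sq_nonneg ‖Z₀ i‖]
    have hs : l2 (fun i => gradY (g i) ((S 0).x i) (y₀ i)) ≤ R := by
      refine le_of_sq_le_sq (le_trans ?_ hD0) hR0
      rw [l2_sq, hetD0]
      refine Finset.sum_le_sum fun i _ => ?_
      have : gradY (g i) ((S 0).x i) (y₀ i) = gradY (g i) 0 (y₀ i) := rfl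
      rw [this]
      nlinarith [sq_nonneg ‖y₀ i - yStar g 0‖, sq_nonneg ‖Z₀ i‖]
    have h2 := trackErr_le (w := lowerSol g (S 0).x)
      (zs := (y₀, fun i => gradY (g i) ((S 0).x i) (y₀ i))) hn hμ0 hμL hρ hy hs
    have h3 : 0 ≤ 2 * warmConst L μ (rho W hW) * (D + 1) * R := by positivity
    linarith
  | succ k ih =>
    obtain ⟨ih1, ih2⟩ := ih (by omega)
    -- Both tracker starts are reduced to one statement: an initial tracker with the right mean that
    -- satisfies one of the alternatives.
    obtain ⟨s', hs', ha, hor⟩ : ∃ s' : Fin n → Vec q,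
        ((S (k + 1)).y, (S (k + 1)).s) = hetInner g W ηy T (S (k + 1)).x ((S k).y, s') ∧
        avg s' = (avg fun i => gradY (g i) ((S (k + 1)).x i) ((S k).y i)) ∧
        (l2 (dev s') ≤ l2 (dev (S k).s) + L * l2 ((S (k + 1)).x - (S k).x) ∨
          l2 s' ≤ R + L * l2 (fun i => (S k).y i - lowerSol g (S (k + 1)).x)) := by
      cases start with
      | carried =>
        refine ⟨(S k).s + ((fun i => gradY (g i) ((S (k + 1)).x i) ((S k).y i)) -
          fun i => gradY (g i) ((S k).x i) ((S k).y i)), ?_, ?_, Or.inl ?_⟩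
        · have e : (S k).s + ((fun i => gradY (g i) ((S (k + 1)).x i) ((S k).y i)) -
              fun i => gradY (g i) ((S k).x i) ((S k).y i)) = fun i => (S k).s i +
              gradY (g i) ((S (k + 1)).x i) ((S k).y i) - gradY (g i) ((S k).x i) ((S k).y i) := by
            ext1 i; exact (add_sub_assoc _ _ _).symm
          rw [e]
          rfl
        · rw [avg_add, avg_sub, ih2]; abel
        · rw [dev_add]
          refine (l2_add_le _ _).trans (add_le_add le_rfl ((l2_dev_le hn _).trans ?_))
          refine l2_le_of_forall_le hL.le fun i => ?_
          refine (norm_gradY_sub_le (hg i).diff (hg i).grad_lip _ _ _ _).trans (le_of_eq ?_)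
          rw [norm_pt_sub_left]
          rfl
      | restarted =>
        refine ⟨fun i => gradY (g i) ((S (k + 1)).x i) ((S k).y i), rfl, rfl, Or.inr ?_⟩
        have h1 : l2 (fun i => gradY (g i) ((S (k + 1)).x i) (lowerSol g (S (k + 1)).x)) ≤ R := by
          refine le_of_sq_le_sq ?_ hR0
          rw [l2_sq]
          exact hζ rfl (k + 1) hk
        have h2 : l2 ((fun i => gradY (g i) ((S (k + 1)).x i) ((S k).y i)) -
            fun i => gradY (g i) ((S (k + 1)).x i) (lowerSol g (S (k + 1)).x)) ≤
            L * l2 (fun i => (S k).y i - lowerSol g (S (k + 1)).x) :=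
          l2_le_of_forall_le hL.le fun i => (hg i).lip_gradY _ _ _
        have h3 := l2_add_le (fun i => gradY (g i) ((S (k + 1)).x i) (lowerSol g (S (k + 1)).x))
          ((fun i => gradY (g i) ((S (k + 1)).x i) ((S k).y i)) -
            fun i => gradY (g i) ((S (k + 1)).x i) (lowerSol g (S (k + 1)).x))
        rw [add_sub_cancel] at h3
        linarith
    have h1 := inner (S (k + 1)).x ((S k).y, s') ha
    have h2 := trackErr_lowerSol_le hn hμ0 hμL hρ hg hR0 hor
    have hs2 : (gtStep W ηy fun i y => gradY (g i) ((S (k + 1)).x i) y)^[T] ((S k).y, s') =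
      ((S (k + 1)).y, (S (k + 1)).s) := hs'.symm
    rw [hs2] at h1
    refine ⟨h1.1.trans (mul_le_mul_of_nonneg_left (h2.trans ?_) hα), h1.2⟩
    have h3 := mul_le_mul_of_nonneg_left (add_le_add (add_le_add ih1 (hx k)) (le_refl R)) hc.le
    refine h3.trans ?_
    set c := warmConst L μ (rho W hW)
    set a := trackRate μ (rho W hW) ηy ^ T
    set b := 1 + devWeight L μ (rho W hW) + trackWeight L μ with hb
    have hb0 : 0 ≤ b := by positivity
    -- Since `a * c ≤ 1/2`, the feedback of the previous error uses at most half of the claimed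
    -- bound; the other half contains `c (D + 1) R`, the cost of displacement and restart.
    have h4 : a * c * ((b + 2 * c * (D + 1)) * R) ≤ 1 / 2 * ((b + 2 * c * (D + 1)) * R) :=
      mul_le_mul_of_nonneg_right hT (by positivity)
    have h5 : 0 ≤ b * R := by positivity
    linarith

end Het

end DBOGT

namespace DBOGT

/-! ### Convergence in the heterogeneous branch. -/

section HetConvergence

open Finset

variable {n p q : ℕ} {L Lf0 Lg2 μ ηx ηy γ R α : ℝ} {W : Matrix (Fin n) (Fin n) ℝ}
  {hW : W.IsHermitian} {f g : Fin n → Vec p → Vec q → ℝ}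

lemma norm_gradient_Phi_le (hn : 0 < n) (hμ0 : 0 < μ) (hμL : μ ≤ L) (h0 : 0 ≤ Lf0)
    (hf : ∀ i, UpperReg L Lf0 (f i)) (hg : ∀ i, LowerReg L Lg2 μ (g i)) (x : Vec p) :
    ‖gradient (Phi f g) x‖ ≤ (1 + L / μ) * Lf0 := by
  rw [(hasGradientAt_Phi hn hμ0 hμL hf hg x).gradient]
  exact norm_avg_le hn fun i => norm_hyper_le hn hμ0 hμL h0 hf hg _ _ i

/-- Since `1 ≤ κ²`, one has `2 (1 + κ²) ≤ 6 κ²`, so this step size meets the condition for the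
constant `√(1 + κ²) Lf`. -/
lemma step_condition_het (hn : 0 < n) (hμ0 : 0 < μ) (hμL : μ ≤ L) {ρ ℓ : ℝ} (hη : 0 < ηx)
    (hℓ : 0 < ℓ) (h : ηx < (1 - ρ) ^ 2 / (4 * √(6 * n) * (L / μ) * ℓ)) :
    32 * n * (ηx * (√(1 + (L / μ) ^ 2) * ℓ)) ^ 2 ≤ (1 - ρ) ^ 4 := by
  have hn0 : (0 : ℝ) < n := by exact_mod_cast hn
  have hκ : 1 ≤ L / μ := (one_le_div hμ0).2 hμL
  refine step_condition hn hη (mul_pos (Real.sqrt_pos.2 (by positivity)) hℓ) (h.trans_le ?_)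
  refine div_le_div_of_nonneg_left (sq_nonneg _)
    (mul_pos (by positivity) (mul_pos (Real.sqrt_pos.2 (by positivity)) hℓ)) ?_
  have h1 : √(2 * n) * √(1 + (L / μ) ^ 2) ≤ √(6 * n) * (L / μ) := by
    rw [← Real.sqrt_mul (by positivity), ← Real.sqrt_sq (show 0 ≤ L / μ by linarith),
      ← Real.sqrt_mul (by positivity), Real.sqrt_sq (show 0 ≤ L / μ by linarith)]
    refine Real.sqrt_le_sqrt ?_
    have h2 : (1 : ℝ) ≤ (L / μ) ^ 2 := one_le_pow₀ hκ
    nlinarith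
  have h2 := mul_le_mul_of_nonneg_right h1 hℓ.le
  linarith

/-- The constant in the bound of the hypergradient estimates. -/
noncomputable def hyperConst (L Lf0 μ ρ : ℝ) (n : ℕ) : ℝ :=
  √n * (Lf0 * (jhipConst L μ ρ n + 1 + L / μ))

/-- The constant in the bound of the displacements of the outer iterates. -/
noncomputable def moveConst (L Lf0 μ ρ ηx : ℝ) (n : ℕ) : ℝ :=
  ηx * (6 / (1 - ρ) ^ 2 + 4 / (1 - ρ) + 1) * hyperConst L Lf0 μ ρ n

/-- The constant in the bound of the lower level errors. -/
noncomputable def innerConst (L Lf0 μ ρ ηx : ℝ) (n : ℕ) : ℝ :=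
  (1 + 1 / devWeight L μ ρ) * (1 + devWeight L μ ρ + trackWeight L μ +
    2 * warmConst L μ ρ * (moveConst L Lf0 μ ρ ηx n + 1))

/-- The constant of the heterogeneous convergence rate. -/
noncomputable def hetConst (L Lf0 Lg2 μ ρ ηx : ℝ) (n : ℕ) : ℝ :=
  1 + 2 * warmConst L μ ρ * ((1 + L / μ) * Lf0) ^ 2 +
    8 * ((√n * (Lf0 * jhipConst L μ ρ n)) ^ 2 +
      (Lf L Lf0 Lg2 μ * innerConst L Lf0 μ ρ ηx n) ^ 2)

lemma hetConst_pos {ρ : ℝ} (hμ0 : 0 < μ) (hμL : μ ≤ L) (hρ : ρ < 1) :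
    0 < hetConst L Lf0 Lg2 μ ρ ηx n := by
  have hc := warmConst_pos hμ0 hμL hρ
  rw [hetConst]; positivity

lemma l2_hetHyper_le (hn : 0 < n) (hμ0 : 0 < μ) (hμL : μ ≤ L) (h0 : 0 ≤ Lf0)
    (hf : ∀ i, UpperReg L Lf0 (f i)) (hg : ∀ i, LowerReg L Lg2 μ (g i))
    (hWd : W ∈ doublyStochastic ℝ (Fin n)) (hρ : rho W hW < 1) (hγ : 0 < γ)
    (hγ' : γ ≤ trackStep L μ (rho W hW)) {Z₀ : Fin n → Vec p →L[ℝ] Vec q} (hR : 1 ≤ R)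
    (hZ : ∑ i, ‖Z₀ i‖ ^ 2 ≤ R ^ 2) (N : ℕ) (x : Fin n → Vec p) (y : Fin n → Vec q) :
    l2 (hetHyper f g W γ N Z₀ x y) ≤ hyperConst L Lf0 μ (rho W hW) n * R := by
  have hL : 0 < L := hμ0.trans_le hμL
  have h1 := l2_hetHyper_sub_le (hW := hW) hn hμ0 hμL h0 hf hg hWd hρ hγ hγ' hR hZ N x y
  have h2 : l2 (hyper f g x y) ≤ √n * ((1 + L / μ) * Lf0) :=
    l2_le_sqrt_mul (by positivity) fun i => norm_hyper_le hn hμ0 hμL h0 hf hg x y i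
  have h3 := l2_add_le (hyper f g x y) (hetHyper f g W γ N Z₀ x y - hyper f g x y)
  rw [add_sub_cancel] at h3
  have hC := jhipConst_nonneg (n := n) hμ0 hμL hρ
  have h4 : √n * (Lf0 * jhipConst L μ (rho W hW) n) * trackRate μ (rho W hW) γ ^ N * R ≤
      √n * (Lf0 * jhipConst L μ (rho W hW) n) * R :=
    mul_le_mul_of_nonneg_right (mul_le_of_le_one_right (by positivity)
      (pow_le_one₀ (trackRate_pos (rho_nonneg W hW)).le (trackRate_lt_one hμ0 hγ hρ).le))
      (by linarith)
  have h5 : √n * ((1 + L / μ) * Lf0) ≤ √n * ((1 + L / μ) * Lf0) * R :=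
    le_mul_of_one_le_right (by positivity) hR
  rw [hyperConst]
  linarith

/-- Squaring only improves the rates: `(c ^ M)² ≤ α ^ M`, because `c ≤ α ≤ 1`. -/
lemma sq_add_mul_pow_le {a b c d R α : ℝ} {T N : ℕ} (hc : 0 ≤ c)
    (hd : 0 ≤ d) (hα1 : α ≤ 1) (hcα : c ≤ α) (hdα : d ≤ α) :
    (a * c ^ N * R + b * (d ^ T * R)) ^ 2 ≤
      2 * (a ^ 2 + b ^ 2) * R ^ 2 * (α ^ T + α ^ N) := by
  have hα : 0 ≤ α := hc.trans hcα
  have key : ∀ {c : ℝ} (M : ℕ), 0 ≤ c → c ≤ α → (c ^ M) ^ 2 ≤ α ^ M := fun M h h' => by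
    have h1 := pow_le_pow_left₀ h h' M
    have h2 : α ^ M ≤ 1 := pow_le_one₀ hα hα1
    have h3 := pow_nonneg h M
    nlinarith
  have k1 := mul_le_mul_of_nonneg_left (key N hc hcα) (sq_nonneg (a * R))
  have k2 := mul_le_mul_of_nonneg_left (key T hd hdα) (sq_nonneg (b * R))
  have k3 := mul_nonneg (sq_nonneg (a * R)) (pow_nonneg hα T)
  have k4 := mul_nonneg (sq_nonneg (b * R)) (pow_nonneg hα N)
  have k5 := sq_nonneg (a * c ^ N * R - b * (d ^ T * R))
  nlinarith

/-- The hypergradient errors. -/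
lemma het_error_le (hn : 0 < n) (hμ0 : 0 < μ) (hμL : μ ≤ L) (h0 : 0 ≤ Lf0) (h2 : 0 ≤ Lg2)
    (hf : ∀ i, UpperReg L Lf0 (f i)) (hg : ∀ i, LowerReg L Lg2 μ (g i))
    (hWd : W ∈ doublyStochastic ℝ (Fin n)) (hρ : rho W hW < 1) (hηx : 0 < ηx)
    (hηy : 0 < ηy) (hηy' : ηy ≤ trackStep L μ (rho W hW)) (hγ : 0 < γ)
    (hγ' : γ ≤ trackStep L μ (rho W hW)) {T N K : ℕ} {start : TrackerStart}
    {y₀ : Fin n → Vec q} {Z₀ : Fin n → Vec p →L[ℝ] Vec q} (hR : 1 ≤ R)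
    (hD0 : hetD0 g y₀ Z₀ ≤ R ^ 2)
    (hζ : start = .restarted →
      ∀ k ≤ K, hetero g (het f g W ηx ηy γ T N start y₀ Z₀ k).x ≤ R ^ 2)
    (hT : trackRate μ (rho W hW) ηy ^ T * warmConst L μ (rho W hW) ≤ 1 / 2) (k : ℕ) (hk : k ≤ K) :
    l2 ((het f g W ηx ηy γ T N start y₀ Z₀ k).h -
        exactHyper f g (het f g W ηx ηy γ T N start y₀ Z₀ k).x) ≤
      √n * (Lf0 * jhipConst L μ (rho W hW) n) * trackRate μ (rho W hW) γ ^ N * R +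
        Lf L Lf0 Lg2 μ * innerConst L Lf0 μ (rho W hW) ηx n *
          (trackRate μ (rho W hW) ηy ^ T * R) := by
  have hL : 0 < L := hμ0.trans_le hμL
  have hR0 : 0 ≤ R := by linarith
  have hq : 0 < 1 - rho W hW := by linarith
  have hβ := devWeight_pos hμ0 hμL hρ
  have hC := jhipConst_nonneg (n := n) hμ0 hμL hρ
  have hZ : ∑ i, ‖Z₀ i‖ ^ 2 ≤ R ^ 2 := by
    refine le_trans (Finset.sum_le_sum fun i _ => ?_) hD0
    nlinarith [sq_nonneg ‖y₀ i - yStar g 0‖, sq_nonneg ‖gradY (g i) 0 (y₀ i)‖]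
  have hh : ∀ k, l2 (het f g W ηx ηy γ T N start y₀ Z₀ k).h ≤
      hyperConst L Lf0 μ (rho W hW) n * R := fun k => by
    rw [het_h_eq]
    exact l2_hetHyper_le hn hμ0 hμL h0 hf hg hWd hρ hγ hγ' hR hZ N _ _
  have hH0 : 0 ≤ hyperConst L Lf0 μ (rho W hW) n := by rw [hyperConst]; positivity
  have hM0 : 0 ≤ moveConst L Lf0 μ (rho W hW) ηx n := by rw [moveConst]; positivity
  have hV := (het_trackErr_le (D := moveConst L Lf0 μ (rho W hW) ηx n) hn hμ0 hμL hg hWd hρ hηy hηy'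
    hR hM0 hD0 hζ (fun k => by
      have h3 := (het_trackingRun f g W ηx ηy γ T N start y₀ Z₀).displacement_le (hW := hW)
        hn hWd hρ hηx.le hh k
      rwa [← mul_assoc] at h3) hT k hk).1
  have hE := l2_hetHyper_sub_le (hW := hW) (Z₀ := Z₀) hn hμ0 hμL h0 hf hg hWd hρ hγ hγ' hR hZ N
    (het f g W ηx ηy γ T N start y₀ Z₀ k).x (het f g W ηx ηy γ T N start y₀ Z₀ k).y
  rw [← het_h_eq] at hE
  set S := het f g W ηx ηy γ T N start y₀ Z₀ k
  refine (l2_sub_le_add _ (hyper f g S.x S.y) _).trans (add_le_add hE ?_)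
  have h3 := l2_hyper_sub_le hn hμ0 hμL h0 h2 hf hg S.x S.x S.y fun _ => lowerSol g S.x
  have h4 : l2 (S.x - S.x) = 0 := by simp [l2]
  rw [h4, zero_pow two_ne_zero, zero_add, Real.sqrt_sq (l2_nonneg _)] at h3
  refine h3.trans ?_
  rw [mul_assoc (Lf L Lf0 Lg2 μ)]
  refine mul_le_mul_of_nonneg_left ?_ (Lf_pos hμ0 hμL h0 h2).le
  refine ((l2_sub_le_trackErr (w := lowerSol g S.x) (zs := (S.y, S.s)) hμ0 hμL hρ).trans
    (mul_le_mul_of_nonneg_left hV (by positivity))).trans (le_of_eq ?_)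
  rw [innerConst]
  ring

/-- Convergence when the lower level functions may differ. -/
theorem het_convergence (hn : 0 < n) (hμ0 : 0 < μ) (hμL : μ ≤ L) (h0 : 0 ≤ Lf0) (h2 : 0 ≤ Lg2)
    (hR : Regular L Lf0 Lg2 μ f g) (hWd : W ∈ doublyStochastic ℝ (Fin n)) (hρ : rho W hW < 1)
    (hb : BddBelow (Set.range (Phi f g))) (hηx : 0 < ηx)
    (hηx' : ηx < (1 - rho W hW) ^ 2 / (4 * √(6 * n) * (L / μ) * Lf L Lf0 Lg2 μ))
    (hηy : 0 < ηy) (hηy' : ηy ≤ trackStep L μ (rho W hW)) (hγ : 0 < γ)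
    (hγ' : γ ≤ trackStep L μ (rho W hW)) (hα1 : α ≤ 1) (hαy : trackRate μ (rho W hW) ηy ≤ α)
    (hαγ : trackRate μ (rho W hW) γ ≤ α) (y₀ : Fin n → Vec q) (Z₀ : Fin n → Vec p →L[ℝ] Vec q)
    (start : TrackerStart) (T N K : ℕ) {ζ : ℝ} (hζ0 : 0 ≤ ζ)
    (hζ : start = .restarted →
      ∀ k ≤ K, hetero g (het f g W ηx ηy γ T N start y₀ Z₀ k).x ≤ ζ) :
    1 / ((K : ℝ) + 1) * ∑ k ∈ range (K + 1),
        ‖gradient (Phi f g) (avg (het f g W ηx ηy γ T N start y₀ Z₀ k).x)‖ ^ 2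
      ≤ 6 / (ηx * (K + 1)) *
          (Phi f g (avg (het f g W ηx ηy γ T N start y₀ Z₀ 0).x) - ⨅ x, Phi f g x)
        + specNorm (het f g W ηx ηy γ T N start y₀ Z₀ 0).h ^ 2 / (K + 1)
        + hetConst L Lf0 Lg2 μ (rho W hW) ηx n * (1 + hetD0 g y₀ Z₀ + ζ) *
          (α ^ T + α ^ N + 1 / ((K : ℝ) + 1)) := by
  have hf := fun i => hR.upper i
  have hg := fun i => hR.lower i
  have hn1 : (1 : ℝ) ≤ n := by exact_mod_cast hn
  have hn0 : (0 : ℝ) < n := by linarith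
  have hK : (0 : ℝ) < (K : ℝ) + 1 := by positivity
  have hα0 : 0 ≤ α := (trackRate_pos (rho_nonneg W hW)).le.trans hαy
  have hL : 0 < L := hμ0.trans_le hμL
  have hD0 : 0 ≤ hetD0 g y₀ Z₀ := Finset.sum_nonneg fun _ _ => by positivity
  have hc := warmConst_pos hμ0 hμL hρ
  have hgap : 0 ≤ Phi f g (avg (het f g W ηx ηy γ T N start y₀ Z₀ 0).x) - ⨅ x, Phi f g x :=
    sub_nonneg.2 (ciInf_le hb _)
  have hαT := pow_nonneg hα0 T
  have hαN := pow_nonneg hα0 N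
  -- `R = √P` meets all normalizations at once: it is at least `1`, and its square dominates the
  -- initial error and the heterogeneity.
  set P := 1 + hetD0 g y₀ Z₀ + ζ with hP
  have hP1 : 1 ≤ P := by linarith
  have hsqP : √P ^ 2 = P := Real.sq_sqrt (by linarith)
  -- For small `T` the moving target may win over the inner contraction. But then `1 ≤ 2 c α ^ T`,
  -- with `c` the growth constant, so the uniform bound on `∇Φ` is already of order `α ^ T`.
  rcases lt_or_ge (1 / 2) (trackRate μ (rho W hW) ηy ^ T * warmConst L μ (rho W hW)) with hT | hT
  · have hsum : ∑ k ∈ range (K + 1),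
        ‖gradient (Phi f g) (avg (het f g W ηx ηy γ T N start y₀ Z₀ k).x)‖ ^ 2 ≤
        (K + 1) * ((1 + L / μ) * Lf0) ^ 2 := by
      refine (Finset.sum_le_sum fun k _ => pow_le_pow_left₀ (norm_nonneg _)
        (norm_gradient_Phi_le hn hμ0 hμL h0 hf hg _) 2).trans (le_of_eq ?_)
      simp
    have h3 : 1 / ((K : ℝ) + 1) * ∑ k ∈ range (K + 1),
        ‖gradient (Phi f g) (avg (het f g W ηx ηy γ T N start y₀ Z₀ k).x)‖ ^ 2 ≤
        ((1 + L / μ) * Lf0) ^ 2 := by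
      rw [one_div, inv_mul_le_iff₀ hK]; exact hsum
    have h4 : 1 ≤ 2 * warmConst L μ (rho W hW) * α ^ T := by
      have h5 := mul_le_mul_of_nonneg_right
        (pow_le_pow_left₀ (trackRate_pos (rho_nonneg W hW)).le hαy T) hc.le
      linarith
    have h5 : ((1 + L / μ) * Lf0) ^ 2 ≤
        2 * warmConst L μ (rho W hW) * ((1 + L / μ) * Lf0) ^ 2 * α ^ T := by
      nlinarith [sq_nonneg ((1 + L / μ) * Lf0)]
    have h6 : 2 * warmConst L μ (rho W hW) * ((1 + L / μ) * Lf0) ^ 2 * α ^ T ≤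
        hetConst L Lf0 Lg2 μ (rho W hW) ηx n * P * (α ^ T + α ^ N + 1 / ((K : ℝ) + 1)) := by
      refine mul_le_mul ?_ ?_ hαT ?_
      · refine le_trans ?_ (le_mul_of_one_le_right (hetConst_pos hμ0 hμL hρ).le hP1)
        rw [hetConst]
        have : 0 ≤ 8 * ((√n * (Lf0 * jhipConst L μ (rho W hW) n)) ^ 2 +
          (Lf L Lf0 Lg2 μ * innerConst L Lf0 μ (rho W hW) ηx n) ^ 2) := by positivity
        linarith
      · have : 0 ≤ 1 / ((K : ℝ) + 1) := by positivity
        linarith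
      · exact mul_nonneg (hetConst_pos hμ0 hμL hρ).le (by linarith)
    refine (h3.trans (h5.trans h6)).trans (le_add_of_nonneg_left ?_)
    positivity
  · have hE : ∀ k ∈ range (K + 1), l2 ((het f g W ηx ηy γ T N start y₀ Z₀ k).h -
        exactHyper f g (het f g W ηx ηy γ T N start y₀ Z₀ k).x) ^ 2 ≤
        2 * ((√n * (Lf0 * jhipConst L μ (rho W hW) n)) ^ 2 +
          (Lf L Lf0 Lg2 μ * innerConst L Lf0 μ (rho W hW) ηx n) ^ 2) * P * (α ^ T + α ^ N) :=
      fun k hk => by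
      have h3 := het_error_le (R := √P) (ηx := ηx) (N := N) (K := K) (start := start) (y₀ := y₀)
        (Z₀ := Z₀) hn hμ0 hμL h0 h2 hf hg hWd hρ hηx hηy hηy' hγ hγ' (Real.one_le_sqrt.2 hP1)
        (by rw [hsqP]; linarith)
        (fun h k hk => (hζ h k hk).trans (by rw [hsqP]; linarith)) hT k
        (by have := Finset.mem_range.1 hk; omega)
      rw [← hsqP]
      exact (pow_le_pow_left₀ (l2_nonneg _) h3 2).trans (sq_add_mul_pow_le
        (trackRate_pos (rho_nonneg W hW)).le (trackRate_pos (rho_nonneg W hW)).le hα1 hαγ hαy)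
    have hm := ((het_trackingRun f g W ηx ηy γ T N start y₀ Z₀).sum_norm_gradient_le (hW := hW) hn
      hWd hρ hηx (step_condition_het hn hμ0 hμL hηx (Lf_pos hμ0 hμL h0 h2) hηx') (Φ := Phi f g)
      (F := exactHyper f g) (l2_exactHyper_sub_le hn hμ0 hμL h0 h2 hf hg)
      (hasGradientAt_Phi hn hμ0 hμL hf hg) hb K).1
    have hsE := Finset.sum_le_sum hE
    rw [Finset.sum_const, Finset.card_range, nsmul_eq_mul, Nat.cast_add, Nat.cast_one] at hsE
    set S := het f g W ηx ηy γ T N start y₀ Z₀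
    have hT0 : l2 (dev (S 0).h) ^ 2 ≤ n * specNorm (S 0).h ^ 2 :=
      (pow_le_pow_left₀ (l2_nonneg _) (l2_dev_le hn _) 2).trans (l2_sq_le_specNorm _)
    have pM : 0 ≤ ∑ k ∈ range (K + 1), ‖avg (S k).h‖ ^ 2 :=
      Finset.sum_nonneg fun _ _ => sq_nonneg _
    have pE : 0 ≤ ∑ k ∈ range (K + 1), l2 ((S k).h - exactHyper f g (S k).x) ^ 2 :=
      Finset.sum_nonneg fun _ _ => sq_nonneg _
    set SE := ∑ k ∈ range (K + 1), l2 ((S k).h - exactHyper f g (S k).x) ^ 2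
    set SN := ∑ k ∈ range (K + 1), ‖gradient (Phi f g) (avg (S k).x)‖ ^ 2
    set gap := Phi f g (avg (S 0).x) - ⨅ x, Phi f g x
    set sp := specNorm (S 0).h ^ 2 with hsp
    have psp : 0 ≤ sp := sq_nonneg _
    set Q := (√n * (Lf0 * jhipConst L μ (rho W hW) n)) ^ 2 +
          (Lf L Lf0 Lg2 μ * innerConst L Lf0 μ (rho W hW) ηx n) ^ 2 with hQ
    have hQ0 : 0 ≤ Q := by positivity
    have hdiv : (4 * SE + l2 (dev (S 0).h) ^ 2 / 6) / n ≤ 4 * SE + sp := by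
      rw [div_le_iff₀ hn0]
      have h3 : SE ≤ SE * n := le_mul_of_one_le_right pE hn1
      have h4 : 0 ≤ sp * n := by positivity
      linarith
    -- The per-iteration errors are only bounded, not summable, so they contribute a multiple of `K
    -- + 1`, which becomes a constant floor after averaging.
    have hSN : SN ≤ 6 / ηx * gap + sp + 8 * Q * P * (α ^ T + α ^ N) * (K + 1) := by
      have e5 : 2 / ηx * gap ≤ 6 / ηx * gap := by gcongr; norm_num
      linarith
    have hfin : 8 * Q * P * (α ^ T + α ^ N) ≤
        hetConst L Lf0 Lg2 μ (rho W hW) ηx n * P * (α ^ T + α ^ N + 1 / ((K : ℝ) + 1)) := by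
      have h3 : 8 * Q ≤ hetConst L Lf0 Lg2 μ (rho W hW) ηx n := by
        rw [hetConst, ← hQ]
        have : 0 ≤ 2 * warmConst L μ (rho W hW) * ((1 + L / μ) * Lf0) ^ 2 := by positivity
        linarith
      have h4 : 0 ≤ 1 / ((K : ℝ) + 1) := by positivity
      exact mul_le_mul (mul_le_mul_of_nonneg_right h3 (by linarith)) (by linarith)
        (by positivity) (mul_nonneg (hetConst_pos hμ0 hμL hρ).le (by linarith))
    calc 1 / ((K : ℝ) + 1) * SN ≤ 1 / ((K : ℝ) + 1) *
          (6 / ηx * gap + sp + 8 * Q * P * (α ^ T + α ^ N) * (K + 1)) :=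
          mul_le_mul_of_nonneg_left hSN (by positivity)
      _ = 6 / (ηx * (K + 1)) * gap + sp / (K + 1) + 8 * Q * P * (α ^ T + α ^ N) := by
          field_simp
      _ ≤ _ := add_le_add le_rfl hfin

end HetConvergence

end DBOGT

/-! ### Assembly of the two branches. -/

theorem mainTheorem2 :
    -- Homogeneous lower levels.
    (∀ L Lf0 Lg2 : ℝ, 0 < L → 0 ≤ Lf0 → 0 ≤ Lg2 →
      ∃ c C : ℝ, 0 < c ∧ 0 < C ∧
      ∀ (n p q : ℕ) (μ ηx ηy : ℝ) (T N : ℕ)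
        (W : Matrix (Fin n) (Fin n) ℝ) (hW : W.IsHermitian)
        (f g : Fin n → Vec p → Vec q → ℝ) (y₀ v₀ : Fin n → Vec q),
        0 < n → 0 < μ → μ ≤ L →
        Regular L Lf0 Lg2 μ f g →
        W ∈ doublyStochastic ℝ (Fin n) → rho W hW < 1 →
        (∀ i j, g i = g j) →
        BddBelow (Set.range (Phi f g)) →
        0 < ηx → ηx < (1 - rho W hW) ^ 2 / (4 * √(2 * n) * LPhi L Lf0 Lg2 μ) →
        0 < ηy → ηy ≤ 2 / (μ + L) →
        c * (L / μ) ^ 5 * deltaY L μ ηy T ≤ 1 →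
        c * (L / μ) ^ 4 * deltaK L μ N ≤ 1 →
        Differentiable ℝ (Phi f g) ∧
        ∀ K : ℕ,
          1 / ((K : ℝ) + 1) * ∑ k ∈ Finset.range (K + 1),
              ‖gradient (Phi f g) (avg (hom f g W ηx ηy T N y₀ v₀ k).x)‖ ^ 2
            ≤ 4 / (ηx * (K + 1)) *
                (Phi f g (avg (hom f g W ηx ηy T N y₀ v₀ 0).x) - ⨅ x, Phi f g x)
              + C * (homC1 g y₀ + homC2 f g v₀
                  + specNorm (hom f g W ηx ηy T N y₀ v₀ 0).h ^ 2) / (K + 1)) ∧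
    -- Heterogeneous lower levels.
    (∀ L μ ρ : ℝ, 0 < μ → μ ≤ L → 0 ≤ ρ → ρ < 1 →
      ∃ ηbar γbar : ℝ, 0 < ηbar ∧ 0 < γbar ∧
      ∀ ηy γ : ℝ, 0 < ηy → ηy ≤ ηbar → 0 < γ → γ ≤ γbar →
      ∃ α : ℝ, 0 < α ∧ α < 1 ∧
      ∀ (n : ℕ) (Lf0 Lg2 ηx : ℝ), 0 < n → 0 ≤ Lf0 → 0 ≤ Lg2 →
        0 < ηx → ηx < (1 - ρ) ^ 2 / (4 * √(6 * n) * (L / μ) * Lf L Lf0 Lg2 μ) →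
      ∃ C : ℝ, 0 < C ∧
      ∀ (p q : ℕ) (W : Matrix (Fin n) (Fin n) ℝ) (hW : W.IsHermitian)
        (f g : Fin n → Vec p → Vec q → ℝ)
        (y₀ : Fin n → Vec q) (Z₀ : Fin n → Vec p →L[ℝ] Vec q),
        Regular L Lf0 Lg2 μ f g →
        W ∈ doublyStochastic ℝ (Fin n) → rho W hW = ρ →
        BddBelow (Set.range (Phi f g)) →
        Differentiable ℝ (Phi f g) ∧
        ∀ (start : TrackerStart) (T N K : ℕ) (ζ : ℝ), 0 ≤ ζ →
          (start = .restarted →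
            ∀ k ≤ K, hetero g (het f g W ηx ηy γ T N start y₀ Z₀ k).x ≤ ζ) →
          1 / ((K : ℝ) + 1) * ∑ k ∈ Finset.range (K + 1),
              ‖gradient (Phi f g) (avg (het f g W ηx ηy γ T N start y₀ Z₀ k).x)‖ ^ 2
            ≤ 6 / (ηx * (K + 1)) *
                (Phi f g (avg (het f g W ηx ηy γ T N start y₀ Z₀ 0).x) - ⨅ x, Phi f g x)
              + specNorm (het f g W ηx ηy γ T N start y₀ Z₀ 0).h ^ 2 / (K + 1)
              + C * (1 + hetD0 g y₀ Z₀ + ζ) * (α ^ T + α ^ N + 1 / ((K : ℝ) + 1))) := by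
  refine ⟨fun L Lf0 Lg2 hL h0 h2 => ?_, fun L μ ρ hμ0 hμL hρ0 hρ1 => ?_⟩
  · refine ⟨5248, 99 * (2 * (L + Lf0 * Lg2 / L)) ^ 2 + 88 * L ^ 2 + 1, by norm_num, by positivity,
      fun n p q μ ηx ηy T N W hW f g y₀ v₀ hn hμ0 hμL hR hWd hρ hgg hb hηx hηx' hηy hηy' hT hN =>
        ⟨fun x => (hasGradientAt_Phi hn hμ0 hμL hR.upper hR.lower x).differentiableAt,
          fun K => hom_convergence hL h0 h2 y₀ v₀ hn hμ0 hμL hR hWd hρ hgg hb hηx hηx' hηy hηy'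
            hT hN K⟩⟩
  · refine ⟨trackStep L μ ρ, trackStep L μ ρ, trackStep_pos hμ0 hμL hρ1, trackStep_pos hμ0 hμL hρ1,
      -- The common rate is the worse of those of the inner loop and of the oracle.
      fun ηy γ hηy hηy' hγ hγ' => ⟨max (trackRate μ ρ ηy) (trackRate μ ρ γ),
        lt_max_of_lt_left (trackRate_pos hρ0),
        max_lt (trackRate_lt_one hμ0 hηy hρ1) (trackRate_lt_one hμ0 hγ hρ1),
        fun n Lf0 Lg2 ηx hn h0 h2 hηx hηx' =>
          ⟨hetConst L Lf0 Lg2 μ ρ ηx n, hetConst_pos hμ0 hμL hρ1, ?_⟩⟩⟩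
    intro p q W hW f g y₀ Z₀ hR hWd hρ hb
    -- The constants were chosen from the number `ρ` before `W`; only now is it identified with `rho
    -- W hW`.
    subst hρ
    exact ⟨fun x => (hasGradientAt_Phi hn hμ0 hμL hR.upper hR.lower x).differentiableAt,
      fun start T N K ζ hζ0 hζ => het_convergence hn hμ0 hμL h0 h2 hR hWd hρ1 hb hηx hηx' hηy hηy'
        hγ hγ' (max_lt (trackRate_lt_one hμ0 hηy hρ1) (trackRate_lt_one hμ0 hγ hρ1)).le
        (le_max_left _ _) (le_max_right _ _) y₀ Z₀ start T N K hζ0 hζ⟩
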